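/- Let $X$ be a compact Kähler manifold of complex dimension $n$ with Kähler form $\omega=\sqrt{-1}\sum g_{\alpha\bar\beta}\,dz^\alpha\wedge d\bar z^\beta$, and let $\mathfrak E=(E,\phi)$ be a Higgs bundle over $X$: $E$ is a holomorphic vector bundle and $\phi$ is a holomorphic $\mathrm{End}\,E$-valued $(1,0)$-form with $\phi\wedge\phi=0$. For a smooth Hermitian metric $h$ on $E$ let $D_h=D'_h+\bar\partial_E$ be its Chern connection, let $\phi^*_h$ be the adjoint of $\phi$, $h(\phi^*_hs,s')=h(s,\phi s')$, and let $\mathcal D'_h=D'_h+\phi^*_h$, acting on endomorphisms $M$ of $E$ by $\mathcal D'_hM=D'_hM+[\phi^*_h,M]$. Let $\mathcal R_h$ be the curvature of the Hitchin–Simpson connection $D_h+\phi+\phi^*_h$, let $\mathcal K_h=\sqrt{-1}\Lambda\mathcal R_h=\sqrt{-1}\Lambda(\mathcal R_h^{1,1})$ be its mean curvature ($\Lambda$ being the adjoint of $\omega\wedge\cdot\,$, so that $\mathcal K_h=\sum g^{\alpha\bar\beta}(\mathcal R_h)_{\alpha\bar\beta}$), and put $$\mathcal J(h)=\frac12\int_X|\mathcal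 K_h|^2\,\omega^n,\qquad |\mathcal K_h|^2=\mathrm{tr}(\mathcal K_h\circ(\mathcal K_h)^*_h).$$ Let $\langle\psi,\eta\rangle=\int_X(\psi,\eta)\,\omega^n/n!$ be the $L^2$ Hermitian inner product of $\mathrm{End}\,E$-valued $1$-forms, where $(\cdot,\cdot)$ is the pointwise Hermitian inner product given by $h$ and $g$, with $(dz^\alpha,dz^\beta)=g^{\alpha\bar\beta}$. Let $\varepsilon>0$ and let $h_t$, $-\varepsilon\le t\le\varepsilon$, be a smooth one-parameter family of Hermitian metrics on $E$ with $h_0=h$. Let $v=h^{-1}\partial_th_t|_{t=0}$ be the endomorphism of $E$ determined by $\partial_th_t(s,s')|_{t=0}=h(s,vs')$. Then the integrals involved converge, $t\mapsto\mathcal J(h_t)$ is differentiable at $t=0$, and $$\partial_t\mathcal J(h_t)\big|_{t=0}=n!\,\langle\mathcal D'_hv,\mathcal D'_h\mathcal K_h\rangle=\int_X(\mathcal D'_hv,\mathcal D'_h\mathcal K_h)\,\omega^n .$$ -/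

import Mathlib

open scoped Manifold ContDiff

noncomputable section

namespace HiggsBundle

open Bundle MeasureTheory Matrix

/-! ### Local frames

The base `X` is a complex manifold modelled on `Fin n → ℂ`, and `V` is a complex vector bundle over
it with fibre `Fin r → ℂ`.  The preferred chart and the preferred trivialization at a point `p` are
used to write objects in local coordinates and in a local (holomorphic) frame around `p`.
The tangent bundle is treated in the same way, with `r = n`; its preferred trivialization at `p` is
the one that is given by the coordinate vector fields of the preferred chart at `p`. -/

section Frames

variable (n r : ℕ) {X : Type*} [TopologicalSpace X] [ChartedSpace (Fin n → ℂ) X]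
  (V : X → Type*) [TopologicalSpace (TotalSpace (Fin r → ℂ) V)]
  [∀ x, AddCommGroup (V x)] [∀ x, Module ℂ (V x)] [∀ x, TopologicalSpace (V x)]
  [FiberBundle (Fin r → ℂ) V] [VectorBundle ℂ (Fin r → ℂ) V]

/-- The point of `X` with coordinates `z` in the preferred chart at `p`. -/
def pt {n : ℕ} {X : Type*} [TopologicalSpace X] [ChartedSpace (Fin n → ℂ) X]
    (p : X) (z : Fin n → ℂ) : X :=
  (chartAt (Fin n → ℂ) p).symm z

/-- The coordinates of `p` itself in the preferred chart at `p`. -/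
def center (p : X) : Fin n → ℂ := chartAt (Fin n → ℂ) p p

/-- The open set of coordinates (in the chart at `p`) over which the frame of `V` at `p` lives. -/
def coordDomain (p : X) : Set (Fin n → ℂ) :=
  {z | z ∈ (chartAt (Fin n → ℂ) p).target ∧
    pt p z ∈ (trivializationAt (Fin r → ℂ) V p).baseSet}

/-- The vector of `V y` with components `a` in the frame of `V` around `p`. -/
def vec (p y : X) : (Fin r → ℂ) →ₗ[ℂ] V y :=
  (trivializationAt (Fin r → ℂ) V p).symmₗ ℂ y

/-- The components of a vector of `V y` in the frame of `V` around `p`. -/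
def comps (p y : X) : V y →ₗ[ℂ] (Fin r → ℂ) :=
  (trivializationAt (Fin r → ℂ) V p).linearMapAt ℂ y

/-- The matrix of an endomorphism of `V y` in the frame around `p`. -/
def endToMatrix (p y : X) (M : Module.End ℂ (V y)) : Matrix (Fin r) (Fin r) ℂ :=
  LinearMap.toMatrix' (comps r V p y ∘ₗ M ∘ₗ vec r V p y)

/-- The endomorphism of `V y` with a given matrix in the frame around `p`. -/
def endOfMatrix (p y : X) (A : Matrix (Fin r) (Fin r) ℂ) : Module.End ℂ (V y) :=
  vec r V p y ∘ₗ Matrix.toLin' A ∘ₗ comps r V p y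

/-- The Gram matrix `G i j = h(e_j, e_i)` of a sesquilinear form (linear in the first variable) in
the frame `e` around `p`, as a function of the coordinates `z`.  In terms of components
`h(s, s') = s'ᴴ G s`. -/
def gramMatrix (h : ∀ x, V x →ₗ[ℂ] V x →ₗ⋆[ℂ] ℂ) (p : X) (z : Fin n → ℂ) :
    Matrix (Fin r) (Fin r) ℂ :=
  Matrix.of fun i j => h (pt p z) (vec r V p (pt p z) (Pi.single j 1))
    (vec r V p (pt p z) (Pi.single i 1))

/-- A smooth (`C^∞`) Hermitian metric on `V`, linear in the first variable and conjugate linear in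
the second one. -/
structure HermitianMetric where
  /-- the Hermitian inner product on each fibre -/
  form : ∀ x, V x →ₗ[ℂ] V x →ₗ⋆[ℂ] ℂ
  conj_symm : ∀ x s s', form x s s' = starRingEnd ℂ (form x s' s)
  pos : ∀ x s, s ≠ 0 → 0 < (form x s s).re
  smooth : ∀ p i j,
    ContDiffOn ℝ ∞ (fun z => gramMatrix n r V form p z i j) (coordDomain n r V p)

variable {n r V}

/-- The Gram matrix of a Hermitian metric in the frame around `p`, at the coordinates `z`. -/
def HermitianMetric.gram (h : HermitianMetric n r V) (p : X) (z : Fin n → ℂ) :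
    Matrix (Fin r) (Fin r) ℂ :=
  gramMatrix n r V h.form p z

/-- The family `h t`, `-ε ≤ t ≤ ε`, depends smoothly on `t` and the point of `X` jointly. -/
def IsSmoothFamily (ε : ℝ) (h : ℝ → HermitianMetric n r V) : Prop :=
  ∀ p i j, ContDiffOn ℝ ∞ (fun q : ℝ × (Fin n → ℂ) => (h q.1).gram p q.2 i j)
    (Set.Icc (-ε) ε ×ˢ coordDomain n r V p)

/-- Hermitian conjugation of a matrix with respect to the Gram matrix `G`:
`h(M* s, s') = h(s, M s')`. -/
def adj {r : ℕ} (G M : Matrix (Fin r) (Fin r) ℂ) : Matrix (Fin r) (Fin r) ℂ :=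
  G⁻¹ * Mᴴ * G

end Frames

/-! ### Derivatives in `ℂⁿ` -/

section Derivatives

variable {n r : ℕ}

/-- The entrywise real directional derivative of a matrix valued function. -/
def dMat (A : (Fin n → ℂ) → Matrix (Fin r) (Fin r) ℂ) (z u : Fin n → ℂ) :
    Matrix (Fin r) (Fin r) ℂ :=
  Matrix.of fun i j => fderiv ℝ (fun z' => A z' i j) z u

/-- The `(1,0)`-part `∂A`, evaluated at the real tangent vector `u`; it is complex linear in `u`. -/
def delMat (A : (Fin n → ℂ) → Matrix (Fin r) (Fin r) ℂ) (z u : Fin n → ℂ) :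
    Matrix (Fin r) (Fin r) ℂ :=
  (1 / 2 : ℂ) • (dMat A z u - Complex.I • dMat A z (Complex.I • u))

end Derivatives

/-! ### Higgs fields and Kähler metrics -/

section Higgs

variable (n r : ℕ) {X : Type*} [TopologicalSpace X] [ChartedSpace (Fin n → ℂ) X]
  [IsManifold 𝓘(ℂ, Fin n → ℂ) ω X]
  (V : X → Type*) [TopologicalSpace (TotalSpace (Fin r → ℂ) V)]
  [∀ x, AddCommGroup (V x)] [∀ x, Module ℂ (V x)] [∀ x, TopologicalSpace (V x)]
  [FiberBundle (Fin r → ℂ) V] [VectorBundle ℂ (Fin r → ℂ) V]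

/-- The holomorphic tangent bundle of `X`, identified with the real tangent bundle with its complex
structure.  A complex valued differential form at `x` is a function of real tangent vectors; a form
of type `(1,0)` is complex linear, one of type `(0,1)` is conjugate linear. -/
abbrev TX (n : ℕ) {X : Type*} [TopologicalSpace X] [ChartedSpace (Fin n → ℂ) X] :
    X → Type :=
  (TangentSpace 𝓘(ℂ, Fin n → ℂ) : X → Type)

/-- The matrix, in the frame around `p` and at the coordinates `z`, of `φ(u)`, for an
`End V`-valued form `φ` and the constant vector field `u` in the coordinates around `p`. -/
def formMatrix (φ : ∀ x, TX n x → Module.End ℂ (V x)) (p : X) (z u : Fin n → ℂ) :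
    Matrix (Fin r) (Fin r) ℂ :=
  endToMatrix r V p (pt p z) (φ (pt p z) (vec n (TX n) p (pt p z) u))

/-- A Higgs field on `V`: a holomorphic `End V`-valued `(1,0)`-form `φ` with `φ ∧ φ = 0`. -/
structure HiggsField where
  /-- the `(1,0)`-form -/
  form : ∀ x, TX n x →ₗ[ℂ] Module.End ℂ (V x)
  holomorphic : ∀ p u i j,
    DifferentiableOn ℂ (fun z => formMatrix n r V (fun x => form x) p z u i j)
      (coordDomain n r V p)
  wedge_self : ∀ x u w, form x u * form x w - form x w * form x u = 0

variable {n r V}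

/-- The Kähler form `√-1 ∑ g_{αβ̄} dz^α ∧ dz̄^β`, in the coordinates around `p`, evaluated at
`u, w`: this is `√-1 (g(u, w) - g(w, u)) = -2 Im g(u, w)`. -/
def kahlerForm (g : HermitianMetric n n (TX n (X := X))) (p : X) (z u w : Fin n → ℂ) : ℝ :=
  -2 * (g.form (pt p z) (vec n (TX n) p (pt p z) u) (vec n (TX n) p (pt p z) w)).im

/-- The Hermitian metric `g` on the tangent bundle is Kähler: its Kähler form is closed. -/
def IsKahler (g : HermitianMetric n n (TX n (X := X))) : Prop :=
  ∀ p : X, ∀ z ∈ (chartAt (Fin n → ℂ) p).target, ∀ u v w : Fin n → ℂ,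
    fderiv ℝ (fun z' => kahlerForm g p z' v w) z u
      + fderiv ℝ (fun z' => kahlerForm g p z' w u) z v
      + fderiv ℝ (fun z' => kahlerForm g p z' u v) z w = 0

/-- The volume measure `ωⁿ / n!` on `X`.  In the chart at `p`, where `ω = √-1 ∑ g_{αβ̄} dz^α ∧ dz̄^β`
and `√-1 dz ∧ dz̄ = 2 dx ∧ dy`, it has the density `2ⁿ det (g_{αβ̄})` with respect to Lebesgue
measure.  These local measures agree on the overlaps of the charts, and the measure on `X` is the
least one that dominates all of them. -/
def kahlerVolume [MeasurableSpace X] (g : HermitianMetric n n (TX n (X := X))) : Measure X :=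
  ⨆ p : X, Measure.map (pt p)
    (((volume : Measure (Fin n → ℂ)).withDensity
      fun z => ENNReal.ofReal (2 ^ n * (g.gram p z).det.re)).restrict
        (chartAt (Fin n → ℂ) p).target)

/-! ### The Hitchin-Simpson connection and its mean curvature -/

/-- The connection form `G⁻¹ ∂G` of the Chern connection of `h` in the holomorphic frame around `p`;
in such a frame `D'' = ∂̄` and `D'_h = ∂ + G⁻¹ ∂G`. -/
def chernForm (h : HermitianMetric n r V) (p : X) (z u : Fin n → ℂ) :
    Matrix (Fin r) (Fin r) ℂ :=
  (h.gram p z)⁻¹ * delMat (h.gram p) z u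

/-- The matrix of the Higgs field in the frame around `p`. -/
def HiggsField.mat (φ : HiggsField n r V) (p : X) (z u : Fin n → ℂ) :
    Matrix (Fin r) (Fin r) ℂ :=
  formMatrix n r V (fun x => φ.form x) p z u

/-- The matrix of the `(0,1)`-form `φ*_h`, the adjoint of the Higgs field. -/
def HiggsField.adjMat (φ : HiggsField n r V) (h : HermitianMetric n r V) (p : X)
    (z u : Fin n → ℂ) : Matrix (Fin r) (Fin r) ℂ :=
  adj (h.gram p z) (φ.mat p z u)

/-- The connection form of the Hitchin-Simpson connection `D_h + φ + φ*_h`. -/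
def hsForm (φ : HiggsField n r V) (h : HermitianMetric n r V) (p : X) (z u : Fin n → ℂ) :
    Matrix (Fin r) (Fin r) ℂ :=
  chernForm h p z u + φ.mat p z u + φ.adjMat h p z u

/-- The curvature `dA + A ∧ A` of the Hitchin-Simpson connection, a matrix valued 2-form, evaluated
at the constant vector fields `u, w`. -/
def hsCurvature (φ : HiggsField n r V) (h : HermitianMetric n r V) (p : X)
    (z u w : Fin n → ℂ) : Matrix (Fin r) (Fin r) ℂ :=
  dMat (fun z' => hsForm φ h p z' w) z u - dMat (fun z' => hsForm φ h p z' u) z w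
    + (hsForm φ h p z u * hsForm φ h p z w - hsForm φ h p z w * hsForm φ h p z u)

/-- The component `Ω_{αβ̄} = Ω(∂_α, ∂_β̄)` of a 2-form, where `∂_α = (e_α - √-1 (√-1 e_α)) / 2` and
`∂_β̄ = (e_β + √-1 (√-1 e_β)) / 2` in the complexified tangent space (the factor in front is the
scalar, the one in the parentheses is the complex structure) and `Ω` is extended complex
bilinearly. -/
def component11 (Om : (Fin n → ℂ) → (Fin n → ℂ) → Matrix (Fin r) (Fin r) ℂ)
    (a b : Fin n) : Matrix (Fin r) (Fin r) ℂ :=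
  let ea : Fin n → ℂ := Pi.single a 1
  let eb : Fin n → ℂ := Pi.single b 1
  (1 / 4 : ℂ) • (Om ea eb + Complex.I • Om ea (Complex.I • eb)
    - Complex.I • Om (Complex.I • ea) eb + Om (Complex.I • ea) (Complex.I • eb))

/-- The coefficient `g^{αβ̄}` at the point `p`, where `∑_β g^{αβ̄} g_{γβ̄} = δ_{αγ}`. -/
def gInv (g : HermitianMetric n n (TX n (X := X))) (p : X) (a b : Fin n) : ℂ :=
  (g.gram p (center n p))⁻¹ a b

/-- The Hitchin-Simpson mean curvature `K_h = √-1 Λ R_h`, an endomorphism of `V`: for a 2-form `Ω`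
one has `√-1 Λ Ω = ∑ g^{αβ̄} Ω_{αβ̄}`. -/
def meanCurvature (g : HermitianMetric n n (TX n (X := X))) (φ : HiggsField n r V)
    (h : HermitianMetric n r V) (p : X) : Module.End ℂ (V p) :=
  endOfMatrix r V p p
    (∑ a, ∑ b, gInv g p a b • component11 (hsCurvature φ h p (center n p)) a b)

/-- The operator `𝒟'_h = D'_h + φ*_h` on endomorphisms of `V`; it is the `End V`-valued 1-form
`𝒟'_h M = ∂M + [G⁻¹ ∂G, M] + [φ*_h, M]`. -/
def dPrime (φ : HiggsField n r V) (h : HermitianMetric n r V)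
    (M : ∀ x, Module.End ℂ (V x)) (p : X) (u : TX n p) : Module.End ℂ (V p) :=
  let z := center n p
  let w := comps n (TX n) p p u
  let m := fun z' => endToMatrix r V p (pt p z') (M (pt p z'))
  endOfMatrix r V p p
    (delMat m z w + (chernForm h p z w * m z - m z * chernForm h p z w)
      + (φ.adjMat h p z w * m z - m z * φ.adjMat h p z w))

/-! ### Inner products and the functional -/

/-- The pointwise norm squared `|M|² = tr(M ∘ M*_h)` of an endomorphism. -/
def endNormSq (h : HermitianMetric n r V) (M : ∀ x, Module.End ℂ (V x)) (p : X) : ℝ :=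
  let m := endToMatrix r V p p (M p)
  (Matrix.trace (m * adj (h.gram p (center n p)) m)).re

/-- The coefficient `ψ_α` of `dz^α` in an `End V`-valued 1-form `ψ`, at the point `p`. -/
def coeff10 (ψ : ∀ x, TX n x → Module.End ℂ (V x)) (p : X) (a : Fin n) :
    Matrix (Fin r) (Fin r) ℂ :=
  let e : Fin n → ℂ := Pi.single a 1
  (1 / 2 : ℂ) • (formMatrix n r V ψ p (center n p) e
    - Complex.I • formMatrix n r V ψ p (center n p) (Complex.I • e))

/-- The coefficient `ψ_ᾱ` of `dz̄^α` in an `End V`-valued 1-form `ψ`, at the point `p`. -/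
def coeff01 (ψ : ∀ x, TX n x → Module.End ℂ (V x)) (p : X) (a : Fin n) :
    Matrix (Fin r) (Fin r) ℂ :=
  let e : Fin n → ℂ := Pi.single a 1
  (1 / 2 : ℂ) • (formMatrix n r V ψ p (center n p) e
    + Complex.I • formMatrix n r V ψ p (center n p) (Complex.I • e))

/-- The pointwise Hermitian inner product of `End V`-valued 1-forms, given by `g` and `h`:
`(ψ, η) = ∑ g^{αβ̄} tr(ψ_α (η_β)*) + ∑ g^{βᾱ} tr(ψ_ᾱ (η_β̄)*)`. -/
def formInner (g : HermitianMetric n n (TX n (X := X))) (h : HermitianMetric n r V)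
    (ψ η : ∀ x, TX n x → Module.End ℂ (V x)) (p : X) : ℂ :=
  let G := h.gram p (center n p)
  ∑ a, ∑ b, (gInv g p a b * Matrix.trace (coeff10 ψ p a * adj G (coeff10 η p b))
    + gInv g p b a * Matrix.trace (coeff01 ψ p a * adj G (coeff01 η p b)))

variable [MeasurableSpace X]

/-- The `L²` Hermitian inner product `⟨ψ, η⟩ = ∫ (ψ, η) ωⁿ / n!` of `End V`-valued 1-forms. -/
def l2Inner (g : HermitianMetric n n (TX n (X := X))) (h : HermitianMetric n r V)
    (ψ η : ∀ x, TX n x → Module.End ℂ (V x)) : ℂ :=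
  ∫ p, formInner g h ψ η p ∂(kahlerVolume g)

/-- The Kobayashi functional `𝒥(h) = (1/2) ∫ |K_h|² ωⁿ`, where `ωⁿ` is `n!` times the volume
measure. -/
def kobayashiFunctional (g : HermitianMetric n n (TX n (X := X))) (φ : HiggsField n r V)
    (h : HermitianMetric n r V) : ℝ :=
  (1 / 2 : ℝ) * ((n.factorial : ℝ) *
    ∫ p, endNormSq h (meanCurvature g φ h) p ∂(kahlerVolume g))

end Higgs

end HiggsBundle

end

/-! In a holomorphic frame with Gram matrix `G`, the mean curvature is `K = ∑ g^{ab̄} (-∂_b̄ (G⁻¹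
∂_a G) + [φ_a, φ*_b])`, the coefficient of the `(1,1)`-part of the curvature. Put `v = G⁻¹ ∂ₜG`.
Then `∂ₜ(G⁻¹ ∂G) = D'v` and `∂ₜφ* = [φ*, v]`, hence `∂ₜK = ∑ g^{ab̄} (-∂_b̄ D'_a v + [φ_a, [φ*_b,
v]])` (`IsGramFamily.dtM_meanL`).

Since `K` is self-adjoint (`IsGram.adj_meanL`), `|K|² = tr(K²)`, so half its time derivative is
`tr(K ∂ₜK)`. Self-adjointness also gives `∂̄K = (D'K)*`. The product rule for `∂̄` and the cyclicity
of the trace then yield the pointwise identity `(𝒟'v, 𝒟'K) = tr(K ∂ₜK) + ∑ g^{ab̄} ∂_b̄ tr(K D'_a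
v)` (`IsGram.trace_variation`, `formInner_eq`).

The last sum integrates to zero. On a Kähler manifold `∑_b ∂_b̄ (g^{ab̄} det g) = 0`
(`IsGram.sum_db_inv_mul_det`), so multiplication by `det g` makes it a Euclidean divergence; a
partition of unity reduces the global statement to compactly supported functions on `ℂⁿ`
(`integral_divTrace`). Differentiation under the integral sign (`hasDerivAt_integral_density`)
finishes the argument.

The global objects at a point are defined in the preferred chart and frame of that very point.
Integrating or differentiating them in one fixed chart therefore requires their transformation laws
(`IsTransition`), which rest on holomorphic transition functions being smooth with holomorphic
derivatives. The volume, a supremum of chart measures, must likewise be shown to restrict to the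
expected measure on each chart (`kahlerVolume_restrict`). -/

open scoped Manifold ContDiff

noncomputable section

namespace HiggsBundle

open Bundle MeasureTheory Matrix Filter Topology
open scoped ComplexOrder

set_option linter.unusedSectionVars false

/-! ### One operator `cd` for `∂`, `∂̄` and `∂ₜ`: `c = -I` or `c = I` with `b = I • a`, or `c = 1`
with `a = b`. -/

section DirectionalDerivatives

variable {W : Type*} [NormedAddCommGroup W] [NormedSpace ℝ W]

/-- The derivative of `f` along the complex tangent vector `(a + c b) / 2`, where `a` and `b` are
real vectors and `c` is a complex number. -/
def cd (c : ℂ) (a b : W) (f : W → ℂ) (x : W) : ℂ :=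
  (1 / 2 : ℂ) * (fderiv ℝ f x a + c * fderiv ℝ f x b)

variable {c : ℂ} {a b x : W} {f g : W → ℂ}

lemma cd_congr (h : f =ᶠ[𝓝 x] g) : cd c a b f x = cd c a b g x := by
  simp only [cd, h.fderiv_eq]

lemma cd_const (y : ℂ) : cd c a b (fun _ => y) x = 0 := by simp [cd]

lemma cd_add (hf : ContDiffAt ℝ ∞ f x) (hg : ContDiffAt ℝ ∞ g x) :
    cd c a b (fun y => f y + g y) x = cd c a b f x + cd c a b g x := by
  simp only [cd, fderiv_fun_add (hf.differentiableAt (by simp)) (hg.differentiableAt (by simp)),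
    _root_.add_apply]
  ring

lemma cd_sub (hf : ContDiffAt ℝ ∞ f x) (hg : ContDiffAt ℝ ∞ g x) :
    cd c a b (fun y => f y - g y) x = cd c a b f x - cd c a b g x := by
  simp only [cd, fderiv_fun_sub (hf.differentiableAt (by simp)) (hg.differentiableAt (by simp)),
    _root_.sub_apply]
  ring

lemma cd_neg : cd c a b (fun y => -f y) x = -cd c a b f x := by
  simp only [cd, fderiv_fun_neg, _root_.neg_apply]
  ring

lemma cd_sum {ι : Type*} {s : Finset ι} {f : ι → W → ℂ}
    (hf : ∀ i ∈ s, ContDiffAt ℝ ∞ (f i) x) :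
    cd c a b (fun y => ∑ i ∈ s, f i y) x = ∑ i ∈ s, cd c a b (f i) x := by
  simp only [cd, fderiv_fun_sum fun i hi => (hf i hi).differentiableAt (by simp),
    _root_.sum_apply, Finset.mul_sum, ← Finset.sum_add_distrib]

lemma cd_mul (hf : ContDiffAt ℝ ∞ f x) (hg : ContDiffAt ℝ ∞ g x) :
    cd c a b (fun y => f y * g y) x = cd c a b f x * g x + f x * cd c a b g x := by
  simp only [cd, fderiv_fun_mul (hf.differentiableAt (by simp)) (hg.differentiableAt (by simp)),
    _root_.add_apply, _root_.smul_apply, smul_eq_mul]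
  ring

/-- Conjugation is real linear and conjugates only the scalar `c`; for `c = ±I` it exchanges `∂` and
`∂̄`. -/
lemma cd_star (hf : ContDiffAt ℝ ∞ f x) :
    cd c a b (fun y => star (f y)) x = star (cd (star c) a b f x) := by
  have h : fderiv ℝ (fun y => star (f y)) x =
      (Complex.conjCLE : ℂ →L[ℝ] ℂ).comp (fderiv ℝ f x) :=
    ((Complex.conjCLE : ℂ →L[ℝ] ℂ).hasFDerivAt.comp x
      (hf.differentiableAt (by simp)).hasFDerivAt).fderiv
  rw [cd, cd, h]
  simp

lemma contDiffAt_fderiv_apply (hf : ContDiffAt ℝ ∞ f x) (a : W) :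
    ContDiffAt ℝ ∞ (fun y => fderiv ℝ f y a) x :=
  (hf.fderiv_right (by simp)).clm_apply contDiffAt_const

lemma contDiffAt_cd (hf : ContDiffAt ℝ ∞ f x) : ContDiffAt ℝ ∞ (cd c a b f) x :=
  contDiffAt_const.mul ((contDiffAt_fderiv_apply hf a).add
    (contDiffAt_const.mul (contDiffAt_fderiv_apply hf b)))

lemma fderiv_cd (hf : ContDiffAt ℝ ∞ f x) (e : W) :
    fderiv ℝ (cd c a b f) x e =
      (1 / 2 : ℂ) * (fderiv ℝ (fderiv ℝ f) x e a + c * fderiv ℝ (fderiv ℝ f) x e b) := by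
  have h : DifferentiableAt ℝ (fderiv ℝ f) x :=
    (hf.fderiv_right (m := ∞) (by simp)).differentiableAt (by simp)
  have h1 (a : W) : HasFDerivAt (fun y => fderiv ℝ f y a)
      ((ContinuousLinearMap.apply ℝ ℂ a).comp (fderiv ℝ (fderiv ℝ f) x)) x :=
    (ContinuousLinearMap.apply ℝ ℂ a).hasFDerivAt.comp x h.hasFDerivAt
  have h2 := (((h1 a).fun_add ((h1 b).const_mul c)).const_mul (1 / 2 : ℂ)).fderiv
  have h3 : cd c a b f = fun y => (1 / 2 : ℂ) * (fderiv ℝ f y a + c * fderiv ℝ f y b) := rfl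
  rw [h3, h2]
  simp
  ring

/-- Symmetry of the second derivative. This covers both `∂∂̄ = ∂̄∂` and the commutation of `∂ₜ` with
`∂` and `∂̄`. -/
lemma cd_comm (hf : ContDiffAt ℝ ∞ f x) (c' : ℂ) (a' b' : W) :
    cd c a b (cd c' a' b' f) x = cd c' a' b' (cd c a b f) x := by
  have hs : IsSymmSndFDerivAt ℝ f x :=
    hf.isSymmSndFDerivAt (by simpa using (show ((2 : ℕ) : WithTop ℕ∞) ≤ ∞ from
      WithTop.coe_le_coe.2 le_top))
  rw [cd, cd]
  simp only [fderiv_cd hf]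
  rw [hs a a', hs a b', hs b a', hs b b']
  ring

/-- Rewrites a space derivative at fixed time as a derivative on `ℝ × W`, where it can be commuted
with the time derivative. -/
lemma cd_slice {f : ℝ × W → ℂ} {t : ℝ} {z a b : W} (hf : ContDiffAt ℝ ∞ f (t, z)) :
    cd c a b (fun y => f (t, y)) z = cd c (0, a) (0, b) f (t, z) := by
  have h : fderiv ℝ (fun y => f (t, y)) z =
      (fderiv ℝ f (t, z)).comp (ContinuousLinearMap.inr ℝ ℝ W) :=
    ((hf.differentiableAt (by simp)).hasFDerivAt.comp z (hasFDerivAt_prodMk_right t z)).fderiv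
  simp [cd, h]

lemma contDiffAt_slice {f : ℝ × W → ℂ} {t : ℝ} {z : W} (hf : ContDiffAt ℝ ∞ f (t, z)) :
    ContDiffAt ℝ ∞ (fun y => f (t, y)) z :=
  hf.comp z (contDiff_prodMk_right t).contDiffAt

end DirectionalDerivatives

/-! ### Wirtinger derivatives of functions on `ℂⁿ` -/

section Wirtinger

variable {n : ℕ}

/-- The `(1,0)`-part of the derivative of `f`. -/
abbrev dl (f : (Fin n → ℂ) → ℂ) (z u : Fin n → ℂ) : ℂ := cd (-Complex.I) u (Complex.I • u) f z

/-- The `(0,1)`-part of the derivative of `f`. -/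
abbrev db (f : (Fin n → ℂ) → ℂ) (z u : Fin n → ℂ) : ℂ := cd Complex.I u (Complex.I • u) f z

lemma complex_smul_eq {M : Type*} [AddCommGroup M] [Module ℂ M] [Module ℝ M]
    [IsScalarTower ℝ ℂ M] (k : ℂ) (u : M) : k • u = k.re • u + k.im • Complex.I • u := by
  conv_lhs => rw [← Complex.re_add_im k, add_smul, mul_smul]
  rw [← Complex.coe_algebraMap, algebraMap_smul, algebraMap_smul]

variable {f : (Fin n → ℂ) → ℂ} {z : Fin n → ℂ}

lemma fderiv_complex_smul (k : ℂ) (u : Fin n → ℂ) :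
    fderiv ℝ f z (k • u) = k.re * fderiv ℝ f z u + k.im * fderiv ℝ f z (Complex.I • u) := by
  rw [complex_smul_eq k u, map_add, map_smul, map_smul, Complex.real_smul, Complex.real_smul]

lemma fderiv_I_smul_smul (k : ℂ) (u : Fin n → ℂ) :
    fderiv ℝ f z (Complex.I • k • u) =
      k.re * fderiv ℝ f z (Complex.I • u) - k.im * fderiv ℝ f z u := by
  rw [smul_smul, fderiv_complex_smul]
  simp [sub_eq_add_neg, add_comm]

lemma dl_smul (k : ℂ) (u : Fin n → ℂ) : dl f z (k • u) = k * dl f z u := by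
  simp only [cd]
  rw [fderiv_I_smul_smul, fderiv_complex_smul k u]
  conv_rhs => rw [← Complex.re_add_im k]
  linear_combination (1 / 2 * (k.im : ℂ) * fderiv ℝ f z (Complex.I • u)) * Complex.I_mul_I

lemma db_smul (k : ℂ) (u : Fin n → ℂ) : db f z (k • u) = star k * db f z u := by
  simp only [cd]
  rw [fderiv_I_smul_smul, fderiv_complex_smul k u]
  have hk : star k = k.re - k.im * Complex.I := by
    apply Complex.ext <;> simp
  rw [hk]
  linear_combination (1 / 2 * (k.im : ℂ) * fderiv ℝ f z (Complex.I • u)) * Complex.I_mul_I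

lemma dl_sum {ι : Type*} (s : Finset ι) (u : ι → Fin n → ℂ) :
    dl f z (∑ i ∈ s, u i) = ∑ i ∈ s, dl f z (u i) := by
  simp only [cd, Finset.smul_sum, map_sum, Finset.sum_add_distrib, Finset.mul_sum, mul_add]

lemma db_sum {ι : Type*} (s : Finset ι) (u : ι → Fin n → ℂ) :
    db f z (∑ i ∈ s, u i) = ∑ i ∈ s, db f z (u i) := by
  simp only [cd, Finset.smul_sum, map_sum, Finset.sum_add_distrib, Finset.mul_sum, mul_add]

lemma eq_sum_single (u : Fin n → ℂ) : u = ∑ a, u a • (Pi.single a 1 : Fin n → ℂ) :=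
  pi_eq_sum_univ' u

lemma dl_eq_sum (u : Fin n → ℂ) : dl f z u = ∑ a, u a * dl f z (Pi.single a 1) := by
  conv_lhs => rw [eq_sum_single u, dl_sum]
  simp only [dl_smul]

lemma db_eq_sum (u : Fin n → ℂ) : db f z u = ∑ a, star (u a) * db f z (Pi.single a 1) := by
  conv_lhs => rw [eq_sum_single u, db_sum]
  simp only [db_smul]

lemma dl_of_differentiableAt (hf : DifferentiableAt ℂ f z) (u : Fin n → ℂ) :
    dl f z u = fderiv ℂ f z u := by
  simp only [cd, hf.fderiv_restrictScalars ℝ, ContinuousLinearMap.coe_restrictScalars', map_smul,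
    smul_eq_mul]
  linear_combination (-1 / 2 * fderiv ℂ f z u) * Complex.I_mul_I

/-- Cauchy–Riemann: the real derivative is complex linear, so the two terms cancel by `I² = -1`. -/
lemma db_of_differentiableAt (hf : DifferentiableAt ℂ f z) (u : Fin n → ℂ) : db f z u = 0 := by
  simp only [cd, hf.fderiv_restrictScalars ℝ, ContinuousLinearMap.coe_restrictScalars', map_smul,
    smul_eq_mul]
  linear_combination (1 / 2 * fderiv ℂ f z u) * Complex.I_mul_I

/-- The derivative of a holomorphic map commutes with `I`, so composition with it preserves the
types `(1,0)` and `(0,1)`. -/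
lemma cd_comp {k : ℂ} {τ : (Fin n → ℂ) → (Fin n → ℂ)} (hτ : DifferentiableAt ℂ τ z)
    (hf : ContDiffAt ℝ ∞ f (τ z)) (u : Fin n → ℂ) :
    cd k u (Complex.I • u) (fun y => f (τ y)) z =
      cd k (fderiv ℂ τ z u) (Complex.I • fderiv ℂ τ z u) f (τ z) := by
  have h : fderiv ℝ (fun y => f (τ y)) z =
      (fderiv ℝ f (τ z)).comp ((fderiv ℂ τ z).restrictScalars ℝ) :=
    ((hf.differentiableAt (by simp)).hasFDerivAt.comp z
      (hτ.hasFDerivAt.restrictScalars ℝ)).fderiv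
  simp [cd, h]

end Wirtinger

/-! ### Entrywise calculus of matrix valued functions, independent of any norm on matrices -/

section MatrixCalculus

variable {W : Type*} [NormedAddCommGroup W] [NormedSpace ℝ W] {r : ℕ}

/-- Smoothness at a point of a matrix valued function. -/
def SmoothMat (A : W → Matrix (Fin r) (Fin r) ℂ) (x : W) : Prop :=
  ∀ i j, ContDiffAt ℝ ∞ (fun y => A y i j) x

/-- The entrywise version of `cd` for matrix valued functions. -/
def cdM (c : ℂ) (a b : W) (A : W → Matrix (Fin r) (Fin r) ℂ) (x : W) : Matrix (Fin r) (Fin r) ℂ :=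
  Matrix.of fun i j => cd c a b (fun y => A y i j) x

variable {c : ℂ} {a b x : W} {A B : W → Matrix (Fin r) (Fin r) ℂ} {f : W → ℂ}

lemma SmoothMat.add (hA : SmoothMat A x) (hB : SmoothMat B x) :
    SmoothMat (fun y => A y + B y) x := fun i j => (hA i j).add (hB i j)

lemma SmoothMat.sub (hA : SmoothMat A x) (hB : SmoothMat B x) :
    SmoothMat (fun y => A y - B y) x := fun i j => (hA i j).sub (hB i j)

lemma SmoothMat.neg (hA : SmoothMat A x) : SmoothMat (fun y => -A y) x := fun i j => (hA i j).neg

lemma SmoothMat.const (M : Matrix (Fin r) (Fin r) ℂ) : SmoothMat (fun _ => M) x :=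
  fun _ _ => contDiffAt_const

lemma SmoothMat.smul (hf : ContDiffAt ℝ ∞ f x) (hA : SmoothMat A x) :
    SmoothMat (fun y => f y • A y) x := fun i j => hf.mul (hA i j)

lemma SmoothMat.sum {ι : Type*} {s : Finset ι} {A : ι → W → Matrix (Fin r) (Fin r) ℂ}
    (hA : ∀ i ∈ s, SmoothMat (A i) x) : SmoothMat (fun y => ∑ i ∈ s, A i y) x := by
  intro j k
  simp only [Matrix.sum_apply]
  exact ContDiffAt.sum fun i hi => hA i hi j k

lemma SmoothMat.mul (hA : SmoothMat A x) (hB : SmoothMat B x) :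
    SmoothMat (fun y => A y * B y) x := by
  intro i j
  simp only [Matrix.mul_apply]
  exact ContDiffAt.sum fun k _ => (hA i k).mul (hB k j)

lemma contDiffAt_star (hf : ContDiffAt ℝ ∞ f x) : ContDiffAt ℝ ∞ (fun y => star (f y)) x :=
  (Complex.conjCLE : ℂ →L[ℝ] ℂ).contDiff.contDiffAt.comp x hf

lemma SmoothMat.conjTranspose (hA : SmoothMat A x) : SmoothMat (fun y => (A y)ᴴ) x :=
  fun i j => contDiffAt_star (hA j i)

lemma SmoothMat.trace (hA : SmoothMat A x) : ContDiffAt ℝ ∞ (fun y => (A y).trace) x :=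
  ContDiffAt.sum fun i _ => hA i i

lemma SmoothMat.det (hA : SmoothMat A x) : ContDiffAt ℝ ∞ (fun y => (A y).det) x := by
  simp only [Matrix.det_apply]
  exact ContDiffAt.sum fun σ _ => (contDiffAt_prod fun i _ => hA (σ i) i).const_smul _

lemma SmoothMat.congr (hA : SmoothMat A x) (h : B =ᶠ[𝓝 x] A) : SmoothMat B x :=
  fun i j => (hA i j).congr_of_eventuallyEq (h.mono fun y hy => by simp only [hy])

lemma SmoothMat.cdM (hA : SmoothMat A x) : SmoothMat (cdM c a b A) x :=
  fun i j => contDiffAt_cd (hA i j)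

lemma SmoothMat.eventually_det_ne (hA : SmoothMat A x) (hu : (A x).det ≠ 0) :
    ∀ᶠ y in 𝓝 x, (A y).det ≠ 0 :=
  hA.det.continuousAt.eventually_ne hu

lemma SmoothMat.inv (hA : SmoothMat A x) (hu : (A x).det ≠ 0) :
    SmoothMat (fun y => (A y)⁻¹) x := by
  intro i j
  -- By Cramer's rule, an adjugate entry is the determinant of `A` with one row replaced by a
  -- constant vector.
  have h : ContDiffAt ℝ ∞ (fun y => (A y).det⁻¹ * (A y).adjugate i j) x := by
    refine (hA.det.inv hu).mul ?_
    simp only [adjugate_apply]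
    refine SmoothMat.det fun k l => ?_
    by_cases hk : k = j
    · subst hk; simpa using contDiffAt_const
    · simpa [updateRow_ne hk] using hA k l
  simpa [Matrix.inv_def, Ring.inverse_eq_inv'] using h

lemma cdM_congr (h : A =ᶠ[𝓝 x] B) : cdM c a b A x = cdM c a b B x := by
  ext i j
  exact cd_congr (h.mono fun y hy => by simp only [hy])

lemma cdM_const (M : Matrix (Fin r) (Fin r) ℂ) : cdM c a b (fun _ => M) x = 0 := by
  ext i j; exact cd_const _

lemma cdM_add (hA : SmoothMat A x) (hB : SmoothMat B x) :
    cdM c a b (fun y => A y + B y) x = cdM c a b A x + cdM c a b B x := by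
  ext i j; exact cd_add (hA i j) (hB i j)

lemma cdM_sub (hA : SmoothMat A x) (hB : SmoothMat B x) :
    cdM c a b (fun y => A y - B y) x = cdM c a b A x - cdM c a b B x := by
  ext i j; exact cd_sub (hA i j) (hB i j)

lemma cdM_neg : cdM c a b (fun y => -A y) x = -cdM c a b A x := by
  ext i j; exact cd_neg

lemma cdM_smul (hf : ContDiffAt ℝ ∞ f x) (hA : SmoothMat A x) :
    cdM c a b (fun y => f y • A y) x = cd c a b f x • A x + f x • cdM c a b A x := by
  ext i j; exact cd_mul hf (hA i j)

lemma cdM_const_smul (k : ℂ) (hA : SmoothMat A x) :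
    cdM c a b (fun y => k • A y) x = k • cdM c a b A x := by
  rw [cdM_smul contDiffAt_const hA, cd_const, zero_smul, zero_add]

lemma cdM_sum {ι : Type*} {s : Finset ι} {A : ι → W → Matrix (Fin r) (Fin r) ℂ}
    (hA : ∀ i ∈ s, SmoothMat (A i) x) :
    cdM c a b (fun y => ∑ i ∈ s, A i y) x = ∑ i ∈ s, cdM c a b (A i) x := by
  ext j k
  simp only [cdM, Matrix.sum_apply, Matrix.of_apply]
  exact cd_sum fun i hi => hA i hi j k

lemma cdM_mul (hA : SmoothMat A x) (hB : SmoothMat B x) :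
    cdM c a b (fun y => A y * B y) x = cdM c a b A x * B x + A x * cdM c a b B x := by
  ext i j
  simp only [cdM, Matrix.mul_apply, Matrix.of_apply, Matrix.add_apply]
  rw [cd_sum fun k _ => (hA i k).mul (hB k j), ← Finset.sum_add_distrib]
  exact Finset.sum_congr rfl fun k _ => cd_mul (hA i k) (hB k j)

lemma cdM_conjTranspose (hA : SmoothMat A x) :
    cdM c a b (fun y => (A y)ᴴ) x = (cdM (star c) a b A x)ᴴ := by
  ext i j; exact cd_star (hA j i)

lemma cd_trace (hA : SmoothMat A x) :
    cd c a b (fun y => (A y).trace) x = (cdM c a b A x).trace :=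
  cd_sum fun i _ => hA i i

lemma cdM_inv (hA : SmoothMat A x) (hu : (A x).det ≠ 0) :
    cdM c a b (fun y => (A y)⁻¹) x = -((A x)⁻¹ * cdM c a b A x * (A x)⁻¹) := by
  -- Differentiate `A A⁻¹ = 1`, which holds near `x` because the determinant stays nonzero there.
  have h : cdM c a b (fun y => A y * (A y)⁻¹) x = 0 := by
    rw [← cdM_const (c := c) (a := a) (b := b) (x := x) (1 : Matrix (Fin r) (Fin r) ℂ)]
    exact cdM_congr ((hA.eventually_det_ne hu).mono fun y hy => mul_nonsing_inv _ hy.isUnit)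
  rw [cdM_mul hA (hA.inv hu)] at h
  have h2 : cdM c a b (fun y => (A y)⁻¹) x =
      (A x)⁻¹ * (A x * cdM c a b (fun y => (A y)⁻¹) x) := by
    rw [← Matrix.mul_assoc, nonsing_inv_mul _ hu.isUnit, Matrix.one_mul]
  rw [h2, eq_neg_of_add_eq_zero_right h, Matrix.mul_neg, Matrix.mul_assoc]

lemma cdM_comm (hA : SmoothMat A x) (c' : ℂ) (a' b' : W) :
    cdM c a b (cdM c' a' b' A) x = cdM c' a' b' (cdM c a b A) x := by
  ext i j; exact cd_comm (hA i j) _ _ _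

lemma SmoothMat.slice {A : ℝ × W → Matrix (Fin r) (Fin r) ℂ} {t : ℝ} {z : W}
    (hA : SmoothMat A (t, z)) : SmoothMat (fun y => A (t, y)) z :=
  fun i j => contDiffAt_slice (hA i j)

lemma cdM_slice {A : ℝ × W → Matrix (Fin r) (Fin r) ℂ} {t : ℝ} {z a b : W}
    (hA : SmoothMat A (t, z)) :
    cdM c a b (fun y => A (t, y)) z = cdM c (0, a) (0, b) A (t, z) := by
  ext i j; exact cd_slice (hA i j)

end MatrixCalculus

/-! ### Wirtinger derivatives of matrices -/

section MatrixWirtinger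

variable {n r : ℕ} {A : (Fin n → ℂ) → Matrix (Fin r) (Fin r) ℂ} {z : Fin n → ℂ}

/-- The `(1,0)`-part of the derivative of a matrix valued function. -/
abbrev dlM (A : (Fin n → ℂ) → Matrix (Fin r) (Fin r) ℂ) (z u : Fin n → ℂ) :
    Matrix (Fin r) (Fin r) ℂ := cdM (-Complex.I) u (Complex.I • u) A z

/-- The `(0,1)`-part of the derivative of a matrix valued function. -/
abbrev dbM (A : (Fin n → ℂ) → Matrix (Fin r) (Fin r) ℂ) (z u : Fin n → ℂ) :
    Matrix (Fin r) (Fin r) ℂ := cdM Complex.I u (Complex.I • u) A z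

lemma delMat_eq (A : (Fin n → ℂ) → Matrix (Fin r) (Fin r) ℂ) (z u : Fin n → ℂ) :
    delMat A z u = dlM A z u := by
  ext i j
  simp [delMat, dMat, cdM, cd, sub_eq_add_neg]

lemma dlM_eq_sum (u : Fin n → ℂ) : dlM A z u = ∑ a, u a • dlM A z (Pi.single a 1) := by
  ext i j
  simpa [Matrix.sum_apply, cdM] using dl_eq_sum (f := fun y => A y i j) (z := z) u

lemma dbM_eq_sum (u : Fin n → ℂ) : dbM A z u = ∑ a, star (u a) • dbM A z (Pi.single a 1) := by
  ext i j
  simpa [Matrix.sum_apply, cdM] using db_eq_sum (f := fun y => A y i j) (z := z) u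

lemma dlM_smul (k : ℂ) (u : Fin n → ℂ) : dlM A z (k • u) = k • dlM A z u := by
  ext i j; exact dl_smul k u

lemma dbM_of_differentiableAt (hA : ∀ i j, DifferentiableAt ℂ (fun y => A y i j) z)
    (u : Fin n → ℂ) : dbM A z u = 0 := by
  ext i j; exact db_of_differentiableAt (hA i j) u

lemma cdM_comp {k : ℂ} {τ : (Fin n → ℂ) → (Fin n → ℂ)} (hτ : DifferentiableAt ℂ τ z)
    (hA : SmoothMat A (τ z)) (u : Fin n → ℂ) :
    cdM k u (Complex.I • u) (fun y => A (τ y)) z =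
      cdM k (fderiv ℂ τ z u) (Complex.I • fderiv ℂ τ z u) A (τ z) := by
  ext i j; exact cd_comp hτ (hA i j) u

lemma dlM_conjTranspose (hA : SmoothMat A z) (u : Fin n → ℂ) :
    dlM (fun y => (A y)ᴴ) z u = (dbM A z u)ᴴ := by
  simp [cdM_conjTranspose hA]

lemma dbM_conjTranspose (hA : SmoothMat A z) (u : Fin n → ℂ) :
    dbM (fun y => (A y)ᴴ) z u = (dlM A z u)ᴴ := by
  simp [cdM_conjTranspose hA]

end MatrixWirtinger

/-! ### Algebra of the adjoint with respect to a Gram matrix -/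

section Adjoint

variable {r : ℕ} {G A B : Matrix (Fin r) (Fin r) ℂ}

lemma adj_add : adj G (A + B) = adj G A + adj G B := by
  simp only [adj, conjTranspose_add, Matrix.mul_add, Matrix.add_mul]

lemma adj_sub : adj G (A - B) = adj G A - adj G B := by
  simp only [adj, conjTranspose_sub, Matrix.mul_sub, Matrix.sub_mul]

lemma adj_neg : adj G (-A) = -adj G A := by
  simp only [adj, conjTranspose_neg, Matrix.mul_neg, Matrix.neg_mul]

lemma adj_smul (k : ℂ) : adj G (k • A) = star k • adj G A := by
  simp only [adj, conjTranspose_smul, Matrix.mul_smul, Matrix.smul_mul]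

lemma adj_sum {ι : Type*} (s : Finset ι) (A : ι → Matrix (Fin r) (Fin r) ℂ) :
    adj G (∑ i ∈ s, A i) = ∑ i ∈ s, adj G (A i) := by
  simp only [adj, conjTranspose_sum, Matrix.mul_sum, Matrix.sum_mul]

lemma adj_mul (hG : G.det ≠ 0) : adj G (A * B) = adj G B * adj G A := by
  simp only [adj, conjTranspose_mul, Matrix.mul_assoc]
  rw [← Matrix.mul_assoc G, mul_nonsing_inv _ hG.isUnit, Matrix.one_mul]

lemma adj_adj (hG : G.det ≠ 0) (hH : G.IsHermitian) : adj G (adj G A) = A := by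
  simp only [adj, conjTranspose_mul, conjTranspose_conjTranspose, hH.inv.eq, hH.eq,
    Matrix.mul_assoc]
  rw [nonsing_inv_mul_cancel_left _ _ hG.isUnit, nonsing_inv_mul _ hG.isUnit, Matrix.mul_one]

end Adjoint

/-! ### The `(1,1)`-component of a curvature form -/

section Components

variable {n r : ℕ} {z : Fin n → ℂ}

lemma cdM_eq_dMat (c : ℂ) (u w : Fin n → ℂ) (A : (Fin n → ℂ) → Matrix (Fin r) (Fin r) ℂ) :
    cdM c u w A z = (1 / 2 : ℂ) • (dMat A z u + c • dMat A z w) := rfl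

lemma dMat_add {A B : (Fin n → ℂ) → Matrix (Fin r) (Fin r) ℂ} (hA : SmoothMat A z)
    (hB : SmoothMat B z) (u : Fin n → ℂ) :
    dMat (fun y => A y + B y) z u = dMat A z u + dMat B z u := by
  ext i j
  exact congrArg (· u) (fderiv_fun_add ((hA i j).differentiableAt (by simp))
    ((hB i j).differentiableAt (by simp)))

lemma dMat_const_smul {A : (Fin n → ℂ) → Matrix (Fin r) (Fin r) ℂ} (hA : SmoothMat A z)
    (k : ℂ) (u : Fin n → ℂ) :
    dMat (fun y => k • A y) z u = k • dMat A z u := by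
  ext i j
  exact congrArg (· u) (fderiv_const_mul ((hA i j).differentiableAt (by simp)) k)

/-- The `(1,1)`-component of `dH + H ∧ H`, for the sum `H` of a form `P` of type `(1,0)` and
a form `S` of type `(0,1)`. -/
lemma component11_curvature {P S : (Fin n → ℂ) → (Fin n → ℂ) → Matrix (Fin r) (Fin r) ℂ}
    (hP : ∀ u, SmoothMat (fun y => P y u) z) (hS : ∀ u, SmoothMat (fun y => S y u) z)
    (hPI : ∀ y u, P y (Complex.I • u) = Complex.I • P y u)
    (hSI : ∀ y u, S y (Complex.I • u) = -Complex.I • S y u) (a b : Fin n) :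
    component11 (fun u w => dMat (fun y => P y w + S y w) z u - dMat (fun y => P y u + S y u) z w
      + ((P z u + S z u) * (P z w + S z w) - (P z w + S z w) * (P z u + S z u))) a b =
    dlM (fun y => S y (Pi.single b 1)) z (Pi.single a 1)
      - dbM (fun y => P y (Pi.single a 1)) z (Pi.single b 1)
      + (P z (Pi.single a 1) * S z (Pi.single b 1) - S z (Pi.single b 1) * P z (Pi.single a 1)) := by
  simp only [component11, cdM_eq_dMat]
  generalize (Pi.single a 1 : Fin n → ℂ) = ea
  generalize (Pi.single b 1 : Fin n → ℂ) = eb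
  have hadd (u w : Fin n → ℂ) : dMat (fun y => P y w + S y w) z u =
      dMat (fun y => P y w) z u + dMat (fun y => S y w) z u := dMat_add (hP w) (hS w) u
  have hPd (u w : Fin n → ℂ) : dMat (fun y => P y (Complex.I • w)) z u =
      Complex.I • dMat (fun y => P y w) z u := by
    simp only [hPI]; exact dMat_const_smul (hP w) _ u
  have hSd (u w : Fin n → ℂ) : dMat (fun y => S y (Complex.I • w)) z u =
      -Complex.I • dMat (fun y => S y w) z u := by
    simp only [hSI]; exact dMat_const_smul (hS w) _ u
  simp only [hadd, hPd, hSd]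
  -- By type, `P` vanishes on `∂_b̄` and `S` on `∂_a`, so only the mixed terms survive; in
  -- coordinates this is the cancellation `I² = -1`.
  simp only [hPI, hSI, Matrix.mul_add, Matrix.add_mul, Matrix.smul_mul,
    Matrix.mul_smul]
  ext i j
  simp only [Matrix.add_apply, Matrix.sub_apply, Matrix.smul_apply, smul_eq_mul]
  ring_nf
  simp only [Complex.I_sq]
  ring

end Components

/-! ### Chern connection and mean curvature in terms of Gram matrices -/

section LocalData

variable {n r : ℕ}

/-- The Chern connection form `G⁻¹ ∂G` of a Gram matrix `G`. -/
def chernL (G : (Fin n → ℂ) → Matrix (Fin r) (Fin r) ℂ) (z u : Fin n → ℂ) :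
    Matrix (Fin r) (Fin r) ℂ :=
  (G z)⁻¹ * dlM G z u

/-- The `(1,0)`-part of the covariant derivative of an endomorphism. -/
def covL (G m : (Fin n → ℂ) → Matrix (Fin r) (Fin r) ℂ) (z u : Fin n → ℂ) :
    Matrix (Fin r) (Fin r) ℂ :=
  dlM m z u + (chernL G z u * m z - m z * chernL G z u)

/-- The `(1,1)`-part of the Hitchin-Simpson curvature. -/
def curvL (G : (Fin n → ℂ) → Matrix (Fin r) (Fin r) ℂ)
    (Φ : (Fin n → ℂ) → (Fin n → ℂ) → Matrix (Fin r) (Fin r) ℂ) (z u w : Fin n → ℂ) :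
    Matrix (Fin r) (Fin r) ℂ :=
  -dbM (fun y => chernL G y u) z w + (Φ z u * adj (G z) (Φ z w) - adj (G z) (Φ z w) * Φ z u)

/-- The Hitchin-Simpson mean curvature in terms of Gram matrices. -/
def meanL (Γ : (Fin n → ℂ) → Matrix (Fin n) (Fin n) ℂ)
    (G : (Fin n → ℂ) → Matrix (Fin r) (Fin r) ℂ)
    (Φ : (Fin n → ℂ) → (Fin n → ℂ) → Matrix (Fin r) (Fin r) ℂ) (z : Fin n → ℂ) :
    Matrix (Fin r) (Fin r) ℂ :=
  ∑ a, ∑ b, (Γ z)⁻¹ a b • curvL G Φ z (Pi.single a 1) (Pi.single b 1)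

/-- The trace `∑ g^{αβ̄} ∂_β̄ η_α` of `∂̄η`, for a `(1,0)`-form `η`. -/
def divL (Γ : (Fin n → ℂ) → Matrix (Fin n) (Fin n) ℂ)
    (η : (Fin n → ℂ) → (Fin n → ℂ) → ℂ) (z : Fin n → ℂ) : ℂ :=
  ∑ a, ∑ b, (Γ z)⁻¹ a b * db (fun y => η y (Pi.single a 1)) z (Pi.single b 1)

/-- `G` is the Gram matrix of a smooth Hermitian metric on the open set `U`. -/
structure IsGram (U : Set (Fin n → ℂ)) (G : (Fin n → ℂ) → Matrix (Fin r) (Fin r) ℂ) : Prop where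
  isOpen : IsOpen U
  smooth : ∀ z ∈ U, SmoothMat G z
  herm : ∀ z ∈ U, (G z).IsHermitian
  det_ne : ∀ z ∈ U, (G z).det ≠ 0

/-- `Φ` is a holomorphic matrix valued `(1,0)`-form on the set `U`. -/
structure IsHiggs (U : Set (Fin n → ℂ))
    (Φ : (Fin n → ℂ) → (Fin n → ℂ) → Matrix (Fin r) (Fin r) ℂ) : Prop where
  smooth : ∀ z ∈ U, ∀ u, SmoothMat (fun y => Φ y u) z
  smul : ∀ z (k : ℂ) u, Φ z (k • u) = k • Φ z u
  add : ∀ z u w, Φ z (u + w) = Φ z u + Φ z w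
  holomorphic : ∀ z ∈ U, ∀ u w, dbM (fun y => Φ y u) z w = 0

variable {U : Set (Fin n → ℂ)} {Γ : (Fin n → ℂ) → Matrix (Fin n) (Fin n) ℂ}
  {G m K : (Fin n → ℂ) → Matrix (Fin r) (Fin r) ℂ}
  {Φ : (Fin n → ℂ) → (Fin n → ℂ) → Matrix (Fin r) (Fin r) ℂ} {z : Fin n → ℂ}

lemma IsGram.eventually (hG : IsGram U G) (hz : z ∈ U) : ∀ᶠ y in 𝓝 z, y ∈ U :=
  hG.isOpen.mem_nhds hz

lemma IsGram.smooth_inv (hG : IsGram U G) (hz : z ∈ U) : SmoothMat (fun y => (G y)⁻¹) z :=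
  (hG.smooth z hz).inv (hG.det_ne z hz)

lemma IsGram.smooth_chernL (hG : IsGram U G) (hz : z ∈ U) (u : Fin n → ℂ) :
    SmoothMat (fun y => chernL G y u) z :=
  (hG.smooth_inv hz).mul (hG.smooth z hz).cdM

lemma IsGram.smooth_adj (hG : IsGram U G) (hz : z ∈ U) (hm : SmoothMat m z) :
    SmoothMat (fun y => adj (G y) (m y)) z :=
  ((hG.smooth_inv hz).mul hm.conjTranspose).mul (hG.smooth z hz)

lemma IsGram.smooth_covL (hG : IsGram U G) (hz : z ∈ U) (hm : SmoothMat m z) (u : Fin n → ℂ) :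
    SmoothMat (fun y => covL G m y u) z :=
  hm.cdM.add (((hG.smooth_chernL hz u).mul hm).sub (hm.mul (hG.smooth_chernL hz u)))

lemma IsGram.smooth_curvL (hG : IsGram U G) (hΦ : IsHiggs U Φ) (hz : z ∈ U)
    (u w : Fin n → ℂ) : SmoothMat (fun y => curvL G Φ y u w) z :=
  (hG.smooth_chernL hz u).cdM.neg.add
    (((hΦ.smooth z hz u).mul (hG.smooth_adj hz (hΦ.smooth z hz w))).sub
      ((hG.smooth_adj hz (hΦ.smooth z hz w)).mul (hΦ.smooth z hz u)))

lemma IsGram.smooth_meanL (hΓ : IsGram U Γ) (hG : IsGram U G) (hΦ : IsHiggs U Φ) (hz : z ∈ U) :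
    SmoothMat (meanL Γ G Φ) z :=
  SmoothMat.sum fun a _ => SmoothMat.sum fun b _ =>
    SmoothMat.smul (hΓ.smooth_inv hz a b) (hG.smooth_curvL hΦ hz _ _)

/-- The `(1,0)`-derivative of an adjoint. -/
lemma IsGram.dlM_adj (hG : IsGram U G) (hz : z ∈ U) (hm : SmoothMat m z) (u : Fin n → ℂ) :
    dlM (fun y => adj (G y) (m y)) z u = adj (G z) (dbM m z u)
      - (chernL G z u * adj (G z) (m z) - adj (G z) (m z) * chernL G z u) := by
  have hd := (hG.det_ne z hz).isUnit
  have h2 := dlM_conjTranspose hm u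
  simp only [adj]
  rw [dlM] at h2 ⊢
  rw [cdM_mul ((hG.smooth_inv hz).mul hm.conjTranspose) (hG.smooth z hz),
    cdM_mul (hG.smooth_inv hz) hm.conjTranspose, cdM_inv (hG.smooth z hz) (hG.det_ne z hz),
    h2]
  simp only [chernL, Matrix.add_mul, Matrix.neg_mul, Matrix.mul_assoc]
  rw [mul_nonsing_inv_cancel_left _ _ hd]
  abel

/-- The `(0,1)`-derivative of an adjoint. -/
lemma IsGram.dbM_adj (hG : IsGram U G) (hz : z ∈ U) (hm : SmoothMat m z) (u : Fin n → ℂ) :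
    dbM (fun y => adj (G y) (m y)) z u = adj (G z) (covL G m z u) := by
  have hd := (hG.det_ne z hz).isUnit
  -- Hermitian symmetry of `G` brings the Chern form, built from `∂G`, into a `∂̄`-derivative.
  have h1 : dbM G z u = (dlM G z u)ᴴ := by
    rw [← dbM_conjTranspose (hG.smooth z hz)]
    exact cdM_congr ((hG.eventually hz).mono fun y hy => (hG.herm y hy).eq.symm)
  have h2 := dbM_conjTranspose hm u
  simp only [adj]
  rw [dbM] at h1 h2 ⊢
  rw [cdM_mul ((hG.smooth_inv hz).mul hm.conjTranspose) (hG.smooth z hz),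
    cdM_mul (hG.smooth_inv hz) hm.conjTranspose, cdM_inv (hG.smooth z hz) (hG.det_ne z hz),
    h2, h1]
  simp only [covL, chernL, conjTranspose_add, conjTranspose_sub, conjTranspose_mul,
    (hG.herm z hz).inv.eq, Matrix.add_mul, Matrix.mul_add, Matrix.sub_mul, Matrix.mul_sub,
    Matrix.neg_mul, Matrix.mul_assoc]
  rw [nonsing_inv_mul _ hd, Matrix.mul_one]
  abel

lemma chernL_I_smul (z u : Fin n → ℂ) :
    chernL G z (Complex.I • u) = Complex.I • chernL G z u := by
  rw [chernL, dlM_smul, Matrix.mul_smul, chernL]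

/-- The `(1,1)`-component of the curvature of the Hitchin-Simpson connection. -/
lemma component11_hs (hG : IsGram U G) (hΦ : IsHiggs U Φ) (hz : z ∈ U) (a b : Fin n) :
    component11 (fun u w =>
      dMat (fun y => chernL G y w + Φ y w + adj (G y) (Φ y w)) z u
      - dMat (fun y => chernL G y u + Φ y u + adj (G y) (Φ y u)) z w
      + ((chernL G z u + Φ z u + adj (G z) (Φ z u)) * (chernL G z w + Φ z w + adj (G z) (Φ z w))
        - (chernL G z w + Φ z w + adj (G z) (Φ z w))
          * (chernL G z u + Φ z u + adj (G z) (Φ z u)))) a b =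
    curvL G Φ z (Pi.single a 1) (Pi.single b 1) := by
  rw [component11_curvature (P := fun y u => chernL G y u + Φ y u)
    (S := fun y u => adj (G y) (Φ y u))
    (fun u => (hG.smooth_chernL hz u).add (hΦ.smooth z hz u))
    (fun u => hG.smooth_adj hz (hΦ.smooth z hz u))
    (fun y u => by rw [chernL_I_smul, hΦ.smul, smul_add])
    (fun y u => by rw [hΦ.smul, adj_smul]; simp)]
  -- As `∂̄Φ = 0`, the term `∂Φ*` reduces to minus the commutator of the Chern form with `Φ*`; this
  -- cancels the same commutator in `H ∧ H`.
  rw [hG.dlM_adj hz (hΦ.smooth z hz _), hΦ.holomorphic z hz]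
  have h := hΦ.holomorphic z hz (Pi.single a 1) (Pi.single b 1)
  rw [dbM] at h ⊢
  rw [cdM_add (hG.smooth_chernL hz _) (hΦ.smooth z hz _), h]
  simp only [curvL, adj, conjTranspose_zero, Matrix.mul_zero, Matrix.zero_mul, Matrix.add_mul,
    Matrix.mul_add]
  abel

lemma IsGram.dbM_chernL (hG : IsGram U G) (hz : z ∈ U) (u w : Fin n → ℂ) :
    dbM (fun y => chernL G y u) z w =
      -((G z)⁻¹ * dbM G z w * (G z)⁻¹ * dlM G z u)
        + (G z)⁻¹ * dbM (fun y => dlM G y u) z w := by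
  simp only [chernL]
  rw [dbM, cdM_mul (hG.smooth_inv hz) (hG.smooth z hz).cdM,
    cdM_inv (hG.smooth z hz) (hG.det_ne z hz)]
  simp only [Matrix.neg_mul]

/-- Conjugate transposition fixes `G` and exchanges `∂` with `∂̄`; these commute. -/
lemma IsGram.dbM_dlM_conjTranspose (hG : IsGram U G) (hz : z ∈ U) (u w : Fin n → ℂ) :
    (dbM (fun y => dlM G y u) z w)ᴴ = dbM (fun y => dlM G y w) z u := by
  have h1 (u : Fin n → ℂ) (y) (hy : y ∈ U) : (dlM G y u)ᴴ = dbM G y u := by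
    rw [← dbM_conjTranspose (hG.smooth y hy)]
    exact cdM_congr ((hG.eventually hy).mono fun y hy => (hG.herm y hy).eq)
  rw [← dlM_conjTranspose (hG.smooth z hz).cdM]
  rw [dlM, cdM_congr ((hG.eventually hz).mono fun y hy => h1 u y hy)]
  exact cdM_comm (hG.smooth z hz) _ _ _

/-- The adjoint swaps the two arguments of the curvature. Together with `g` being Hermitian, this
makes its contraction `K` self-adjoint. -/
lemma IsGram.adj_curvL (hG : IsGram U G) (hz : z ∈ U) (u w : Fin n → ℂ) :
    adj (G z) (curvL G Φ z u w) = curvL G Φ z w u := by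
  have hd := hG.det_ne z hz
  have h1 (u : Fin n → ℂ) : (dlM G z u)ᴴ = dbM G z u := by
    rw [← dbM_conjTranspose (hG.smooth z hz)]
    exact cdM_congr ((hG.eventually hz).mono fun y hy => (hG.herm y hy).eq)
  have h2 (u : Fin n → ℂ) : (dbM G z u)ᴴ = dlM G z u := by rw [← h1, conjTranspose_conjTranspose]
  have h3 : adj (G z) (dbM (fun y => chernL G y u) z w) = dbM (fun y => chernL G y w) z u := by
    rw [hG.dbM_chernL hz, hG.dbM_chernL hz]
    simp only [adj, conjTranspose_add, conjTranspose_neg, conjTranspose_mul,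
      (hG.herm z hz).inv.eq, hG.dbM_dlM_conjTranspose hz, h1, h2, Matrix.add_mul, Matrix.mul_add,
      Matrix.neg_mul, Matrix.mul_neg, Matrix.mul_assoc, nonsing_inv_mul _ hd.isUnit,
      Matrix.mul_one]
  simp only [curvL, adj_add, adj_neg, adj_sub, adj_mul hd, h3, adj_adj hd (hG.herm z hz)]

/-- The mean curvature is self-adjoint. -/
lemma IsGram.adj_meanL (hΓ : IsGram U Γ) (hG : IsGram U G) (hz : z ∈ U) :
    adj (G z) (meanL Γ G Φ z) = meanL Γ G Φ z := by
  simp only [meanL, adj_sum, adj_smul, hG.adj_curvL hz, (hΓ.herm z hz).inv.apply]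
  exact Finset.sum_comm

/-- The pointwise identity behind the first variation formula. -/
lemma IsGram.trace_variation (hG : IsGram U G) (hz : z ∈ U)
    (hm : SmoothMat m z) (hK : SmoothMat K z)
    (hKa : ∀ y ∈ U, adj (G y) (K y) = K y) :
    (K z * ∑ a, ∑ b, (Γ z)⁻¹ a b •
      (-dbM (fun y => covL G m y (Pi.single a 1)) z (Pi.single b 1)
        + (Φ z (Pi.single a 1) * (adj (G z) (Φ z (Pi.single b 1)) * m z
            - m z * adj (G z) (Φ z (Pi.single b 1)))
          - (adj (G z) (Φ z (Pi.single b 1)) * m z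
            - m z * adj (G z) (Φ z (Pi.single b 1))) * Φ z (Pi.single a 1)))).trace
    + divL Γ (fun y u => (K y * covL G m y u).trace) z =
    ∑ a, ∑ b, ((Γ z)⁻¹ a b *
        (covL G m z (Pi.single a 1) * adj (G z) (covL G K z (Pi.single b 1))).trace
      + (Γ z)⁻¹ b a * ((adj (G z) (Φ z (Pi.single a 1)) * m z
            - m z * adj (G z) (Φ z (Pi.single a 1)))
          * adj (G z) (adj (G z) (Φ z (Pi.single b 1)) * K z
            - K z * adj (G z) (Φ z (Pi.single b 1)))).trace) := by
  have hd := hG.det_ne z hz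
  -- `∂̄(K*) = (D'K)*`, and `K* = K` near `z`.
  have h1 (b : Fin n) : adj (G z) (covL G K z (Pi.single b 1)) = dbM K z (Pi.single b 1) := by
    rw [← hG.dbM_adj hz hK]
    exact cdM_congr ((hG.eventually hz).mono fun y hy => hKa y hy)
  have h2 (a b : Fin n) : db (fun y => (K y * covL G m y (Pi.single a 1)).trace) z
      (Pi.single b 1) = (dbM K z (Pi.single b 1) * covL G m z (Pi.single a 1)).trace
        + (K z * dbM (fun y => covL G m y (Pi.single a 1)) z (Pi.single b 1)).trace := by
    rw [db, cd_trace (hK.mul (hG.smooth_covL hz hm _)), cdM_mul hK (hG.smooth_covL hz hm _),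
      trace_add]
  simp only [divL, h1, h2, Finset.mul_sum, trace_sum, Matrix.mul_smul, trace_smul, smul_eq_mul,
    Finset.sum_add_distrib, adj_sub, adj_mul hd, adj_adj hd (hG.herm z hz), hKa z hz]
  -- The `(0,1)`-part is weighted by `g^{bā}`; renaming its indices gives every term the common
  -- factor `g^{ab̄}`.
  rw [Finset.sum_comm (f := fun a b => (Γ z)⁻¹ b a * _)]
  simp only [← Finset.sum_add_distrib]
  refine Finset.sum_congr rfl fun a _ => Finset.sum_congr rfl fun b _ => ?_
  rw [← mul_add, ← mul_add]
  congr 1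
  generalize covL G m z (Pi.single a 1) = D
  generalize Φ z (Pi.single a 1) = P
  generalize dbM (fun y => covL G m y (Pi.single a 1)) z (Pi.single b 1) = X
  generalize dbM K z (Pi.single b 1) = Y
  generalize adj (G z) (Φ z (Pi.single b 1)) * m z - m z * adj (G z) (Φ z (Pi.single b 1)) = S
  -- Cyclicity of the trace: `tr(K [P, S]) = tr(S [K, P])`, where `[K, Φ_b]` is the adjoint of
  -- `[Φ*_b, K]`.
  have h3 : (K z * (P * S - S * P)).trace = (S * (K z * P - P * K z)).trace := by
    rw [Matrix.mul_sub, Matrix.mul_sub, trace_sub, trace_sub, ← Matrix.mul_assoc (K z) P,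
      Matrix.trace_mul_comm (K z * P), Matrix.trace_mul_comm (K z), Matrix.mul_assoc S]
  rw [Matrix.mul_add, trace_add, Matrix.mul_neg, trace_neg, Matrix.trace_mul_comm Y D, h3]
  ring

end LocalData

/-! ### Holomorphic functions of several variables are smooth -/

section Holomorphic

variable {n : ℕ}

/-- Cauchy's estimate for the derivative of a holomorphic function of several variables. -/
lemma norm_fderiv_le_of_closedBall {f : (Fin n → ℂ) → ℂ} {y : Fin n → ℂ} {R C : ℝ} (hR : 0 < R)
    (hf : ∀ z ∈ Metric.closedBall y R, DifferentiableAt ℂ f z)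
    (hC : ∀ z ∈ Metric.closedBall y R, ‖f z‖ ≤ C) : ‖fderiv ℂ f y‖ ≤ C / R := by
  have hC0 : 0 ≤ C := (norm_nonneg _).trans (hC y (Metric.mem_closedBall_self hR.le))
  refine ContinuousLinearMap.opNorm_le_bound _ (by positivity) fun w => ?_
  rcases eq_or_ne w 0 with rfl | hw
  · simp
  have hw' : 0 < ‖w‖ := norm_pos_iff.2 hw
  have hmem (ζ : ℂ) (hζ : ‖ζ‖ ≤ R / ‖w‖) : y + ζ • w ∈ Metric.closedBall y R := by
    rw [mem_closedBall_iff_norm, add_sub_cancel_left, norm_smul]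
    exact (le_div_iff₀ hw').1 hζ
  have hline (ζ : ℂ) : HasDerivAt (fun ζ : ℂ => y + ζ • w) w ζ := by
    simpa using ((hasDerivAt_id ζ).smul_const w).const_add y
  have hd : HasDerivAt (fun ζ : ℂ => f (y + ζ • w)) (fderiv ℂ f y w) 0 := by
    refine HasFDerivAt.comp_hasDerivAt (l := f) (l' := fderiv ℂ f y) 0 ?_ (hline 0)
    simpa using (hf y (Metric.mem_closedBall_self hR.le)).hasFDerivAt
  -- One-variable Cauchy estimate on the complex line through `y` in direction `w`; the radius `R /
  -- ‖w‖` keeps the disc inside the ball.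
  have h := Complex.norm_deriv_le_of_forall_mem_sphere_norm_le (c := 0) (R := R / ‖w‖) (C := C)
    (f := fun ζ : ℂ => f (y + ζ • w)) (by positivity) ?_ ?_
  · rw [hd.deriv] at h
    calc _ ≤ C / (R / ‖w‖) := h
      _ = C / R * ‖w‖ := by field_simp
  · refine DifferentiableOn.diffContOnCl fun ζ hζ => ?_
    have hζ' : ‖ζ‖ ≤ R / ‖w‖ := by simpa using Metric.closure_ball_subset_closedBall hζ
    exact ((hf _ (hmem ζ hζ')).comp ζ (hline ζ).differentiableAt).differentiableWithinAt
  · intro ζ hζ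
    exact hC _ (hmem ζ (by simpa using (mem_sphere_zero_iff_norm.1 hζ).le))

/-- The directional derivatives of a holomorphic function are holomorphic. -/
lemma differentiableOn_fderiv_apply {f : (Fin n → ℂ) → ℂ} {U : Set (Fin n → ℂ)} (hU : IsOpen U)
    (hf : DifferentiableOn ℂ f U) (v : Fin n → ℂ) :
    DifferentiableOn ℂ (fun z => fderiv ℂ f z v) U := by
  intro z₀ hz₀
  obtain ⟨δ, hδ, hδU⟩ := Metric.isOpen_iff.1 hU z₀ hz₀
  -- Room for three steps of length `R` inside `U`: moving the point `z`, running along Cauchy's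
  -- circle, and estimating the derivative there.
  set R := δ / 4 with hRdef
  have hR : 0 < R := by positivity
  have hsub : Metric.closedBall z₀ (3 * R) ⊆ U :=
    (Metric.closedBall_subset_ball (by linarith)).trans hδU
  have hdiff (z) (hz : z ∈ Metric.closedBall z₀ (3 * R)) : DifferentiableAt ℂ f z :=
    hf.differentiableAt (hU.mem_nhds (hsub hz))
  obtain ⟨C, hC⟩ := (isCompact_closedBall z₀ (3 * R)).exists_bound_of_continuousOn
    (hf.continuousOn.mono hsub)
  -- Gives `ρ ‖v‖ ≤ R`; the summand `1` covers `v = 0`.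
  set ρ := R / (‖v‖ + 1) with hρdef
  have hρ : 0 < ρ := by positivity
  have hρv : ρ * ‖v‖ ≤ R := by
    rw [hρdef, div_mul_eq_mul_div, div_le_iff₀ (by positivity)]
    nlinarith
  have hmem (z) (hz : z ∈ Metric.ball z₀ R) (ζ : ℂ) (hζ : ‖ζ‖ ≤ ρ) :
      z + ζ • v ∈ Metric.closedBall z₀ (2 * R) := by
    rw [mem_closedBall_iff_norm]
    have h1 : ‖ζ • v‖ ≤ R := by
      rw [norm_smul]; exact (mul_le_mul_of_nonneg_right hζ (norm_nonneg _)).trans hρv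
    calc ‖z + ζ • v - z₀‖ = ‖(z - z₀) + ζ • v‖ := by congr 1; abel
      _ ≤ ‖z - z₀‖ + ‖ζ • v‖ := norm_add_le _ _
      _ ≤ 2 * R := by linarith [mem_ball_iff_norm.1 hz]
  have h23 : Metric.closedBall z₀ (2 * R) ⊆ Metric.closedBall z₀ (3 * R) :=
    Metric.closedBall_subset_closedBall (by linarith)
  have hbound (y) (hy : y ∈ Metric.closedBall z₀ (2 * R)) : ‖fderiv ℂ f y‖ ≤ C / R := by
    have hs : Metric.closedBall y R ⊆ Metric.closedBall z₀ (3 * R) :=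
      Metric.closedBall_subset_closedBall' (by linarith [Metric.mem_closedBall.1 hy])
    exact norm_fderiv_le_of_closedBall hR (fun z hz => hdiff z (hs hz)) fun z hz => hC z (hs hz)
  have hline (z : Fin n → ℂ) (ζ : ℂ) : HasDerivAt (fun ζ : ℂ => z + ζ • v) v ζ := by
    simpa using ((hasDerivAt_id ζ).smul_const v).const_add z
  have hcm (θ : ℝ) : ‖circleMap 0 ρ θ‖ ≤ ρ := by simp [abs_of_pos hρ]
  -- Cauchy's integral formula
  have hcauchy (z) (hz : z ∈ Metric.ball z₀ R) : fderiv ℂ f z v =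
      (2 * Real.pi * Complex.I : ℂ)⁻¹ * ∫ θ in (0 : ℝ)..2 * Real.pi,
        (deriv (circleMap 0 ρ) θ * ((circleMap 0 ρ θ) ^ 2)⁻¹) * f (z + circleMap 0 ρ θ • v) := by
    have hzmem := hmem z hz 0 (by simpa using hρ.le)
    have hd : HasDerivAt (fun ζ : ℂ => f (z + ζ • v)) (fderiv ℂ f z v) 0 := by
      refine HasFDerivAt.comp_hasDerivAt (l := f) (l' := fderiv ℂ f z) 0 ?_ (hline z 0)
      simp only [zero_smul, add_zero] at hzmem ⊢
      exact (hdiff z (h23 hzmem)).hasFDerivAt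
    have hV : IsOpen {ζ : ℂ | z + ζ • v ∈ U} := hU.preimage (by fun_prop)
    have h := Complex.cderiv_eq_deriv (U := {ζ : ℂ | z + ζ • v ∈ U}) (z := 0) (r := ρ)
      (f := fun ζ : ℂ => f (z + ζ • v)) hV
      (fun ζ hζ => ((hf.differentiableAt (hU.mem_nhds hζ)).comp ζ
        (hline z ζ).differentiableAt).differentiableWithinAt) hρ
      (fun ζ hζ => hsub (h23 (hmem z hz ζ (by simpa using hζ))))
    rw [← hd.deriv, ← h, Complex.cderiv, circleIntegral]
    simp [mul_assoc]
  have hcont : Continuous fun θ : ℝ => deriv (circleMap 0 ρ) θ * ((circleMap 0 ρ θ) ^ 2)⁻¹ := by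
    simp only [deriv_circleMap]
    refine ((continuous_circleMap 0 ρ).mul continuous_const).mul (Continuous.inv₀ ?_ fun θ => ?_)
    · exact (continuous_circleMap 0 ρ).pow 2
    · exact pow_ne_zero 2 (by simpa using circleMap_ne_center (c := 0) (θ := θ) hρ.ne')
  have hFcont (z) (hz : z ∈ Metric.ball z₀ R) : Continuous fun θ : ℝ =>
      (deriv (circleMap 0 ρ) θ * ((circleMap 0 ρ θ) ^ 2)⁻¹) * f (z + circleMap 0 ρ θ • v) := by
    refine hcont.mul (continuous_iff_continuousAt.2 fun θ => ?_)
    refine ContinuousAt.comp (f := fun θ : ℝ => z + circleMap 0 ρ θ • v)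
      (hdiff _ (h23 (hmem z hz _ (hcm θ)))).continuousAt ?_
    exact (continuous_const.add ((continuous_circleMap 0 ρ).smul continuous_const)).continuousAt
  -- Continuity of the derivative is not known at this stage; measurability suffices for dominated
  -- differentiation.
  have hmeas : Measurable fun θ : ℝ => fderiv ℂ f (z₀ + circleMap 0 ρ θ • v) :=
    (measurable_fderiv ℂ f).comp
      (continuous_const.add ((continuous_circleMap 0 ρ).smul continuous_const)).measurable
  -- In Cauchy's formula `z` enters only through values of `f`, so the integral is differentiable in
  -- `z`; Cauchy's estimate supplies the bound.
  have hderiv := intervalIntegral.hasFDerivAt_integral_of_dominated_of_fderiv_le (𝕜 := ℂ)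
    (μ := volume) (a := 0) (b := 2 * Real.pi) (x₀ := z₀) (s := Metric.ball z₀ R)
    (F := fun z θ => (deriv (circleMap 0 ρ) θ * ((circleMap 0 ρ θ) ^ 2)⁻¹) *
      f (z + circleMap 0 ρ θ • v))
    (F' := fun z θ => (deriv (circleMap 0 ρ) θ * ((circleMap 0 ρ θ) ^ 2)⁻¹) •
      fderiv ℂ f (z + circleMap 0 ρ θ • v))
    (bound := fun θ => ‖deriv (circleMap 0 ρ) θ * ((circleMap 0 ρ θ) ^ 2)⁻¹‖ * (C / R))
    (Metric.ball_mem_nhds _ hR) ?_ ?_ ?_ ?_ ?_ ?_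
  · have h1 : DifferentiableAt ℂ (fun z => (2 * Real.pi * Complex.I : ℂ)⁻¹ *
        ∫ θ in (0 : ℝ)..2 * Real.pi,
        (deriv (circleMap 0 ρ) θ * ((circleMap 0 ρ θ) ^ 2)⁻¹) * f (z + circleMap 0 ρ θ • v)) z₀ :=
      hderiv.differentiableAt.const_mul _
    refine (h1.congr_of_eventuallyEq ?_).differentiableWithinAt
    filter_upwards [Metric.ball_mem_nhds z₀ hR] with z hz using hcauchy z hz
  · filter_upwards [Metric.ball_mem_nhds z₀ hR] with z hz
    exact (hFcont z hz).aestronglyMeasurable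
  · exact (hFcont z₀ (Metric.mem_ball_self hR)).intervalIntegrable _ _
  · exact hcont.aestronglyMeasurable.smul hmeas.aestronglyMeasurable
  · refine Eventually.of_forall fun θ _ z hz => ?_
    rw [norm_smul]
    exact mul_le_mul_of_nonneg_left (hbound _ (hmem z hz _ (hcm θ))) (norm_nonneg _)
  · exact (hcont.norm.mul continuous_const).intervalIntegrable _ _
  · refine Eventually.of_forall fun θ _ z hz => ?_
    refine HasFDerivAt.const_mul ?_ _
    exact (hasFDerivAt_comp_add_right _).2 (hdiff _ (h23 (hmem z hz _ (hcm θ)))).hasFDerivAt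

/-- Holomorphic functions of several variables are smooth. -/
lemma contDiffOn_of_differentiableOn {U : Set (Fin n → ℂ)} (hU : IsOpen U) (k : ℕ) :
    ∀ {f : (Fin n → ℂ) → ℂ}, DifferentiableOn ℂ f U → ContDiffOn ℂ k f U := by
  induction k with
  | zero => exact fun hf => contDiffOn_zero.2 hf.continuousOn
  | succ k ih =>
    intro f hf
    rw [Nat.cast_add, Nat.cast_one, contDiffOn_succ_iff_fderiv_of_isOpen hU]
    exact ⟨hf, by simp, contDiffOn_clm_apply.2 fun v =>
      ih (differentiableOn_fderiv_apply hU hf v)⟩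

lemma contDiffAt_of_differentiableOn {U : Set (Fin n → ℂ)} (hU : IsOpen U)
    {f : (Fin n → ℂ) → ℂ} (hf : DifferentiableOn ℂ f U) {z : Fin n → ℂ} (hz : z ∈ U) :
    ContDiffAt ℝ ∞ f z :=
  ContDiffAt.restrict_scalars ℝ ((contDiffOn_infty.2 fun k =>
    contDiffOn_of_differentiableOn hU k hf).contDiffAt (hU.mem_nhds hz))

end Holomorphic

/-! ### Derivative of the determinant -/

section Determinant

variable {W : Type*} [NormedAddCommGroup W] [NormedSpace ℝ W] {r : ℕ}
  {c : ℂ} {a b x : W} {A : W → Matrix (Fin r) (Fin r) ℂ}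

lemma cd_prod {ι : Type*} [DecidableEq ι] {s : Finset ι} {f : ι → W → ℂ}
    (hf : ∀ i ∈ s, ContDiffAt ℝ ∞ (f i) x) :
    cd c a b (fun y => ∏ i ∈ s, f i y) x =
      ∑ i ∈ s, (∏ j ∈ s.erase i, f j x) * cd c a b (f i) x := by
  have h := HasFDerivAt.finsetProd (𝔸' := ℂ)
    fun i hi => ((hf i hi).differentiableAt (by simp)).hasFDerivAt
  simp only [cd, h.fderiv, _root_.sum_apply, _root_.smul_apply, smul_eq_mul, Finset.mul_sum,
    ← Finset.sum_add_distrib]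
  exact Finset.sum_congr rfl fun i _ => by ring

/-- Jacobi's formula for the derivative of a determinant. -/
lemma cd_det (hA : SmoothMat A x) :
    cd c a b (fun y => (A y).det) x = ((A x).adjugate * cdM c a b A x).trace := by
  -- By Cramer's rule, each diagonal entry is the determinant with column `i` replaced by its
  -- derivative.
  have h1 (i : Fin r) : ((A x).adjugate * cdM c a b A x) i i =
      ((A x).updateCol i fun k => cdM c a b A x k i).det := by
    rw [← cramer_apply, cramer_eq_adjugate_mulVec]; rfl
  simp only [Matrix.trace, diag_apply, h1]
  simp only [det_apply']
  rw [cd_sum fun σ _ => contDiffAt_const.mul (contDiffAt_prod fun i _ => hA (σ i) i),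
    Finset.sum_comm]
  refine Finset.sum_congr rfl fun σ _ => ?_
  rw [cd_mul contDiffAt_const (contDiffAt_prod fun i _ => hA (σ i) i), cd_const, zero_mul,
    zero_add, cd_prod fun i _ => hA (σ i) i, Finset.mul_sum]
  refine Finset.sum_congr rfl fun i _ => ?_
  congr 1
  rw [← Finset.mul_prod_erase _ _ (Finset.mem_univ i), updateCol_self, mul_comm]
  congr 1
  exact Finset.prod_congr rfl fun j hj => (updateCol_ne (Finset.ne_of_mem_erase hj)).symm

end Determinant

/-! ### The Kähler condition and the local divergence theorem -/

section Kahler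

variable {n : ℕ}

/-- The value `g(v, w)` of the Hermitian form with Gram matrix `M`. -/
def hermVal (M : Matrix (Fin n) (Fin n) ℂ) (v w : Fin n → ℂ) : ℂ := star w ⬝ᵥ M *ᵥ v

lemma hermVal_I_left (M : Matrix (Fin n) (Fin n) ℂ) (v w : Fin n → ℂ) :
    hermVal M (Complex.I • v) w = Complex.I * hermVal M v w := by
  simp [hermVal, mulVec_smul]

lemma hermVal_I_right (M : Matrix (Fin n) (Fin n) ℂ) (v w : Fin n → ℂ) :
    hermVal M v (Complex.I • w) = -Complex.I * hermVal M v w := by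
  simp [hermVal, star_smul]

lemma hermVal_single (M : Matrix (Fin n) (Fin n) ℂ) (i j : Fin n) :
    hermVal M (Pi.single j 1) (Pi.single i 1) = M i j := by
  have h : star (Pi.single i 1 : Fin n → ℂ) = Pi.single i 1 := by
    rw [← Pi.single_star, star_one]
  simp [hermVal, h]

variable {U : Set (Fin n → ℂ)} {Γ : (Fin n → ℂ) → Matrix (Fin n) (Fin n) ℂ} {z : Fin n → ℂ}

lemma contDiffAt_hermVal (hΓ : SmoothMat Γ z) (v w : Fin n → ℂ) :
    ContDiffAt ℝ ∞ (fun y => hermVal (Γ y) v w) z := by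
  simp only [hermVal, dotProduct, mulVec]
  exact ContDiffAt.sum fun i _ => contDiffAt_const.mul
    (ContDiffAt.sum fun j _ => (hΓ i j).mul contDiffAt_const)

/-- For a closed Kähler form, `∂_α g_{γβ̄}` is symmetric in `α` and `γ`. -/
lemma IsGram.kahler_symm (hΓ : IsGram U Γ) (hz : z ∈ U)
    (hK : ∀ u v w : Fin n → ℂ,
      fderiv ℝ (fun y => -2 * (hermVal (Γ y) v w).im) z u
        + fderiv ℝ (fun y => -2 * (hermVal (Γ y) w u).im) z v
        + fderiv ℝ (fun y => -2 * (hermVal (Γ y) u v).im) z w = 0) (a b c : Fin n) :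
    dlM Γ z (Pi.single a 1) b c = dlM Γ z (Pi.single c 1) b a := by
  have hs (v w : Fin n → ℂ) : DifferentiableAt ℝ (fun y => hermVal (Γ y) v w) z :=
    (contDiffAt_hermVal (hΓ.smooth z hz) v w).differentiableAt (by simp)
  set d : (Fin n → ℂ) → (Fin n → ℂ) → (Fin n → ℂ) → ℂ :=
    fun u v w => fderiv ℝ (fun y => hermVal (Γ y) v w) z u with hd
  have him (u v w : Fin n → ℂ) :
      ((fderiv ℝ (fun y => -2 * (hermVal (Γ y) v w).im) z u : ℝ) : ℂ) =
        Complex.I * (d u v w - d u w v) := by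
    have h1 : fderiv ℝ (fun y => -2 * (hermVal (Γ y) v w).im) z u = -2 * (d u v w).im := by
      have := ((Complex.imCLM.hasFDerivAt.comp z (hs v w).hasFDerivAt).const_mul (-2 : ℝ)).fderiv
      exact congrArg (fun T => T u) this
    -- Hermitian symmetry turns the imaginary part into an antisymmetrization of `d`, which is
    -- complex bilinear up to conjugation.
    have h2 : d u w v = star (d u v w) := by
      have h3 : (fun y => hermVal (Γ y) w v) =ᶠ[𝓝 z] fun y => star (hermVal (Γ y) v w) := by
        filter_upwards [hΓ.eventually hz] with y hy
        simp only [hermVal]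
        rw [star_dotProduct, star_mulVec, (hΓ.herm y hy).eq, dotProduct_comm, dotProduct_mulVec,
          dotProduct_comm]
      have h4 := (Complex.conjCLE : ℂ →L[ℝ] ℂ).hasFDerivAt.comp z (hs v w).hasFDerivAt
      have h5 : fderiv ℝ (fun y => star (hermVal (Γ y) v w)) z = _ := h4.fderiv
      simp only [hd, h3.fderiv_eq, h5]
      rfl
    rw [h1, h2]
    apply Complex.ext <;> simp
    ring
  have hT (u v w : Fin n → ℂ) :
      (d u v w - d u w v) + (d v w u - d v u w) + (d w u v - d w v u) = 0 := by
    have h := congrArg (fun x : ℝ => (x : ℂ)) (hK u v w)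
    simp only [Complex.ofReal_add, him, Complex.ofReal_zero] at h
    have h' : Complex.I * ((d u v w - d u w v) + (d v w u - d v u w) + (d w u v - d w v u)) = 0 := by
      linear_combination h
    exact (mul_eq_zero.1 h').resolve_left Complex.I_ne_zero
  have hl (u v w : Fin n → ℂ) : d u (Complex.I • v) w = Complex.I * d u v w := by
    simp only [hd, hermVal_I_left]
    rw [fderiv_const_mul (hs v w)]; rfl
  have hr (u v w : Fin n → ℂ) : d u v (Complex.I • w) = -Complex.I * d u v w := by
    simp only [hd, hermVal_I_right]
    rw [fderiv_const_mul (hs v w)]; rfl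
  have hdl (u : Fin n → ℂ) (i j : Fin n) : dlM Γ z u i j = (1 / 2 : ℂ) *
      (d u (Pi.single j 1) (Pi.single i 1)
        - Complex.I * d (Complex.I • u) (Pi.single j 1) (Pi.single i 1)) := by
    simp only [hd, hermVal_single, cdM, cd, Matrix.of_apply]
    ring
  rw [hdl, hdl]
  generalize (Pi.single a 1 : Fin n → ℂ) = ea
  generalize (Pi.single b 1 : Fin n → ℂ) = eb
  generalize (Pi.single c 1 : Fin n → ℂ) = ec
  -- The eight equations are closedness on `ea`, `ec`, `eb` with each vector optionally multiplied
  -- by `I`. The coefficients below expand `(ea - I·Iea)(ec - I·Iec)(eb + I·Ieb) / 8`, that is,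
  -- evaluation on `(∂_a, ∂_c, ∂_b̄)`.
  have e1 := hT ea ec eb
  have e2 := hT (Complex.I • ea) ec eb
  have e3 := hT ea (Complex.I • ec) eb
  have e4 := hT ea ec (Complex.I • eb)
  have e5 := hT (Complex.I • ea) (Complex.I • ec) eb
  have e6 := hT (Complex.I • ea) ec (Complex.I • eb)
  have e7 := hT ea (Complex.I • ec) (Complex.I • eb)
  have e8 := hT (Complex.I • ea) (Complex.I • ec) (Complex.I • eb)
  simp only [hl, hr] at e1 e2 e3 e4 e5 e6 e7 e8
  linear_combination (norm := skip) (1 / 8 : ℂ) * (e1 - Complex.I * e2 - Complex.I * e3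
      + Complex.I * e4 - e5 + e6 + e7 - Complex.I * e8)
  ring_nf
  simp only [Complex.I_sq, Complex.I_pow_three]
  ring

/-- On a Kähler manifold, `∑_β ∂_β̄ (g^{αβ̄} det g) = 0`. -/
lemma IsGram.sum_db_inv_mul_det (hΓ : IsGram U Γ) (hz : z ∈ U)
    (hK : ∀ a b c : Fin n, dlM Γ z (Pi.single a 1) b c = dlM Γ z (Pi.single c 1) b a)
    (a : Fin n) :
    ∑ b, db (fun y => (Γ y)⁻¹ a b * (Γ y).det) z (Pi.single b 1) = 0 := by
  have hs := hΓ.smooth z hz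
  have hd := hΓ.det_ne z hz
  have hdb (u : Fin n → ℂ) : dbM Γ z u = (dlM Γ z u)ᴴ := by
    rw [← dbM_conjTranspose hs]
    exact cdM_congr ((hΓ.eventually hz).mono fun y hy => (hΓ.herm y hy).eq.symm)
  have hsym (i j k : Fin n) : dbM Γ z (Pi.single i 1) k j = dbM Γ z (Pi.single k 1) i j := by
    simp only [hdb, conjTranspose_apply, hK i j k]
  have h1 (b : Fin n) : db (fun y => (Γ y)⁻¹ a b * (Γ y).det) z (Pi.single b 1) =
      (Γ z).det * ((Γ z)⁻¹ a b * ((Γ z)⁻¹ * dbM Γ z (Pi.single b 1)).trace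
        - ((Γ z)⁻¹ * dbM Γ z (Pi.single b 1) * (Γ z)⁻¹) a b) := by
    have h2 : db (fun y => (Γ y)⁻¹ a b) z (Pi.single b 1) =
        -((Γ z)⁻¹ * dbM Γ z (Pi.single b 1) * (Γ z)⁻¹) a b :=
      congrFun (congrFun (cdM_inv hs hd) a) b
    have h3 : (Γ z).adjugate = (Γ z).det • (Γ z)⁻¹ := by
      rw [Matrix.inv_def, smul_smul, Ring.inverse_eq_inv', mul_inv_cancel₀ hd, one_smul]
    rw [db] at h2 ⊢
    rw [cd_mul (hΓ.smooth_inv hz a b) hs.det, h2, cd_det hs, h3, Matrix.smul_mul, trace_smul,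
      smul_eq_mul]
    ring
  simp only [h1]
  rw [← Finset.mul_sum, Finset.sum_sub_distrib]
  -- The derivative of `g⁻¹` and that of `det g` cancel after summation: the Kähler symmetry `hsym`
  -- moves the derivative index into the matrix and produces Jacobi's trace.
  have h4 : ∑ b, ((Γ z)⁻¹ * dbM Γ z (Pi.single b 1) * (Γ z)⁻¹) a b =
      ∑ i, (Γ z)⁻¹ a i * ((Γ z)⁻¹ * dbM Γ z (Pi.single i 1)).trace := by
    simp only [Matrix.trace_mul_comm (Γ z)⁻¹, Matrix.mul_assoc]
    simp only [Matrix.mul_apply (M := (Γ z)⁻¹)]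
    rw [Finset.sum_comm]
    refine Finset.sum_congr rfl fun i _ => ?_
    rw [← Finset.mul_sum]
    congr 1
    refine Finset.sum_congr rfl fun b _ => ?_
    simp only [diag_apply, Matrix.mul_apply, hsym b _ i]
  rw [h4, sub_self, mul_zero]

variable {η : (Fin n → ℂ) → (Fin n → ℂ) → ℂ}

/-- On a Kähler manifold the trace of `∂̄η` is a divergence. -/
lemma IsGram.divL_mul_det (hΓ : IsGram U Γ) (hz : z ∈ U)
    (hK : ∀ a b c : Fin n, dlM Γ z (Pi.single a 1) b c = dlM Γ z (Pi.single c 1) b a)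
    (hη : ∀ a : Fin n, ContDiffAt ℝ ∞ (fun y => η y (Pi.single a 1)) z) :
    divL Γ η z * (Γ z).det =
      ∑ b, db (fun y => ∑ a, (Γ y)⁻¹ a b * (Γ y).det * η y (Pi.single a 1)) z (Pi.single b 1) := by
  have hs (a b : Fin n) : ContDiffAt ℝ ∞ (fun y => (Γ y)⁻¹ a b * (Γ y).det) z :=
    (hΓ.smooth_inv hz a b).mul (hΓ.smooth z hz).det
  have h1 (b : Fin n) : db (fun y => ∑ a, (Γ y)⁻¹ a b * (Γ y).det * η y (Pi.single a 1)) z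
      (Pi.single b 1) = ∑ a, (db (fun y => (Γ y)⁻¹ a b * (Γ y).det) z (Pi.single b 1)
        * η z (Pi.single a 1) + (Γ z)⁻¹ a b * (Γ z).det
          * db (fun y => η y (Pi.single a 1)) z (Pi.single b 1)) := by
    rw [db, cd_sum fun a _ => (hs a b).mul (hη a)]
    exact Finset.sum_congr rfl fun a _ => cd_mul (hs a b) (hη a)
  simp only [h1]
  rw [Finset.sum_comm]
  simp only [Finset.sum_add_distrib, ← Finset.sum_mul, hΓ.sum_db_inv_mul_det hz hK, zero_mul,
    zero_add, divL]
  simp only [Finset.sum_mul]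
  exact Finset.sum_congr rfl fun a _ => Finset.sum_congr rfl fun b _ => by ring

lemma integral_fderiv_eq_zero {f : (Fin n → ℂ) → ℂ} (hf : ContDiff ℝ ∞ f)
    (hc : HasCompactSupport f) (u : Fin n → ℂ) : ∫ z, fderiv ℝ f z u = 0 := by
  have h1 : Integrable f := hf.continuous.integrable_of_hasCompactSupport hc
  have hcont : Continuous fun z => fderiv ℝ f z u :=
    (hf.continuous_fderiv (by simp)).clm_apply continuous_const
  have h2 : Integrable fun z => fderiv ℝ f z u :=
    hcont.integrable_of_hasCompactSupport (hc.fderiv_apply ℝ u)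
  -- Integration by parts against the constant function `1`.
  have h := integral_mul_fderiv_eq_neg_fderiv_mul_of_integrable (μ := volume) (𝕜 := ℂ)
    (f := fun _ : Fin n → ℂ => (1 : ℂ)) (g := f) (v := u) (by simp) (by simpa using h2)
    (by simpa using h1) (fun _ _ => differentiableAt_const _)
    (fun x _ => hf.differentiable (by simp) x)
  simpa using h

lemma integral_db_eq_zero {f : (Fin n → ℂ) → ℂ} (hf : ContDiff ℝ ∞ f)
    (hc : HasCompactSupport f) (u : Fin n → ℂ) : ∫ z, db f z u = 0 := by
  have hcont (u) : Continuous fun z => fderiv ℝ f z u :=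
    (hf.continuous_fderiv (by simp)).clm_apply continuous_const
  have h2 (u) : Integrable fun z => fderiv ℝ f z u :=
    (hcont u).integrable_of_hasCompactSupport (hc.fderiv_apply ℝ u)
  simp only [cd]
  rw [integral_const_mul, integral_add (h2 _) ((h2 _).const_mul _), integral_const_mul,
    integral_fderiv_eq_zero hf hc, integral_fderiv_eq_zero hf hc]
  simp

/-- The local version of Stokes' theorem for `(1,0)`-forms with compact support. -/
lemma IsGram.setIntegral_divL_mul_det (hΓ : IsGram U Γ)
    (hK : ∀ z ∈ U, ∀ a b c : Fin n,
      dlM Γ z (Pi.single a 1) b c = dlM Γ z (Pi.single c 1) b a)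
    (hη : ∀ z ∈ U, ∀ a : Fin n, ContDiffAt ℝ ∞ (fun y => η y (Pi.single a 1)) z)
    {C : Set (Fin n → ℂ)} (hC : IsCompact C) (hCU : C ⊆ U)
    (hsupp : ∀ z ∉ C, ∀ a : Fin n, η z (Pi.single a 1) = 0) :
    ∫ z in U, divL Γ η z * (Γ z).det = 0 := by
  set f : Fin n → (Fin n → ℂ) → ℂ :=
    fun b y => ∑ a, (Γ y)⁻¹ a b * (Γ y).det * η y (Pi.single a 1) with hf
  have hf0 (b : Fin n) (z) (hz : z ∉ C) : f b z = 0 := by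
    simp only [hf, hsupp z hz, mul_zero, Finset.sum_const_zero]
  have hev (b : Fin n) (z) (hz : z ∉ C) : f b =ᶠ[𝓝 z] fun _ => 0 :=
    eventually_of_mem (hC.isClosed.isOpen_compl.mem_nhds hz) fun y hy => hf0 b y hy
  -- As `η` vanishes off the compact set `C ⊆ U`, so does `f b`; the behaviour of `Γ` outside `U` is
  -- irrelevant.
  have hfs (b : Fin n) : ContDiff ℝ ∞ (f b) := by
    refine contDiff_iff_contDiffAt.2 fun z => ?_
    by_cases hz : z ∈ C
    · exact ContDiffAt.sum fun a _ => ((hΓ.smooth_inv (hCU hz) a b).mul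
        (hΓ.smooth z (hCU hz)).det).mul (hη z (hCU hz) a)
    · exact contDiffAt_const.congr_of_eventuallyEq (hev b z hz)
  have hfc (b : Fin n) : HasCompactSupport (f b) := HasCompactSupport.intro hC (hf0 b)
  have h1 : ∫ z in U, divL Γ η z * (Γ z).det =
      ∫ z in U, ∑ b, db (f b) z (Pi.single b 1) :=
    setIntegral_congr_fun hΓ.isOpen.measurableSet fun z hz =>
      hΓ.divL_mul_det hz (hK z hz) (hη z hz)
  have h2 : ∫ z in U, ∑ b, db (f b) z (Pi.single b 1) = ∫ z, ∑ b, db (f b) z (Pi.single b 1) := by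
    refine setIntegral_eq_integral_of_forall_compl_eq_zero fun z hz => ?_
    refine Finset.sum_eq_zero fun b _ => ?_
    rw [db, cd_congr (hev b z fun h => hz (hCU h)), cd_const]
  have h3 (b : Fin n) : Integrable fun z => db (f b) z (Pi.single b 1) := by
    have hcont (u) : Continuous fun z => fderiv ℝ (f b) z u :=
      ((hfs b).continuous_fderiv (by simp)).clm_apply continuous_const
    have h2 (u) : Integrable fun z => fderiv ℝ (f b) z u :=
      (hcont u).integrable_of_hasCompactSupport ((hfc b).fderiv_apply ℝ u)
    exact ((h2 _).add ((h2 _).const_mul _)).const_mul _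
  rw [h1, h2, integral_finsetSum _ fun b _ => h3 b]
  exact Finset.sum_eq_zero fun b _ => integral_db_eq_zero (hfs b) (hfc b) _

end Kahler

/-! ### Transformation laws under holomorphic changes of coordinates and frame -/

section Transition

variable {n r : ℕ}

/-- A holomorphic change of coordinates `τ`, together with a holomorphic change of frame `s`, on
the open set `O`. -/
structure IsTransition (O : Set (Fin n → ℂ)) (τ : (Fin n → ℂ) → Fin n → ℂ)
    (s : (Fin n → ℂ) → Matrix (Fin r) (Fin r) ℂ) : Prop where
  isOpen : IsOpen O
  holo : DifferentiableOn ℂ τ O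
  holo_frame : ∀ i j, DifferentiableOn ℂ (fun z => s z i j) O
  det_ne : ∀ z ∈ O, (s z).det ≠ 0

/-- The Jacobian matrix of a holomorphic change of coordinates. -/
def jac (τ : (Fin n → ℂ) → Fin n → ℂ) (z : Fin n → ℂ) : Matrix (Fin n) (Fin n) ℂ :=
  LinearMap.toMatrix' (fderiv ℂ τ z : (Fin n → ℂ) →ₗ[ℂ] (Fin n → ℂ))

lemma jac_apply (τ : (Fin n → ℂ) → Fin n → ℂ) (z : Fin n → ℂ) (i j : Fin n) :
    jac τ z i j = fderiv ℂ τ z (Pi.single j 1) i := by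
  simp [jac, LinearMap.toMatrix'_apply]

/-- The contraction of a sesquilinear form with the inverse of a Gram matrix does not depend on
the basis. -/
lemma sum_inv_smul_sesquilinear {M : Type*} [AddCommGroup M] [Module ℂ M]
    {A A' J : Matrix (Fin n) (Fin n) ℂ} (hA : A = Jᴴ * A' * J) (hJ : J.det ≠ 0)
    (B : Fin n → Fin n → M) :
    ∑ a, ∑ b, A⁻¹ a b • ∑ c, ∑ d, (J c a * star (J d b)) • B c d =
      ∑ c, ∑ d, A'⁻¹ c d • B c d := by
  have hJH : IsUnit (Jᴴ).det := by rw [det_conjTranspose]; exact hJ.isUnit.star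
  have hinv : A'⁻¹ = J * A⁻¹ * Jᴴ := by
    rw [hA, Matrix.mul_inv_rev, Matrix.mul_inv_rev, Matrix.mul_assoc, Matrix.mul_assoc,
      Matrix.mul_assoc, nonsing_inv_mul _ hJH, Matrix.mul_one, ← Matrix.mul_assoc,
      mul_nonsing_inv _ hJ.isUnit, Matrix.one_mul]
  have h1 (c d : Fin n) : A'⁻¹ c d = ∑ a, ∑ b, A⁻¹ a b * (J c a * star (J d b)) := by
    rw [hinv, Matrix.mul_assoc]
    simp only [Matrix.mul_apply, Finset.mul_sum, conjTranspose_apply]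
    exact Finset.sum_congr rfl fun a _ => Finset.sum_congr rfl fun b _ => by ring
  simp only [h1, Finset.sum_smul, Finset.smul_sum, smul_smul]
  calc _ = ∑ a, ∑ c, ∑ b, ∑ d, (A⁻¹ a b * (J c a * star (J d b))) • B c d :=
        Finset.sum_congr rfl fun a _ => Finset.sum_comm
    _ = ∑ a, ∑ c, ∑ d, ∑ b, (A⁻¹ a b * (J c a * star (J d b))) • B c d :=
        Finset.sum_congr rfl fun a _ => Finset.sum_congr rfl fun c _ => Finset.sum_comm
    _ = ∑ c, ∑ a, ∑ d, ∑ b, (A⁻¹ a b * (J c a * star (J d b))) • B c d := Finset.sum_comm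
    _ = _ := Finset.sum_congr rfl fun c _ => Finset.sum_comm

variable {O U U' : Set (Fin n → ℂ)} {τ : (Fin n → ℂ) → Fin n → ℂ}
  {s : (Fin n → ℂ) → Matrix (Fin r) (Fin r) ℂ}
  {Γ Γ' : (Fin n → ℂ) → Matrix (Fin n) (Fin n) ℂ}
  {G G' m m' : (Fin n → ℂ) → Matrix (Fin r) (Fin r) ℂ}
  {Φ Φ' : (Fin n → ℂ) → (Fin n → ℂ) → Matrix (Fin r) (Fin r) ℂ} {z : Fin n → ℂ}

lemma IsTransition.smooth (h : IsTransition O τ s) (hz : z ∈ O) : SmoothMat s z :=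
  fun i j => contDiffAt_of_differentiableOn h.isOpen (h.holo_frame i j) hz

lemma IsTransition.differentiableAt (h : IsTransition O τ s) (hz : z ∈ O) :
    DifferentiableAt ℂ τ z := h.holo.differentiableAt (h.isOpen.mem_nhds hz)

lemma IsTransition.dbM_frame (h : IsTransition O τ s) (hz : z ∈ O) (u : Fin n → ℂ) :
    dbM s z u = 0 :=
  dbM_of_differentiableAt
    (fun i j => (h.holo_frame i j).differentiableAt (h.isOpen.mem_nhds hz)) u

lemma IsTransition.dbM_frame_inv (h : IsTransition O τ s) (hz : z ∈ O) (u : Fin n → ℂ) :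
    dbM (fun y => (s y)⁻¹) z u = 0 := by
  rw [dbM, cdM_inv (h.smooth hz) (h.det_ne z hz), ← dbM, h.dbM_frame hz]
  simp

lemma IsTransition.dlM_frame_inv (h : IsTransition O τ s) (hz : z ∈ O) (u : Fin n → ℂ) :
    dlM (fun y => (s y)⁻¹) z u = -((s z)⁻¹ * dlM s z u * (s z)⁻¹) :=
  cdM_inv (h.smooth hz) (h.det_ne z hz)

/-- The derivatives of the holomorphic matrix `s` are again holomorphic. This removes the
inhomogeneous term `s⁻¹ ∂s` from the curvature. -/
lemma IsTransition.dbM_dlM_frame (h : IsTransition O τ s) (hz : z ∈ O) (u w : Fin n → ℂ) :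
    dbM (fun y => dlM s y u) z w = 0 := by
  ext i j
  have h1 : (fun y => dlM s y u i j) =ᶠ[𝓝 z] fun y => fderiv ℂ (fun y => s y i j) y u := by
    filter_upwards [h.isOpen.mem_nhds hz] with y hy
    exact dl_of_differentiableAt ((h.holo_frame i j).differentiableAt (h.isOpen.mem_nhds hy)) u
  have h2 := differentiableOn_fderiv_apply h.isOpen (h.holo_frame i j) u
  exact (cd_congr h1).trans
    (db_of_differentiableAt (h2.differentiableAt (h.isOpen.mem_nhds hz)) w)

lemma IsTransition.fderiv_component (h : IsTransition O τ s) (hz : z ∈ O) (u : Fin n → ℂ)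
    (c : Fin n) : fderiv ℂ τ z u c = fderiv ℂ (fun y => τ y c) z u := by
  have h1 := (hasFDerivAt_pi'.1 (h.differentiableAt hz).hasFDerivAt c).fderiv
  rw [h1]; rfl

lemma IsTransition.differentiableOn_fderiv (h : IsTransition O τ s) (u : Fin n → ℂ) (c : Fin n) :
    DifferentiableOn ℂ (fun z => fderiv ℂ τ z u c) O := by
  have h1 : DifferentiableOn ℂ (fun y => τ y c) O := fun y hy =>
    differentiableWithinAt_pi.1 (h.holo y hy) c
  exact (differentiableOn_fderiv_apply h.isOpen h1 u).congr fun y hy => h.fderiv_component hy u c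

lemma IsTransition.contDiffAt_fderiv (h : IsTransition O τ s) (hz : z ∈ O) (u : Fin n → ℂ)
    (c : Fin n) : ContDiffAt ℝ ∞ (fun z => fderiv ℂ τ z u c) z :=
  contDiffAt_of_differentiableOn h.isOpen (h.differentiableOn_fderiv u c) hz

lemma IsTransition.contDiffAt_coord (h : IsTransition O τ s) (hz : z ∈ O) :
    ContDiffAt ℝ ∞ τ z :=
  contDiffAt_pi.2 fun c => contDiffAt_of_differentiableOn h.isOpen
    (fun y hy => differentiableWithinAt_pi.1 (h.holo y hy) c) hz

lemma IsTransition.smooth_comp (h : IsTransition O τ s) (hz : z ∈ O) (hm : SmoothMat m (τ z)) :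
    SmoothMat (fun y => m (τ y)) z :=
  fun i j => (hm i j).comp z (h.contDiffAt_coord hz)

lemma IsTransition.db_fderiv (h : IsTransition O τ s) (hz : z ∈ O) (u w : Fin n → ℂ)
    (c : Fin n) : db (fun y => fderiv ℂ τ y u c) z w = 0 :=
  db_of_differentiableAt ((h.differentiableOn_fderiv u c).differentiableAt
    (h.isOpen.mem_nhds hz)) w

/-- The `(0,1)`-derivative of the pullback of a `(1,0)`-form. -/
lemma IsTransition.db_pullback (h : IsTransition O τ s) (hz : z ∈ O)
    {η : (Fin n → ℂ) → (Fin n → ℂ) → ℂ} (hη : ∀ u, ContDiffAt ℝ ∞ (fun y => η y u) (τ z))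
    (hlin : ∀ y u, η y u = ∑ c, u c * η y (Pi.single c 1)) (u w : Fin n → ℂ) :
    db (fun y => η (τ y) (fderiv ℂ τ y u)) z w =
      db (fun y => η y (fderiv ℂ τ z u)) (τ z) (fderiv ℂ τ z w) := by
  have h1 (y) : η (τ y) (fderiv ℂ τ y u) =
      ∑ c, fderiv ℂ τ y u c * η (τ y) (Pi.single c 1) := hlin _ _
  have h2 (y) : η y (fderiv ℂ τ z u) = ∑ c, fderiv ℂ τ z u c * η y (Pi.single c 1) := hlin _ _
  have hs (c : Fin n) : ContDiffAt ℝ ∞ (fun y => η (τ y) (Pi.single c 1)) z :=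
    (hη _).comp z (h.contDiffAt_coord hz)
  simp only [h1, h2, db]
  rw [cd_sum fun c _ => (h.contDiffAt_fderiv hz u c).mul (hs c),
    cd_sum fun c _ => contDiffAt_const.mul (hη _)]
  refine Finset.sum_congr rfl fun c _ => ?_
  -- The entries of the Jacobian are holomorphic, so `∂̄` only acts on the components of `η`.
  have h3 := h.db_fderiv hz u w c
  rw [db] at h3
  rw [cd_mul (h.contDiffAt_fderiv hz u c) (hs c), cd_mul contDiffAt_const (hη _), h3, cd_const,
    cd_comp (h.differentiableAt hz) (hη _)]

lemma chernL_eq_sum (G : (Fin n → ℂ) → Matrix (Fin r) (Fin r) ℂ) (z u : Fin n → ℂ) :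
    chernL G z u = ∑ c, u c • chernL G z (Pi.single c 1) := by
  simp only [chernL]
  rw [dlM_eq_sum, Finset.mul_sum]
  simp only [Matrix.mul_smul]

lemma IsTransition.dbM_pullback_chernL (h : IsTransition O τ s) (hz : z ∈ O)
    (hG' : IsGram U' G') (hz' : τ z ∈ U') (u w : Fin n → ℂ) :
    dbM (fun y => chernL G' (τ y) (fderiv ℂ τ y u)) z w =
      dbM (fun y => chernL G' y (fderiv ℂ τ z u)) (τ z) (fderiv ℂ τ z w) := by
  ext i j
  refine h.db_pullback (η := fun y u => chernL G' y u i j) hz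
    (fun u => hG'.smooth_chernL hz' u i j) (fun y u => ?_) u w
  rw [chernL_eq_sum]
  simp [Matrix.sum_apply]

lemma IsTransition.smooth_pullback_chernL (h : IsTransition O τ s) (hz : z ∈ O)
    (hG' : IsGram U' G') (hz' : τ z ∈ U') (u : Fin n → ℂ) :
    SmoothMat (fun y => chernL G' (τ y) (fderiv ℂ τ y u)) z := by
  have h1 (y) : chernL G' (τ y) (fderiv ℂ τ y u) =
      ∑ c, fderiv ℂ τ y u c • chernL G' (τ y) (Pi.single c 1) := chernL_eq_sum _ _ _
  simp only [h1]
  exact SmoothMat.sum fun c _ => SmoothMat.smul (h.contDiffAt_fderiv hz u c)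
    (h.smooth_comp hz (hG'.smooth_chernL hz' _))

/-- The gauge transformation law of a connection. Only the right factor of `sᴴ G' s` contributes
`∂s`, because `∂(sᴴ) = (∂̄s)ᴴ = 0`. -/
lemma IsTransition.chernL_eq (h : IsTransition O τ s) (hz : z ∈ O) (hG' : IsGram U' G')
    (hz' : τ z ∈ U') (hG : ∀ y ∈ O, G y = (s y)ᴴ * G' (τ y) * s y) (u : Fin n → ℂ) :
    chernL G z u =
      (s z)⁻¹ * chernL G' (τ z) (fderiv ℂ τ z u) * s z + (s z)⁻¹ * dlM s z u := by
  have hs := h.smooth hz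
  have hc := h.smooth_comp hz (hG'.smooth _ hz')
  have hsd := (h.det_ne z hz).isUnit
  have hsH : IsUnit ((s z)ᴴ).det := by rw [det_conjTranspose]; exact hsd.star
  have h1 : dlM (fun y => (s y)ᴴ) z u = 0 := by
    rw [dlM_conjTranspose hs, h.dbM_frame hz, conjTranspose_zero]
  have h2 : dlM G z u = (s z)ᴴ * (dlM G' (τ z) (fderiv ℂ τ z u) * s z
      + G' (τ z) * dlM s z u) := by
    have h3 : dlM G z u = dlM (fun y => (s y)ᴴ * G' (τ y) * s y) z u :=
      cdM_congr (eventually_of_mem (h.isOpen.mem_nhds hz) hG)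
    rw [dlM] at h1
    rw [h3, dlM, cdM_mul (hs.conjTranspose.mul hc) hs, cdM_mul hs.conjTranspose hc, h1,
      cdM_comp (h.differentiableAt hz) (hG'.smooth _ hz')]
    simp only [Matrix.zero_mul, zero_add, Matrix.mul_add, Matrix.mul_assoc]
  rw [chernL, h2, hG z hz, Matrix.mul_inv_rev, Matrix.mul_inv_rev]
  simp only [chernL, Matrix.mul_assoc]
  rw [nonsing_inv_mul_cancel_left _ _ hsH]
  simp only [Matrix.mul_add]
  rw [nonsing_inv_mul_cancel_left _ _ (hG'.det_ne _ hz').isUnit]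

lemma IsTransition.dbM_chernL (h : IsTransition O τ s) (hz : z ∈ O) (hG' : IsGram U' G')
    (hτ : ∀ y ∈ O, τ y ∈ U') (hG : ∀ y ∈ O, G y = (s y)ᴴ * G' (τ y) * s y) (u w : Fin n → ℂ) :
    dbM (fun y => chernL G y u) z w = (s z)⁻¹ *
      dbM (fun y => chernL G' y (fderiv ℂ τ z u)) (τ z) (fderiv ℂ τ z w) * s z := by
  have hs := h.smooth hz
  have hsi := hs.inv (h.det_ne z hz)
  have hC := h.smooth_pullback_chernL hz hG' (hτ z hz) u
  have h1 := h.dbM_frame_inv hz w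
  have h2 := h.dbM_frame hz w
  have h3 := h.dbM_dlM_frame hz u w
  have h4 := h.dbM_pullback_chernL hz hG' (hτ z hz) u w
  have h5 : dbM (fun y => chernL G y u) z w =
      dbM (fun y => (s y)⁻¹ * chernL G' (τ y) (fderiv ℂ τ y u) * s y
        + (s y)⁻¹ * dlM s y u) z w :=
    cdM_congr (eventually_of_mem (h.isOpen.mem_nhds hz)
      fun y hy => h.chernL_eq hy hG' (hτ y hy) hG u)
  rw [h5, ← h4]
  rw [dbM] at h1 h2 h3 ⊢
  rw [cdM_add ((hsi.mul hC).mul hs) (hsi.mul hs.cdM), cdM_mul (hsi.mul hC) hs, cdM_mul hsi hC,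
    cdM_mul hsi hs.cdM, h1, h2, h3]
  simp

lemma inv_conj_mul_inv_conj {S A B : Matrix (Fin r) (Fin r) ℂ} (hS : S.det ≠ 0) :
    S⁻¹ * A * S * (S⁻¹ * B * S) = S⁻¹ * (A * B) * S := by
  simp only [Matrix.mul_assoc]
  rw [mul_nonsing_inv_cancel_left _ _ hS.isUnit]

lemma adj_conj {S A B : Matrix (Fin r) (Fin r) ℂ} (hS : S.det ≠ 0) :
    adj (Sᴴ * A * S) (S⁻¹ * B * S) = S⁻¹ * adj A B * S := by
  have hsH : IsUnit (Sᴴ).det := by rw [det_conjTranspose]; exact hS.isUnit.star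
  simp only [adj, Matrix.mul_inv_rev, conjTranspose_mul, conjTranspose_nonsing_inv,
    Matrix.mul_assoc]
  rw [nonsing_inv_mul_cancel_left _ _ hsH, nonsing_inv_mul_cancel_left _ _ hsH]

lemma IsTransition.curvL_eq (h : IsTransition O τ s) (hz : z ∈ O) (hG' : IsGram U' G')
    (hτ : ∀ y ∈ O, τ y ∈ U') (hG : ∀ y ∈ O, G y = (s y)ᴴ * G' (τ y) * s y)
    (hΦ : ∀ u, Φ z u = (s z)⁻¹ * Φ' (τ z) (fderiv ℂ τ z u) * s z) (u w : Fin n → ℂ) :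
    curvL G Φ z u w =
      (s z)⁻¹ * curvL G' Φ' (τ z) (fderiv ℂ τ z u) (fderiv ℂ τ z w) * s z := by
  have hd := h.det_ne z hz
  simp only [curvL]
  rw [h.dbM_chernL hz hG' hτ hG, hΦ, hΦ, hG z hz, adj_conj hd, inv_conj_mul_inv_conj hd,
    inv_conj_mul_inv_conj hd]
  simp only [Matrix.mul_add, Matrix.add_mul, Matrix.mul_sub, Matrix.sub_mul, Matrix.mul_neg,
    Matrix.neg_mul]

lemma IsHiggs.eq_sum (hΦ : IsHiggs U Φ) (z u : Fin n → ℂ) :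
    Φ z u = ∑ c, u c • Φ z (Pi.single c 1) := by
  let T : (Fin n → ℂ) →ₗ[ℂ] Matrix (Fin r) (Fin r) ℂ :=
    { toFun := Φ z, map_add' := hΦ.add z, map_smul' := hΦ.smul z }
  have h : T u = T (∑ c, u c • (Pi.single c 1 : Fin n → ℂ)) := by rw [← eq_sum_single u]
  rw [map_sum] at h
  simp only [map_smul] at h
  exact h

/-- Sesquilinearity of the curvature, the form required by `sum_inv_smul_sesquilinear`. -/
lemma curvL_eq_sum (hG : IsGram U G) (hΦ : IsHiggs U Φ) (hz : z ∈ U) (u w : Fin n → ℂ) :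
    curvL G Φ z u w =
      ∑ c, ∑ d, (u c * star (w d)) • curvL G Φ z (Pi.single c 1) (Pi.single d 1) := by
  have h1 : dbM (fun y => chernL G y u) z w =
      ∑ c, ∑ d, (u c * star (w d)) • dbM (fun y => chernL G y (Pi.single c 1)) z
        (Pi.single d 1) := by
    have h2 (y) : chernL G y u = ∑ c, u c • chernL G y (Pi.single c 1) := chernL_eq_sum _ _ _
    simp only [h2, dbM]
    rw [cdM_sum fun c _ => SmoothMat.smul contDiffAt_const (hG.smooth_chernL hz _)]
    refine Finset.sum_congr rfl fun c _ => ?_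
    rw [cdM_const_smul _ (hG.smooth_chernL hz _), ← dbM, dbM_eq_sum, Finset.smul_sum]
    simp only [smul_smul]
  have h3 : Φ z u * adj (G z) (Φ z w) = ∑ c, ∑ d, (u c * star (w d)) •
      (Φ z (Pi.single c 1) * adj (G z) (Φ z (Pi.single d 1))) := by
    rw [hΦ.eq_sum z u, hΦ.eq_sum z w, adj_sum, Finset.sum_mul_sum]
    simp only [adj_smul, Matrix.smul_mul, Matrix.mul_smul, smul_smul, mul_comm (star _)]
  have h4 : adj (G z) (Φ z w) * Φ z u = ∑ c, ∑ d, (u c * star (w d)) •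
      (adj (G z) (Φ z (Pi.single d 1)) * Φ z (Pi.single c 1)) := by
    rw [hΦ.eq_sum z u, hΦ.eq_sum z w, adj_sum, Finset.sum_mul_sum, Finset.sum_comm]
    simp only [adj_smul, Matrix.smul_mul, Matrix.mul_smul, smul_smul]
  rw [curvL, h1, h3, h4]
  simp only [curvL, smul_add, smul_sub, smul_neg, Finset.sum_add_distrib,
    Finset.sum_sub_distrib, Finset.sum_neg_distrib]

/-- The mean curvature does not depend on the coordinates and transforms as an endomorphism. -/
lemma IsTransition.meanL_eq (h : IsTransition O τ s) (hz : z ∈ O) (hG' : IsGram U' G')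
    (hΦ' : IsHiggs U' Φ')
    (hτ : ∀ y ∈ O, τ y ∈ U') (hG : ∀ y ∈ O, G y = (s y)ᴴ * G' (τ y) * s y)
    (hΓ : Γ z = (jac τ z)ᴴ * Γ' (τ z) * jac τ z) (hJ : (jac τ z).det ≠ 0)
    (hΦ : ∀ u, Φ z u = (s z)⁻¹ * Φ' (τ z) (fderiv ℂ τ z u) * s z) :
    meanL Γ G Φ z = (s z)⁻¹ * meanL Γ' G' Φ' (τ z) * s z := by
  have h1 := sum_inv_smul_sesquilinear hΓ hJ
    fun c d => curvL G' Φ' (τ z) (Pi.single c 1) (Pi.single d 1)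
  rw [meanL, meanL, ← h1]
  simp only [Finset.mul_sum, Finset.sum_mul, Matrix.mul_smul, Matrix.smul_mul]
  refine Finset.sum_congr rfl fun a _ => Finset.sum_congr rfl fun b _ => ?_
  rw [h.curvL_eq hz hG' hτ hG hΦ, curvL_eq_sum hG' hΦ' (hτ z hz)]
  simp only [Finset.mul_sum, Finset.sum_mul, Matrix.mul_smul, Matrix.smul_mul, jac_apply]

/-- The derivatives of the conjugating factors `s⁻¹` and `s` cancel the commutator with the
inhomogeneous term `s⁻¹ ∂s`. -/
lemma IsTransition.covL_eq (h : IsTransition O τ s) (hz : z ∈ O) (hG' : IsGram U' G')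
    (hz' : τ z ∈ U') (hG : ∀ y ∈ O, G y = (s y)ᴴ * G' (τ y) * s y)
    (hm' : SmoothMat m' (τ z)) (hm : ∀ y ∈ O, m y = (s y)⁻¹ * m' (τ y) * s y) (u : Fin n → ℂ) :
    covL G m z u = (s z)⁻¹ * covL G' m' (τ z) (fderiv ℂ τ z u) * s z := by
  have hs := h.smooth hz
  have hsd := h.det_ne z hz
  have hsi := hs.inv hsd
  have hc := h.smooth_comp hz hm'
  have h1 := h.dlM_frame_inv hz u
  have h2 : dlM m z u = dlM (fun y => (s y)⁻¹ * m' (τ y) * s y) z u :=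
    cdM_congr (eventually_of_mem (h.isOpen.mem_nhds hz) hm)
  rw [covL, h2, h.chernL_eq hz hG' hz' hG, hm z hz]
  rw [dlM] at h1 ⊢
  rw [cdM_mul (hsi.mul hc) hs, cdM_mul hsi hc, h1, cdM_comp (h.differentiableAt hz) hm']
  simp only [covL, Matrix.mul_add, Matrix.add_mul, Matrix.mul_sub, Matrix.sub_mul,
    Matrix.neg_mul, Matrix.mul_assoc, mul_nonsing_inv_cancel_left _ _ hsd.isUnit]
  abel

/-- The trace of `∂̄η` does not depend on the coordinates. -/
lemma IsTransition.divL_eq (h : IsTransition O τ s) (hz : z ∈ O)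
    (hΓ : Γ z = (jac τ z)ᴴ * Γ' (τ z) * jac τ z)
    (hJ : (jac τ z).det ≠ 0) {η η' : (Fin n → ℂ) → (Fin n → ℂ) → ℂ}
    (hη' : ∀ u, ContDiffAt ℝ ∞ (fun y => η' y u) (τ z))
    (hlin : ∀ y u, η' y u = ∑ c, u c * η' y (Pi.single c 1))
    (hη : ∀ y ∈ O, ∀ u, η y u = η' (τ y) (fderiv ℂ τ y u)) :
    divL Γ η z = divL Γ' η' (τ z) := by
  have h1 := sum_inv_smul_sesquilinear hΓ hJ
    fun c d => db (fun y => η' y (Pi.single c 1)) (τ z) (Pi.single d 1)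
  simp only [smul_eq_mul] at h1
  rw [divL, divL, ← h1]
  refine Finset.sum_congr rfl fun a _ => Finset.sum_congr rfl fun b _ => ?_
  have h2 : db (fun y => η y (Pi.single a 1)) z (Pi.single b 1) =
      db (fun y => η' (τ y) (fderiv ℂ τ y (Pi.single a 1))) z (Pi.single b 1) :=
    cd_congr (eventually_of_mem (h.isOpen.mem_nhds hz) fun y hy => hη y hy _)
  rw [h2, h.db_pullback hz hη' hlin]
  have h3 (y) : η' y (fderiv ℂ τ z (Pi.single a 1)) =
      ∑ c, jac τ z c a * η' y (Pi.single c 1) := by rw [hlin]; simp only [jac_apply]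
  congr 1
  simp only [h3, db]
  rw [cd_sum fun c _ => contDiffAt_const.mul (hη' _)]
  refine Finset.sum_congr rfl fun c _ => ?_
  rw [cd_mul contDiffAt_const (hη' _), cd_const, zero_mul, zero_add, ← db, db_eq_sum,
    Finset.mul_sum]
  simp only [jac_apply, mul_assoc]

end Transition

/-! ### Charts and frames of the manifold and the bundle -/

section ChangeOfFrame

variable {n r : ℕ} {X : Type*} [TopologicalSpace X] [ChartedSpace (Fin n → ℂ) X]
  {V : X → Type*} [TopologicalSpace (TotalSpace (Fin r → ℂ) V)]
  [∀ x, AddCommGroup (V x)] [∀ x, Module ℂ (V x)] [∀ x, TopologicalSpace (V x)]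
  [FiberBundle (Fin r → ℂ) V] [VectorBundle ℂ (Fin r → ℂ) V]

variable (r V) in
/-- The domain of the frame of `V` around `p`. -/
abbrev frameSet (p : X) : Set X := (trivializationAt (Fin r → ℂ) V p).baseSet

variable (r V) in
/-- The matrix of the change from the frame around `p` to the frame around `q`, at `y`. -/
def frameChange (p q y : X) : Matrix (Fin r) (Fin r) ℂ :=
  LinearMap.toMatrix' (comps r V q y ∘ₗ vec r V p y)

variable {p q y : X}

lemma comps_vec (hp : y ∈ frameSet r V p) (u : Fin r → ℂ) : comps r V p y (vec r V p y u) = u :=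
  (trivializationAt (Fin r → ℂ) V p).linearMapAt_symmₗ hp u

lemma vec_comps (hp : y ∈ frameSet r V p) (u : V y) : vec r V p y (comps r V p y u) = u :=
  (trivializationAt (Fin r → ℂ) V p).symmₗ_linearMapAt hp u

lemma frameChange_mulVec (u : Fin r → ℂ) :
    frameChange r V p q y *ᵥ u = comps r V q y (vec r V p y u) := by
  rw [frameChange, LinearMap.toMatrix'_mulVec]; rfl

lemma vec_eq (hq : y ∈ frameSet r V q) (u : Fin r → ℂ) :
    vec r V p y u = vec r V q y (frameChange r V p q y *ᵥ u) := by
  rw [frameChange_mulVec, vec_comps hq]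

lemma frameChange_mul (hp : y ∈ frameSet r V p) (hq : y ∈ frameSet r V q) :
    frameChange r V q p y * frameChange r V p q y = 1 := by
  rw [frameChange, frameChange, ← LinearMap.toMatrix'_comp, ← LinearMap.toMatrix'_id]
  congr 1
  ext1 i
  ext1
  simp [vec_comps hq, comps_vec hp]

lemma frameChange_inv (hp : y ∈ frameSet r V p) (hq : y ∈ frameSet r V q) :
    (frameChange r V p q y)⁻¹ = frameChange r V q p y :=
  inv_eq_left_inv (frameChange_mul hp hq)

lemma frameChange_det (hp : y ∈ frameSet r V p) (hq : y ∈ frameSet r V q) :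
    (frameChange r V p q y).det ≠ 0 := by
  have h := congrArg Matrix.det (frameChange_mul hp hq)
  rw [det_mul, det_one] at h
  exact right_ne_zero_of_mul_eq_one h

lemma endToMatrix_change (hp : y ∈ frameSet r V p) (hq : y ∈ frameSet r V q)
    (M : Module.End ℂ (V y)) : endToMatrix r V p y M =
      (frameChange r V p q y)⁻¹ * endToMatrix r V q y M * frameChange r V p q y := by
  rw [frameChange_inv hp hq]
  simp only [endToMatrix, frameChange]
  rw [← LinearMap.toMatrix'_comp, ← LinearMap.toMatrix'_comp]
  congr 1
  ext1 i
  ext1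
  simp [vec_comps hq]

lemma endToMatrix_endOfMatrix (hp : y ∈ frameSet r V p) (A : Matrix (Fin r) (Fin r) ℂ) :
    endToMatrix r V p y (endOfMatrix r V p y A) = A := by
  rw [endToMatrix, endOfMatrix]
  conv_rhs => rw [← LinearMap.toMatrix'_toLin' A]
  congr 1
  ext1 i
  ext1
  simp [comps_vec hp]

/-- The Gram matrix of a sesquilinear form at the point `y`, in the frame around `p`. -/
def gramAt (h : ∀ x, V x →ₗ[ℂ] V x →ₗ⋆[ℂ] ℂ) (p y : X) : Matrix (Fin r) (Fin r) ℂ :=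
  Matrix.of fun i j => h y (vec r V p y (Pi.single j 1)) (vec r V p y (Pi.single i 1))

lemma form_vec (h : ∀ x, V x →ₗ[ℂ] V x →ₗ⋆[ℂ] ℂ) (p y : X) (u w : Fin r → ℂ) :
    h y (vec r V p y u) (vec r V p y w) = star w ⬝ᵥ gramAt (r := r) h p y *ᵥ u := by
  conv_lhs => rw [eq_sum_single u, eq_sum_single w]
  simp only [map_sum, map_smul, LinearMap.map_smulₛₗ, LinearMap.sum_apply, LinearMap.smul_apply,
    dotProduct, mulVec, gramAt, Matrix.of_apply, smul_eq_mul, Finset.mul_sum, Pi.star_apply]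
  refine Finset.sum_congr rfl fun i _ => Finset.sum_congr rfl fun j _ => ?_
  simp only [starRingEnd_apply]
  ring

lemma dotProduct_mulVec_single {k : ℕ} (M : Matrix (Fin k) (Fin k) ℂ) (i j : Fin k) :
    star (Pi.single i 1 : Fin k → ℂ) ⬝ᵥ M *ᵥ Pi.single j 1 = M i j := hermVal_single M i j

lemma gramAt_change (h : ∀ x, V x →ₗ[ℂ] V x →ₗ⋆[ℂ] ℂ) (hq : y ∈ frameSet r V q) :
    gramAt (r := r) h p y =
      (frameChange r V p q y)ᴴ * gramAt (r := r) h q y * frameChange r V p q y := by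
  ext i j
  rw [gramAt, Matrix.of_apply, vec_eq (p := p) hq (Pi.single i 1), vec_eq (p := p) hq (Pi.single j 1),
    form_vec]
  refine Eq.trans ?_ (dotProduct_mulVec_single _ i j)
  simp only [← mulVec_mulVec, star_mulVec, ← dotProduct_mulVec]

lemma HermitianMetric.gram_eq (h : HermitianMetric n r V) (p : X) (z : Fin n → ℂ) :
    h.gram p z = gramAt (r := r) h.form p (pt p z) := rfl

lemma HermitianMetric.gramAt_isHermitian (h : HermitianMetric n r V) (p y : X) :
    (gramAt (r := r) h.form p y).IsHermitian := by
  ext i j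
  rw [conjTranspose_apply, gramAt, Matrix.of_apply, Matrix.of_apply, h.conj_symm y]
  simp

lemma HermitianMetric.gramAt_posDef (h : HermitianMetric n r V) (hp : y ∈ frameSet r V p) :
    (gramAt (r := r) h.form p y).PosDef := by
  refine PosDef.of_dotProduct_mulVec_pos (h.gramAt_isHermitian p y) fun u hu => ?_
  rw [← form_vec]
  have hu' : vec r V p y u ≠ 0 := fun h0 => hu (by rw [← comps_vec hp u, h0, map_zero])
  have h1 := h.conj_symm y (vec r V p y u) (vec r V p y u)
  rw [Complex.lt_def]
  exact ⟨h.pos y _ hu', (Complex.conj_eq_iff_im.1 h1.symm).symm⟩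

lemma pt_center (p : X) : pt p (center n p) = p :=
  (chartAt (Fin n → ℂ) p).left_inv (mem_chart_source _ p)

variable (n) in
lemma pt_chart (hy : y ∈ (chartAt (Fin n → ℂ) p).source) :
    pt p (chartAt (Fin n → ℂ) p y) = y :=
  (chartAt (Fin n → ℂ) p).left_inv hy

variable (n r V) in
lemma isOpen_coordDomain (p : X) : IsOpen (coordDomain n r V p) :=
  (chartAt (Fin n → ℂ) p).isOpen_inter_preimage_symm
    (trivializationAt (Fin r → ℂ) V p).open_baseSet

variable (n r V) in
lemma center_mem (p : X) : center n p ∈ coordDomain n r V p :=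
  ⟨mem_chart_target _ p, by
    rw [pt_center]; exact FiberBundle.mem_baseSet_trivializationAt' p⟩

variable (n r V) in
/-- The set of points that have coordinates and components with respect to `p`. -/
def chartDomain (p : X) : Set X := (chartAt (Fin n → ℂ) p).source ∩ frameSet r V p

variable (n r V) in
lemma isOpen_chartDomain (p : X) : IsOpen (chartDomain n r V p) :=
  (chartAt (Fin n → ℂ) p).open_source.inter (trivializationAt (Fin r → ℂ) V p).open_baseSet

variable (n r V) in
lemma mem_chartDomain_self (p : X) : p ∈ chartDomain n r V p :=
  ⟨mem_chart_source _ p, FiberBundle.mem_baseSet_trivializationAt' p⟩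

lemma chart_mem_coordDomain (hy : y ∈ chartDomain n r V p) :
    chartAt (Fin n → ℂ) p y ∈ coordDomain n r V p :=
  ⟨(chartAt (Fin n → ℂ) p).map_source hy.1, by rw [pt_chart n hy.1]; exact hy.2⟩

lemma isGram_gram (h : HermitianMetric n r V) (p : X) :
    IsGram (coordDomain n r V p) (h.gram p) where
  isOpen := isOpen_coordDomain n r V p
  smooth _ hz i j := (h.smooth p i j).contDiffAt ((isOpen_coordDomain n r V p).mem_nhds hz)
  herm _ _ := h.gramAt_isHermitian p _
  det_ne _ hz := (h.gramAt_posDef hz.2).det_pos.ne'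

lemma IsGram.mono {k : ℕ} {U U' : Set (Fin n → ℂ)} {G : (Fin n → ℂ) → Matrix (Fin k) (Fin k) ℂ}
    (hG : IsGram U G) (hU' : IsOpen U') (h : U' ⊆ U) : IsGram U' G where
  isOpen := hU'
  smooth z hz := hG.smooth z (h hz)
  herm z hz := hG.herm z (h hz)
  det_ne z hz := hG.det_ne z (h hz)

variable (n r V) in
/-- The coordinates at `p` of points that also have coordinates at `q`. -/
def overlap (p q : X) : Set (Fin n → ℂ) :=
  {z | z ∈ coordDomain n r V p ∧ pt p z ∈ chartDomain n r V q}

variable (n) in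
/-- The change of coordinates from `p` to `q`. -/
def coordChange (p q : X) (z : Fin n → ℂ) : Fin n → ℂ := chartAt (Fin n → ℂ) q (pt p z)

lemma pt_coordChange {z : Fin n → ℂ} (hz : z ∈ overlap n r V p q) :
    pt q (coordChange n p q z) = pt p z := pt_chart n hz.2.1

lemma coordChange_mem {z : Fin n → ℂ} (hz : z ∈ overlap n r V p q) :
    coordChange n p q z ∈ coordDomain n r V q := chart_mem_coordDomain hz.2

variable (n r V) in
lemma isOpen_overlap (p q : X) : IsOpen (overlap n r V p q) := by
  have h := (chartAt (Fin n → ℂ) p).isOpen_inter_preimage_symm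
    (((trivializationAt (Fin r → ℂ) V p).open_baseSet).inter (isOpen_chartDomain n r V q))
  convert h using 1
  ext z
  simp only [overlap, coordDomain, pt, Set.mem_ofPred_eq, Set.mem_inter_iff, Set.mem_preimage]
  tauto

variable [IsManifold 𝓘(ℂ, Fin n → ℂ) ω X]

lemma differentiableOn_coordChange : DifferentiableOn ℂ (coordChange n p q)
    ((chartAt (Fin n → ℂ) p).target ∩ pt p ⁻¹' (chartAt (Fin n → ℂ) q).source) := by
  have h1 : ContMDiffOn 𝓘(ℂ, Fin n → ℂ) 𝓘(ℂ, Fin n → ℂ) ω (pt (n := n) p)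
      (chartAt (Fin n → ℂ) p).target := contMDiffOn_chart_symm
  have h2 : ContMDiffOn 𝓘(ℂ, Fin n → ℂ) 𝓘(ℂ, Fin n → ℂ) ω (chartAt (Fin n → ℂ) q)
      (chartAt (Fin n → ℂ) q).source := contMDiffOn_chart
  exact (h2.comp' h1).contDiffOn.differentiableOn (by simp)

-- Here the holomorphic structures of manifold and bundle enter: both transition maps are of class
-- `ω` over `ℂ`, hence complex differentiable.
variable (V) in
lemma isTransition [ContMDiffVectorBundle ω (Fin r → ℂ) V 𝓘(ℂ, Fin n → ℂ)] (p q : X) :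
    IsTransition (overlap n r V p q) (coordChange n p q)
      (fun z => frameChange r V p q (pt p z)) where
  isOpen := isOpen_overlap n r V p q
  holo := differentiableOn_coordChange.mono fun z hz => ⟨hz.1.1, hz.2.1⟩
  holo_frame i j := by
    have h1 : ContMDiffOn 𝓘(ℂ, Fin n → ℂ) 𝓘(ℂ, Fin n → ℂ) ω (pt (n := n) p)
      (chartAt (Fin n → ℂ) p).target := contMDiffOn_chart_symm
    have h2 := contMDiffOn_coordChangeL (n := ω) (IB := 𝓘(ℂ, Fin n → ℂ)) (𝕜 := ℂ)
      (trivializationAt (Fin r → ℂ) V p) (trivializationAt (Fin r → ℂ) V q)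
    have h3 := ((h2.comp' h1).contDiffOn.differentiableOn (by simp)).mono
      (show overlap n r V p q ⊆ _ from fun z hz => ⟨hz.1.1, hz.1.2, hz.2.2⟩)
    have h4 : DifferentiableOn ℂ (fun z => ((trivializationAt (Fin r → ℂ) V p).coordChangeL ℂ
        (trivializationAt (Fin r → ℂ) V q) (pt p z) : (Fin r → ℂ) →L[ℂ] (Fin r → ℂ))
          (Pi.single j 1) i) (overlap n r V p q) := fun z hz =>
      differentiableWithinAt_pi.1 ((h3 z hz).clm_apply (differentiableWithinAt_const _)) i
    refine h4.congr fun z hz => ?_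
    rw [frameChange, LinearMap.toMatrix'_apply]
    simp only [ContinuousLinearEquiv.coe_coe]
    rw [Trivialization.coordChangeL_apply _ _ ⟨hz.1.2, hz.2.2⟩]
    simp [comps, vec, hz.2.2, hz.1.2]
  det_ne z hz := frameChange_det hz.1.2 hz.2.2

lemma mem_coordDomain_TX {z : Fin n → ℂ} :
    z ∈ coordDomain n n (TX n) p ↔ z ∈ (chartAt (Fin n → ℂ) p).target := by
  refine ⟨fun h => h.1, fun h => ⟨h, ?_⟩⟩
  exact (chartAt (Fin n → ℂ) p).map_target h

/-- The change of frame of the tangent bundle is the derivative of the change of coordinates. -/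
lemma comps_vec_TX {z : Fin n → ℂ} (hz : z ∈ (chartAt (Fin n → ℂ) p).target)
    (hq : pt p z ∈ (chartAt (Fin n → ℂ) q).source) (u : Fin n → ℂ) :
    comps n (TX n) q (pt p z) (vec n (TX n) p (pt p z) u) =
      fderiv ℂ (coordChange n p q) z u := by
  have hp : pt p z ∈ (chartAt (Fin n → ℂ) p).source := (chartAt (Fin n → ℂ) p).map_target hz
  have h1 : comps n (TX n) q (pt p z) (vec n (TX n) p (pt p z) u) =
      (trivializationAt (Fin n → ℂ) (TX n) p).coordChangeL ℂ
        (trivializationAt (Fin n → ℂ) (TX n) q) (pt p z) u := by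
    rw [Trivialization.coordChangeL_apply _ _ ⟨hp, hq⟩]
    rw [comps, vec, Trivialization.coe_linearMapAt_of_mem _ hq, Trivialization.symmₗ_apply _ hp]
  have h2 := (tangentBundleCore 𝓘(ℂ, Fin n → ℂ) X).localTriv_coordChange_eq
    (achart (Fin n → ℂ) p) (achart (Fin n → ℂ) q) (b := pt p z) ⟨hp, hq⟩ u
  rw [h1]
  refine Eq.trans h2 ?_
  rw [tangentBundleCore_coordChange_achart]
  have h3 : extChartAt 𝓘(ℂ, Fin n → ℂ) p (pt p z) = z := by
    simp [pt, hz]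
  rw [h3]
  simp only [modelWithCornersSelf_coe, Set.range_id, fderivWithin_univ]
  rfl

lemma jac_coordChange {z : Fin n → ℂ} (hz : z ∈ (chartAt (Fin n → ℂ) p).target)
    (hq : pt p z ∈ (chartAt (Fin n → ℂ) q).source) :
    jac (coordChange n p q) z = frameChange n (TX n) p q (pt p z) := by
  ext i j
  rw [jac_apply, ← comps_vec_TX hz hq, frameChange, LinearMap.toMatrix'_apply]
  rfl

end ChangeOfFrame

/-! ### The volume measure in charts -/

section Volume

variable {n : ℕ} {X : Type*} [TopologicalSpace X] [ChartedSpace (Fin n → ℂ) X]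
  [IsManifold 𝓘(ℂ, Fin n → ℂ) ω X] [MeasurableSpace X] [BorelSpace X]

/-- The density of the volume of `g` in the coordinates at `p`. -/
def volumeDensity (g : HermitianMetric n n (TX n (X := X))) (p : X) (z : Fin n → ℂ) : ENNReal :=
  ENNReal.ofReal (2 ^ n * (g.gram p z).det.re)

/-- The volume of `g` on the domain of the chart at `p`. -/
def chartVolume (g : HermitianMetric n n (TX n (X := X))) (p : X) : Measure X :=
  Measure.map (pt p) ((volume.withDensity (volumeDensity g p)).restrict
    (chartAt (Fin n → ℂ) p).target)

lemma kahlerVolume_eq (g : HermitianMetric n n (TX n (X := X))) :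
    kahlerVolume g = ⨆ p, chartVolume g p := rfl

lemma measurableSet_chart_target (p : X) : MeasurableSet (chartAt (Fin n → ℂ) p).target :=
  (chartAt (Fin n → ℂ) p).open_target.measurableSet

lemma measurableSet_chart_source (p : X) : MeasurableSet (chartAt (Fin n → ℂ) p).source :=
  (chartAt (Fin n → ℂ) p).open_source.measurableSet

lemma aemeasurable_pt (p : X) (μ : Measure (Fin n → ℂ)) :
    AEMeasurable (pt p) (μ.restrict (chartAt (Fin n → ℂ) p).target) :=
  (chartAt (Fin n → ℂ) p).continuousOn_symm.aemeasurable (measurableSet_chart_target p)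

lemma measurableSet_preimage_pt (p : X) {E : Set X} (hE : MeasurableSet E) :
    MeasurableSet (pt p ⁻¹' E ∩ (chartAt (Fin n → ℂ) p).target) := by
  have h1 : Continuous ((chartAt (Fin n → ℂ) p).target.domRestrict (pt p)) :=
    continuousOn_iff_continuous_domRestrict.1 (chartAt (Fin n → ℂ) p).continuousOn_symm
  have h2 := (measurableSet_chart_target p).subtype_image (h1.measurable hE)
  convert h2 using 1
  ext z
  simp [Set.domRestrict]

variable (g : HermitianMetric n n (TX n (X := X)))

lemma chartVolume_apply (p : X) {E : Set X} (hE : MeasurableSet E) :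
    chartVolume g p E =
      ∫⁻ z in pt p ⁻¹' E ∩ (chartAt (Fin n → ℂ) p).target, volumeDensity g p z := by
  rw [chartVolume, Measure.map_apply_of_aemeasurable (aemeasurable_pt p _) hE,
    Measure.restrict_apply' (measurableSet_chart_target p),
    withDensity_apply _ (measurableSet_preimage_pt p hE)]

lemma chartVolume_inter_source (p : X) {E : Set X} (hE : MeasurableSet E) :
    chartVolume g p (E ∩ (chartAt (Fin n → ℂ) p).source) = chartVolume g p E := by
  rw [chartVolume_apply g p hE, chartVolume_apply g p (hE.inter (measurableSet_chart_source p))]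
  congr 2
  ext z
  simp only [Set.mem_inter_iff, Set.mem_preimage]
  exact ⟨fun h => ⟨h.1.1, h.2⟩, fun h => ⟨⟨h.1, (chartAt (Fin n → ℂ) p).map_target h.2⟩, h.2⟩⟩

lemma abs_det_restrictScalars (L : (Fin n → ℂ) →L[ℂ] (Fin n → ℂ)) :
    |(L.restrictScalars ℝ).det| = ‖(LinearMap.toMatrix' (L : (Fin n → ℂ) →ₗ[ℂ] _)).det‖ ^ 2 := by
  have h1 : (L.restrictScalars ℝ).det =
      LinearMap.det ((L : (Fin n → ℂ) →ₗ[ℂ] (Fin n → ℂ)).restrictScalars ℝ) := rfl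
  rw [h1, LinearMap.det_restrictScalars, LinearMap.det_toMatrix', Algebra.norm_complex_eq]
  simp [Complex.normSq_eq_norm_sq]

/-- The real Jacobian determinant of a holomorphic map is `|det J|²`, which is also the factor
relating the two values of `det g`. -/
lemma volumeDensity_change {p q : X} {z : Fin n → ℂ}
    (hz : z ∈ (chartAt (Fin n → ℂ) p).target) (hq : pt p z ∈ (chartAt (Fin n → ℂ) q).source) :
    ENNReal.ofReal |((fderiv ℂ (coordChange n p q) z).restrictScalars ℝ).det| *
      volumeDensity g q (coordChange n p q z) = volumeDensity g p z := by
  have hq' : pt p z ∈ frameSet n (TX n) q := hq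
  rw [volumeDensity, volumeDensity, ← ENNReal.ofReal_mul (abs_nonneg _), g.gram_eq, g.gram_eq]
  have e1 : pt q (coordChange n p q z) = pt p z := pt_chart n hq
  rw [e1, gramAt_change (r := n) g.form (p := p) hq', abs_det_restrictScalars]
  have e2 : LinearMap.toMatrix' ((fderiv ℂ (coordChange n p q) z : (Fin n → ℂ) →L[ℂ] _) :
      (Fin n → ℂ) →ₗ[ℂ] (Fin n → ℂ)) = frameChange n (TX n) p q (pt p z) := by
    rw [← jac_coordChange hz hq]
    ext i j
    rw [jac_apply, LinearMap.toMatrix'_apply]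
    rfl
  rw [e2, det_mul, det_mul, det_conjTranspose]
  congr 1
  set d := (frameChange n (TX n) p q (pt p z)).det
  have e3 : star d * (gramAt (r := n) g.form q (pt p z)).det * d =
      ((‖d‖ ^ 2 : ℝ) : ℂ) * (gramAt (r := n) g.form q (pt p z)).det := by
    rw [← Complex.normSq_eq_norm_sq, Complex.normSq_eq_conj_mul_self, starRingEnd_apply]
    ring
  rw [e3, Complex.re_ofReal_mul]
  ring

lemma chartVolume_eq_of_subset {p q : X} {E : Set X} (hE : MeasurableSet E)
    (hp : E ⊆ (chartAt (Fin n → ℂ) p).source) (hq : E ⊆ (chartAt (Fin n → ℂ) q).source) :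
    chartVolume g p E = chartVolume g q E := by
  rw [chartVolume_apply g p hE, chartVolume_apply g q hE]
  set S := pt p ⁻¹' E ∩ (chartAt (Fin n → ℂ) p).target
  have hS : MeasurableSet S := measurableSet_preimage_pt p hE
  have himg : coordChange n p q '' S = pt q ⁻¹' E ∩ (chartAt (Fin n → ℂ) q).target := by
    ext w
    constructor
    · rintro ⟨z, hz, rfl⟩
      have h1 : pt q (coordChange n p q z) = pt p z := pt_chart n (hq hz.1)
      exact ⟨by rw [Set.mem_preimage, h1]; exact hz.1,
        (chartAt (Fin n → ℂ) q).map_source (hq hz.1)⟩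
    · rintro ⟨h1, h2⟩
      refine ⟨chartAt (Fin n → ℂ) p (pt q w), ⟨?_, (chartAt (Fin n → ℂ) p).map_source (hp h1)⟩, ?_⟩
      · rw [Set.mem_preimage, pt_chart n (hp h1)]
        exact h1
      · rw [coordChange, pt_chart n (hp h1)]
        exact (chartAt (Fin n → ℂ) q).right_inv h2
  have hinj : Set.InjOn (coordChange n p q) S := by
    intro z hz w hw h
    have h1 : pt p z = pt p w := by
      have := congrArg (pt q) h
      rwa [coordChange, coordChange, pt_chart n (hq hz.1), pt_chart n (hq hw.1)] at this
    exact (chartAt (Fin n → ℂ) p).symm.injOn hz.2 hw.2 h1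
  have hder : ∀ z ∈ S, HasFDerivWithinAt (coordChange n p q)
      ((fderiv ℂ (coordChange n p q) z).restrictScalars ℝ) S z := by
    intro z hz
    have h1 : IsOpen ((chartAt (Fin n → ℂ) p).target ∩
        pt p ⁻¹' (chartAt (Fin n → ℂ) q).source) :=
      (chartAt (Fin n → ℂ) p).isOpen_inter_preimage_symm (chartAt (Fin n → ℂ) q).open_source
    exact (((differentiableOn_coordChange (p := p) (q := q)).differentiableAt
      (h1.mem_nhds ⟨hz.2, hq hz.1⟩)).hasFDerivAt.restrictScalars ℝ).hasFDerivWithinAt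
  rw [← himg, lintegral_image_eq_lintegral_abs_det_fderiv_mul volume hS hder hinj]
  exact setLIntegral_congr_fun hS fun z hz => (volumeDensity_change g hz.2 (hq hz.1)).symm

/-- Glues the chart measures over finitely many charts, each new chart `a` being used only off the
part `W` already covered. The result serves as an upper bound for the supremum defining
`kahlerVolume`. -/
lemma exists_measure_eq_chartVolume (t : Finset X) : ∃ ν : Measure X, ∀ q : X, ∀ E : Set X,
    MeasurableSet E → E ⊆ (chartAt (Fin n → ℂ) q).source →
      E ⊆ ⋃ a ∈ t, (chartAt (Fin n → ℂ) a).source → ν E = chartVolume g q E := by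
  classical
  induction t using Finset.induction_on with
  | empty =>
    refine ⟨0, fun q E _ _ h => ?_⟩
    have : E = ∅ := by simpa using h
    simp [this]
  | insert a t _ ih =>
    obtain ⟨ν, hν⟩ := ih
    set W := ⋃ a ∈ t, (chartAt (Fin n → ℂ) a).source
    have hW : MeasurableSet W :=
      (isOpen_biUnion fun a _ => (chartAt (Fin n → ℂ) a).open_source).measurableSet
    refine ⟨ν.restrict W + (chartVolume g a).restrict Wᶜ, fun q E hE hq h => ?_⟩
    have h2 : E ∩ Wᶜ ⊆ (chartAt (Fin n → ℂ) a).source := by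
      intro x hx
      have := h hx.1
      rw [Finset.set_biUnion_insert] at this
      exact this.resolve_right hx.2
    rw [Measure.add_apply, Measure.restrict_apply hE, Measure.restrict_apply hE,
      hν q _ (hE.inter hW) (Set.inter_subset_left.trans hq) Set.inter_subset_right,
      chartVolume_eq_of_subset g (hE.inter hW.compl) h2 (Set.inter_subset_left.trans hq)]
    exact measure_inter_add_sdiff E hW

variable [CompactSpace X]

/-- By compactness the glued measure `ν` of a finite cover dominates every chart measure, hence
their supremum; on `E` it equals the chart measure, which is also a lower bound. -/
lemma kahlerVolume_apply {p : X} {E : Set X} (hE : MeasurableSet E)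
    (hp : E ⊆ (chartAt (Fin n → ℂ) p).source) : kahlerVolume g E = chartVolume g p E := by
  obtain ⟨t, ht⟩ := isCompact_univ.elim_finite_subcover (fun a : X => (chartAt (Fin n → ℂ) a).source)
    (fun a => (chartAt (Fin n → ℂ) a).open_source)
    (fun x _ => Set.mem_iUnion.2 ⟨x, mem_chart_source _ x⟩)
  obtain ⟨ν, hν⟩ := exists_measure_eq_chartVolume g t
  have hle : kahlerVolume g ≤ ν := by
    rw [kahlerVolume_eq]
    refine iSup_le fun q => Measure.le_iff.2 fun F hF => ?_
    rw [← chartVolume_inter_source g q hF, ← hν q _ (hF.inter (measurableSet_chart_source q))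
      Set.inter_subset_right fun x _ => ht (Set.mem_univ x)]
    exact measure_mono Set.inter_subset_left
  refine le_antisymm ?_ ?_
  · rw [← hν p E hE hp fun x _ => ht (Set.mem_univ x)]
    exact hle E
  · rw [kahlerVolume_eq]
    exact (le_iSup (chartVolume g) p : _) E

lemma kahlerVolume_restrict (p : X) :
    (kahlerVolume g).restrict (chartAt (Fin n → ℂ) p).source = chartVolume g p := by
  ext E hE
  rw [Measure.restrict_apply hE, kahlerVolume_apply g (hE.inter (measurableSet_chart_source p))
    Set.inter_subset_right, chartVolume_inter_source g p hE]

lemma continuousOn_det_gram (p : X) : ContinuousOn (fun z => (g.gram p z).det)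
    (chartAt (Fin n → ℂ) p).target := by
  have h : ∀ i j, ContinuousOn (fun z => g.gram p z i j) (chartAt (Fin n → ℂ) p).target :=
    fun i j => ((g.smooth p i j).continuousOn).mono fun z hz => mem_coordDomain_TX.2 hz
  simp only [det_apply]
  exact continuousOn_finsetSum _ fun σ _ => (continuousOn_finsetProd _ fun i _ => h _ _).const_smul _

lemma continuousOn_volumeDensity (p : X) :
    ContinuousOn (volumeDensity g p) (chartAt (Fin n → ℂ) p).target :=
  ENNReal.continuous_ofReal.comp_continuousOn
    ((Complex.continuous_re.comp_continuousOn (continuousOn_det_gram g p)).const_smul ((2 : ℝ) ^ n))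

instance isFiniteMeasure_kahlerVolume : IsFiniteMeasure (kahlerVolume g) := by
  have : IsLocallyFiniteMeasure (kahlerVolume g) := by
    refine ⟨fun p => ?_⟩
    set e := chartAt (Fin n → ℂ) p
    have hc : center n p ∈ e.target := mem_chart_target _ p
    have h1 : ContinuousAt (volumeDensity g p) (center n p) :=
      (continuousOn_volumeDensity g p).continuousAt (e.open_target.mem_nhds hc)
    -- The density is continuous, hence bounded on a small coordinate ball; local finiteness gives
    -- finiteness by compactness of `X`.
    have h2 : ∀ᶠ z in 𝓝 (center n p), volumeDensity g p z < volumeDensity g p (center n p) + 1 :=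
      h1.eventually_lt continuousAt_const (ENNReal.lt_add_right ENNReal.ofReal_ne_top one_ne_zero)
    obtain ⟨δ, hδ, hball⟩ := Metric.eventually_nhds_iff_ball.1 (h2.and (e.open_target.mem_nhds hc))
    have ho : IsOpen (e.source ∩ e ⁻¹' Metric.ball (center n p) δ) :=
      e.isOpen_inter_preimage Metric.isOpen_ball
    refine ⟨_, ho.mem_nhds ⟨mem_chart_source _ p, Metric.mem_ball_self hδ⟩, ?_⟩
    rw [kahlerVolume_apply g (p := p) ho.measurableSet Set.inter_subset_left,
      chartVolume_apply g p ho.measurableSet]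
    have hsub : pt p ⁻¹' (e.source ∩ e ⁻¹' Metric.ball (center n p) δ) ∩ e.target ⊆
        Metric.ball (center n p) δ := by
      intro z hz
      have := hz.1.2
      rwa [Set.mem_preimage, show e (pt p z) = z from e.right_inv hz.2] at this
    refine (lintegral_mono_set hsub).trans_lt ?_
    refine (setLIntegral_mono (g := fun _ => volumeDensity g p (center n p) + 1)
      measurable_const fun z hz => (hball z hz).1.le).trans_lt ?_
    rw [setLIntegral_const]
    exact ENNReal.mul_lt_top (ENNReal.add_lt_top.2 ⟨ENNReal.ofReal_lt_top, ENNReal.one_lt_top⟩)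
      measure_ball_lt_top
  infer_instance

/-- The integral of a function with support in the domain of a chart, in coordinates. -/
lemma integral_kahlerVolume {r : ℕ} {V : X → Type*} [TopologicalSpace (TotalSpace (Fin r → ℂ) V)]
    [∀ x, AddCommGroup (V x)] [∀ x, Module ℂ (V x)] [∀ x, TopologicalSpace (V x)]
    [FiberBundle (Fin r → ℂ) V] [VectorBundle ℂ (Fin r → ℂ) V] {f : X → ℂ} {p : X}
    (hf : AEStronglyMeasurable f (kahlerVolume g)) (hsupp : ∀ x ∉ chartDomain n r V p, f x = 0) :
    ∫ x, f x ∂(kahlerVolume g) =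
      2 ^ n * ∫ z in coordDomain n r V p, f (pt p z) * (g.gram p z).det := by
  have hT := measurableSet_chart_target (n := n) p
  rw [← setIntegral_eq_integral_of_forall_compl_eq_zero
    (s := (chartAt (Fin n → ℂ) p).source) fun x hx => hsupp x fun h => hx h.1,
    kahlerVolume_restrict, chartVolume, integral_map (aemeasurable_pt p _)
    (by rw [← chartVolume, ← kahlerVolume_restrict]; exact hf.restrict),
    restrict_withDensity hT, integral_withDensity_eq_integral_toReal_smul₀
      ((continuousOn_volumeDensity g p).aemeasurable hT)
      (Eventually.of_forall fun _ => ENNReal.ofReal_lt_top)]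
  have hsub : coordDomain n r V p ⊆ (chartAt (Fin n → ℂ) p).target := fun z hz => hz.1
  rw [← integral_const_mul, ← setIntegral_eq_of_subset_of_forall_sdiff_eq_zero hT hsub]
  · refine setIntegral_congr_fun hT fun z hz => ?_
    have hpos := (g.gramAt_posDef (p := p) (y := pt p z)
      ((chartAt (Fin n → ℂ) p).map_target hz)).det_pos
    rw [← g.gram_eq] at hpos
    have h1 := Complex.lt_def.1 hpos
    simp only [volumeDensity]
    rw [ENNReal.toReal_ofReal (mul_nonneg (by positivity) h1.1.le), Complex.real_smul]
    -- The determinant is real because the Gram matrix is positive definite.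
    have h2 : (((g.gram p z).det.re : ℝ) : ℂ) = (g.gram p z).det :=
      Complex.ext rfl (by simpa using h1.2)
    push_cast
    rw [h2]
    ring
  · intro z hz
    rw [hsupp (pt p z) fun h => hz.2 ⟨hz.1, h.2⟩, zero_mul, mul_zero]

end Volume

/-! ### Time derivatives of families -/

section TimeDerivative

variable {n r : ℕ} {S : Set (ℝ × (Fin n → ℂ))} {q : ℝ × (Fin n → ℂ)}
  {A : ℝ → (Fin n → ℂ) → Matrix (Fin r) (Fin r) ℂ}

/-- The time derivative of a matrix valued function. -/
abbrev dtM (A : ℝ → (Fin n → ℂ) → Matrix (Fin r) (Fin r) ℂ) (q : ℝ × (Fin n → ℂ)) :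
    Matrix (Fin r) (Fin r) ℂ :=
  cdM 1 (1, 0) (1, 0) (fun q => A q.1 q.2) q

lemma hasDerivAt_of_joint {f : ℝ × (Fin n → ℂ) → ℂ} {t : ℝ} {z : Fin n → ℂ}
    (hf : ContDiffAt ℝ ∞ f (t, z)) :
    HasDerivAt (fun t => f (t, z)) (cd 1 (1, 0) (1, 0) f (t, z)) t := by
  have h := (hf.differentiableAt (by simp)).hasFDerivAt.comp_hasDerivAt t
    ((hasDerivAt_id t).prodMk (hasDerivAt_const t z))
  have h1 : cd 1 (1, 0) (1, 0) f (t, z) = fderiv ℝ f (t, z) (1, 0) := by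
    simp only [cd]
    ring
  rw [h1]
  exact h

lemma cdM_eventuallyEq_joint (hS : IsOpen S) (hA : ∀ q ∈ S, SmoothMat (fun q => A q.1 q.2) q)
    (hq : q ∈ S) (c : ℂ) (a b : Fin n → ℂ) :
    (fun q : ℝ × (Fin n → ℂ) => cdM c a b (A q.1) q.2) =ᶠ[𝓝 q]
      cdM c (0, a) (0, b) fun q => A q.1 q.2 := by
  filter_upwards [hS.mem_nhds hq] with q' hq'
  exact cdM_slice (A := fun q => A q.1 q.2) (hA q' hq')

lemma smoothMat_cdM_joint (hS : IsOpen S) (hA : ∀ q ∈ S, SmoothMat (fun q => A q.1 q.2) q)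
    (hq : q ∈ S) (c : ℂ) (a b : Fin n → ℂ) :
    SmoothMat (fun q : ℝ × (Fin n → ℂ) => cdM c a b (A q.1) q.2) q :=
  SmoothMat.congr (hA q hq).cdM (cdM_eventuallyEq_joint hS hA hq c a b)

/-- Time and space derivatives commute, once the space derivative is read on `ℝ × ℂⁿ`. -/
lemma dtM_cdM (hS : IsOpen S) (hA : ∀ q ∈ S, SmoothMat (fun q => A q.1 q.2) q)
    (hq : q ∈ S) (c : ℂ) (a b : Fin n → ℂ) :
    dtM (fun t y => cdM c a b (A t) y) q = cdM c a b (fun y => dtM A (q.1, y)) q.2 := by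
  rw [dtM, cdM_congr (cdM_eventuallyEq_joint hS hA hq c a b), cdM_comm (hA q hq)]
  exact (cdM_slice (t := q.1) (z := q.2) (hA q hq).cdM).symm

lemma contDiffAt_snd {f : (Fin n → ℂ) → ℂ} (hf : ContDiffAt ℝ ∞ f q.2) :
    ContDiffAt ℝ ∞ (fun q : ℝ × (Fin n → ℂ) => f q.2) q :=
  ContDiffAt.comp q hf contDiff_snd.contDiffAt

lemma cd_time_snd {f : (Fin n → ℂ) → ℂ} (hf : ContDiffAt ℝ ∞ f q.2) :
    cd 1 (1, 0) (1, 0) (fun q : ℝ × (Fin n → ℂ) => f q.2) q = 0 := by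
  have h : HasFDerivAt (fun q : ℝ × (Fin n → ℂ) => f q.2)
      ((fderiv ℝ f q.2).comp (ContinuousLinearMap.snd ℝ ℝ (Fin n → ℂ))) q :=
    (hf.differentiableAt (by simp)).hasFDerivAt.comp q hasFDerivAt_snd
  simp [cd, h.fderiv]

lemma SmoothMat.snd {B : (Fin n → ℂ) → Matrix (Fin r) (Fin r) ℂ} (hB : SmoothMat B q.2) :
    SmoothMat (fun q : ℝ × (Fin n → ℂ) => B q.2) q := fun i j => contDiffAt_snd (hB i j)

lemma dtM_snd {B : (Fin n → ℂ) → Matrix (Fin r) (Fin r) ℂ} (hB : SmoothMat B q.2) :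
    dtM (fun _ y => B y) q = 0 := by
  ext i j
  exact cd_time_snd (hB i j)

end TimeDerivative

/-! ### First variation of connection, Higgs adjoint and mean curvature -/

section Variation

variable {n r : ℕ}

/-- `G` is a family of Gram matrices on the open set `U` that is smooth for `t ∈ I`. -/
structure IsGramFamily (I : Set ℝ) (U : Set (Fin n → ℂ))
    (G : ℝ → (Fin n → ℂ) → Matrix (Fin r) (Fin r) ℂ) : Prop where
  isOpen_time : IsOpen I
  gram : ∀ t, IsGram U (G t)
  smooth : ∀ q ∈ I ×ˢ U, SmoothMat (fun q : ℝ × (Fin n → ℂ) => G q.1 q.2) q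

/-- The endomorphism `G⁻¹ ∂ₜG`. -/
def velocity (G : ℝ → (Fin n → ℂ) → Matrix (Fin r) (Fin r) ℂ) (t : ℝ) (z : Fin n → ℂ) :
    Matrix (Fin r) (Fin r) ℂ :=
  (G t z)⁻¹ * dtM G (t, z)

variable {I : Set ℝ} {U : Set (Fin n → ℂ)} {Γ : (Fin n → ℂ) → Matrix (Fin n) (Fin n) ℂ}
  {G : ℝ → (Fin n → ℂ) → Matrix (Fin r) (Fin r) ℂ}
  {Φ : (Fin n → ℂ) → (Fin n → ℂ) → Matrix (Fin r) (Fin r) ℂ} {q : ℝ × (Fin n → ℂ)}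

namespace IsGramFamily

lemma isOpen (hG : IsGramFamily I U G) : IsOpen (I ×ˢ U) :=
  hG.isOpen_time.prod (hG.gram 0).isOpen

lemma det_ne (hG : IsGramFamily I U G) (hq : q ∈ I ×ˢ U) : (G q.1 q.2).det ≠ 0 :=
  (hG.gram q.1).det_ne q.2 hq.2

lemma smooth_inv (hG : IsGramFamily I U G) (hq : q ∈ I ×ˢ U) :
    SmoothMat (fun q : ℝ × (Fin n → ℂ) => (G q.1 q.2)⁻¹) q :=
  (hG.smooth q hq).inv (hG.det_ne hq)

lemma smooth_velocity (hG : IsGramFamily I U G) (hq : q ∈ I ×ˢ U) :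
    SmoothMat (fun q : ℝ × (Fin n → ℂ) => velocity G q.1 q.2) q :=
  (hG.smooth_inv hq).mul (hG.smooth q hq).cdM

lemma smooth_velocity_slice (hG : IsGramFamily I U G) (hq : q ∈ I ×ˢ U) :
    SmoothMat (velocity G q.1) q.2 :=
  SmoothMat.slice (t := q.1) (z := q.2) (hG.smooth_velocity hq)

lemma dtM_gram (hG : IsGramFamily I U G) (hq : q ∈ I ×ˢ U) :
    dtM G q = G q.1 q.2 * velocity G q.1 q.2 := by
  rw [velocity, mul_nonsing_inv_cancel_left _ _ (hG.det_ne hq).isUnit]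

lemma smooth_chernL (hG : IsGramFamily I U G) (hq : q ∈ I ×ˢ U) (u : Fin n → ℂ) :
    SmoothMat (fun q : ℝ × (Fin n → ℂ) => chernL (G q.1) q.2 u) q :=
  (hG.smooth_inv hq).mul (smoothMat_cdM_joint hG.isOpen hG.smooth hq _ _ _)

/-- The variation of the Chern connection. -/
lemma dtM_chernL (hG : IsGramFamily I U G) (hq : q ∈ I ×ˢ U) (u : Fin n → ℂ) :
    dtM (fun t y => chernL (G t) y u) q = covL (G q.1) (velocity G q.1) q.2 u := by
  have hd := (hG.det_ne hq).isUnit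
  have h1 := dtM_cdM hG.isOpen hG.smooth hq (-Complex.I) u (Complex.I • u)
  -- With `∂ₜG = G v` near the point, `∂ₜ(G⁻¹ ∂G) = -v G⁻¹ ∂G + G⁻¹ ∂(G v)`, which is `∂v + [G⁻¹ ∂G,
  -- v]`.
  have h2 : (fun y => dtM G (q.1, y)) =ᶠ[𝓝 q.2] fun y => G q.1 y * velocity G q.1 y :=
    eventually_of_mem ((hG.gram 0).isOpen.mem_nhds hq.2) fun y hy =>
      hG.dtM_gram (q := (q.1, y)) ⟨hq.1, hy⟩
  rw [cdM_congr h2, cdM_mul ((hG.gram q.1).smooth q.2 hq.2) (hG.smooth_velocity_slice hq)] at h1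
  have h3 := hG.dtM_gram hq
  rw [dtM] at h1 h3 ⊢
  simp only [chernL]
  rw [cdM_mul (hG.smooth_inv hq) (smoothMat_cdM_joint hG.isOpen hG.smooth hq _ _ _),
    cdM_inv (hG.smooth q hq) (hG.det_ne hq), h1, h3]
  simp only [covL, chernL, Matrix.mul_add, Matrix.neg_mul, Matrix.mul_assoc,
    nonsing_inv_mul_cancel_left _ _ hd]
  abel

lemma smooth_adj (hG : IsGramFamily I U G) (hq : q ∈ I ×ˢ U)
    {B : (Fin n → ℂ) → Matrix (Fin r) (Fin r) ℂ} (hB : SmoothMat B q.2) :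
    SmoothMat (fun q : ℝ × (Fin n → ℂ) => adj (G q.1 q.2) (B q.2)) q :=
  ((hG.smooth_inv hq).mul hB.snd.conjTranspose).mul (hG.smooth q hq)

/-- The variation of the adjoint. -/
lemma dtM_adj (hG : IsGramFamily I U G) (hq : q ∈ I ×ˢ U)
    {B : (Fin n → ℂ) → Matrix (Fin r) (Fin r) ℂ} (hB : SmoothMat B q.2) :
    dtM (fun t y => adj (G t y) (B y)) q =
      adj (G q.1 q.2) (B q.2) * velocity G q.1 q.2
        - velocity G q.1 q.2 * adj (G q.1 q.2) (B q.2) := by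
  have hd := (hG.det_ne hq).isUnit
  have h3 := hG.dtM_gram hq
  have h4 := dtM_snd (q := q) hB.conjTranspose
  simp only [adj]
  rw [dtM] at h3 h4 ⊢
  rw [cdM_mul ((hG.smooth_inv hq).mul hB.snd.conjTranspose) (hG.smooth q hq),
    cdM_mul (hG.smooth_inv hq) hB.snd.conjTranspose,
    cdM_inv (hG.smooth q hq) (hG.det_ne hq), h3, h4]
  simp only [Matrix.neg_mul, Matrix.mul_assoc, Matrix.add_mul, Matrix.mul_zero, Matrix.zero_mul,
    nonsing_inv_mul_cancel_left _ _ hd]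
  abel

lemma smooth_curvL (hG : IsGramFamily I U G) (hΦ : IsHiggs U Φ) (hq : q ∈ I ×ˢ U)
    (u w : Fin n → ℂ) :
    SmoothMat (fun q : ℝ × (Fin n → ℂ) => curvL (G q.1) Φ q.2 u w) q :=
  (smoothMat_cdM_joint (A := fun t y => chernL (G t) y u) hG.isOpen
    (fun _ h => hG.smooth_chernL h u) hq _ _ _).neg.add
    (((hΦ.smooth q.2 hq.2 u).snd.mul (hG.smooth_adj hq (hΦ.smooth q.2 hq.2 w))).sub
      ((hG.smooth_adj hq (hΦ.smooth q.2 hq.2 w)).mul (hΦ.smooth q.2 hq.2 u).snd))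

/-- The variation of the Hitchin-Simpson curvature. -/
lemma dtM_curvL (hG : IsGramFamily I U G) (hΦ : IsHiggs U Φ) (hq : q ∈ I ×ˢ U)
    (u w : Fin n → ℂ) :
    dtM (fun t y => curvL (G t) Φ y u w) q =
      -dbM (fun y => covL (G q.1) (velocity G q.1) y u) q.2 w
        + (Φ q.2 u * (adj (G q.1 q.2) (Φ q.2 w) * velocity G q.1 q.2
            - velocity G q.1 q.2 * adj (G q.1 q.2) (Φ q.2 w))
          - (adj (G q.1 q.2) (Φ q.2 w) * velocity G q.1 q.2
            - velocity G q.1 q.2 * adj (G q.1 q.2) (Φ q.2 w)) * Φ q.2 u) := by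
  have hc : ∀ q ∈ I ×ˢ U, SmoothMat (fun q : ℝ × (Fin n → ℂ) => chernL (G q.1) q.2 u) q :=
    fun _ h => hG.smooth_chernL h u
  have h1 := dtM_cdM (A := fun t y => chernL (G t) y u) hG.isOpen hc hq Complex.I w (Complex.I • w)
  have h2 : (fun y => dtM (fun t y => chernL (G t) y u) (q.1, y)) =ᶠ[𝓝 q.2]
      fun y => covL (G q.1) (velocity G q.1) y u :=
    eventually_of_mem ((hG.gram 0).isOpen.mem_nhds hq.2) fun y hy =>
      hG.dtM_chernL (q := (q.1, y)) ⟨hq.1, hy⟩ u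
  rw [cdM_congr h2] at h1
  have h3 := hG.dtM_adj hq (hΦ.smooth q.2 hq.2 w)
  have h4 := dtM_snd (hΦ.smooth q.2 hq.2 u)
  have s1 := smoothMat_cdM_joint (A := fun t y => chernL (G t) y u) hG.isOpen hc hq
    Complex.I w (Complex.I • w)
  have s2 := (hΦ.smooth q.2 hq.2 u).snd
  have s3 := hG.smooth_adj hq (hΦ.smooth q.2 hq.2 w)
  simp only [curvL]
  rw [dtM] at h1 h3 h4 ⊢
  rw [cdM_add s1.neg ((s2.mul s3).sub (s3.mul s2)), cdM_neg, cdM_sub (s2.mul s3) (s3.mul s2),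
    cdM_mul s2 s3, cdM_mul s3 s2, h1, h3, h4]
  simp only [Matrix.zero_mul, Matrix.mul_zero, zero_add, add_zero]

lemma smooth_meanL (hG : IsGramFamily I U G) (hΓ : IsGram U Γ) (hΦ : IsHiggs U Φ)
    (hq : q ∈ I ×ˢ U) :
    SmoothMat (fun q : ℝ × (Fin n → ℂ) => meanL Γ (G q.1) Φ q.2) q :=
  SmoothMat.sum fun a _ => SmoothMat.sum fun b _ =>
    SmoothMat.smul (contDiffAt_snd (hΓ.smooth_inv hq.2 a b)) (hG.smooth_curvL hΦ hq _ _)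

/-- The variation of the mean curvature. -/
lemma dtM_meanL (hG : IsGramFamily I U G) (hΓ : IsGram U Γ) (hΦ : IsHiggs U Φ)
    (hq : q ∈ I ×ˢ U) :
    dtM (fun t y => meanL Γ (G t) Φ y) q = ∑ a, ∑ b, (Γ q.2)⁻¹ a b •
      (-dbM (fun y => covL (G q.1) (velocity G q.1) y (Pi.single a 1)) q.2 (Pi.single b 1)
        + (Φ q.2 (Pi.single a 1) * (adj (G q.1 q.2) (Φ q.2 (Pi.single b 1)) * velocity G q.1 q.2
            - velocity G q.1 q.2 * adj (G q.1 q.2) (Φ q.2 (Pi.single b 1)))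
          - (adj (G q.1 q.2) (Φ q.2 (Pi.single b 1)) * velocity G q.1 q.2
            - velocity G q.1 q.2 * adj (G q.1 q.2) (Φ q.2 (Pi.single b 1)))
              * Φ q.2 (Pi.single a 1))) := by
  have hs (a b : Fin n) := SmoothMat.smul (contDiffAt_snd (q := q) (hΓ.smooth_inv hq.2 a b))
    (hG.smooth_curvL hΦ hq (Pi.single a 1) (Pi.single b 1))
  simp only [meanL]
  rw [dtM, cdM_sum fun a _ => SmoothMat.sum fun b _ => hs a b]
  refine Finset.sum_congr rfl fun a _ => ?_
  rw [cdM_sum fun b _ => hs a b]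
  refine Finset.sum_congr rfl fun b _ => ?_
  rw [cdM_smul (contDiffAt_snd (hΓ.smooth_inv hq.2 a b)) (hG.smooth_curvL hΦ hq _ _),
    cd_time_snd (hΓ.smooth_inv hq.2 a b), zero_smul, zero_add, ← hG.dtM_curvL hΦ hq]

lemma smooth_normSq (hG : IsGramFamily I U G) (hΓ : IsGram U Γ) (hΦ : IsHiggs U Φ)
    (hq : q ∈ I ×ˢ U) : ContDiffAt ℝ ∞
      (fun q : ℝ × (Fin n → ℂ) => (meanL Γ (G q.1) Φ q.2 * meanL Γ (G q.1) Φ q.2).trace) q :=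
  ((hG.smooth_meanL hΓ hΦ hq).mul (hG.smooth_meanL hΓ hΦ hq)).trace

lemma cd_normSq (hG : IsGramFamily I U G) (hΓ : IsGram U Γ) (hΦ : IsHiggs U Φ)
    (hq : q ∈ I ×ˢ U) : cd 1 (1, 0) (1, 0)
      (fun q : ℝ × (Fin n → ℂ) => (meanL Γ (G q.1) Φ q.2 * meanL Γ (G q.1) Φ q.2).trace) q =
      2 * (meanL Γ (G q.1) Φ q.2 * dtM (fun t y => meanL Γ (G t) Φ y) q).trace := by
  have hs := hG.smooth_meanL hΓ hΦ hq
  rw [cd_trace (hs.mul hs), cdM_mul hs hs, trace_add, trace_mul_comm (cdM _ _ _ _ _), two_mul]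

end IsGramFamily

end Variation

/-! ### The mean curvature in an arbitrary frame -/

section LocalFormulas

variable {n r : ℕ} {X : Type*} [TopologicalSpace X] [ChartedSpace (Fin n → ℂ) X]
  [IsManifold 𝓘(ℂ, Fin n → ℂ) ω X]
  {V : X → Type*} [TopologicalSpace (TotalSpace (Fin r → ℂ) V)]
  [∀ x, AddCommGroup (V x)] [∀ x, Module ℂ (V x)] [∀ x, TopologicalSpace (V x)]
  [FiberBundle (Fin r → ℂ) V] [VectorBundle ℂ (Fin r → ℂ) V]

/-- The matrix of a section `M` of `End V` at the point `y`, in the frame around `p`. -/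
def endAt (M : ∀ x, Module.End ℂ (V x)) (p y : X) : Matrix (Fin r) (Fin r) ℂ :=
  endToMatrix r V p y (M y)

/-- The matrix of `ψ(u)` at the point `y`, in the frame around `p`. -/
def formAt (ψ : ∀ x, TX n x → Module.End ℂ (V x)) (p y : X) (u : Fin n → ℂ) :
    Matrix (Fin r) (Fin r) ℂ :=
  endToMatrix r V p y (ψ y (vec n (TX n) p y u))

/-- The mean curvature in the frame around `p`, as a function of the coordinates. -/
def meanAt (g : HermitianMetric n n (TX n (X := X))) (φ : HiggsField n r V)
    (h : HermitianMetric n r V) (p : X) (z : Fin n → ℂ) : Matrix (Fin r) (Fin r) ℂ :=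
  meanL (g.gram p) (h.gram p) (φ.mat p) z

variable (g : HermitianMetric n n (TX n (X := X))) (φ : HiggsField n r V)
  (h : HermitianMetric n r V) {p q : X} {z : Fin n → ℂ}

lemma endToMatrix_add (p y : X) (M N : Module.End ℂ (V y)) :
    endToMatrix r V p y (M + N) = endToMatrix r V p y M + endToMatrix r V p y N := by
  simp only [endToMatrix, LinearMap.add_comp, LinearMap.comp_add, map_add]

lemma endToMatrix_smul (p y : X) (k : ℂ) (M : Module.End ℂ (V y)) :
    endToMatrix r V p y (k • M) = k • endToMatrix r V p y M := by
  simp only [endToMatrix, LinearMap.smul_comp, LinearMap.comp_smul, map_smul]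

lemma isHiggs_mat (p : X) : IsHiggs (coordDomain n r V p) (φ.mat p) where
  smooth _ hz u i j :=
    contDiffAt_of_differentiableOn (isOpen_coordDomain n r V p) (φ.holomorphic p u i j) hz
  smul z k u := by
    simp only [HiggsField.mat, formMatrix, map_smul, endToMatrix_smul]
  add z u w := by
    simp only [HiggsField.mat, formMatrix, map_add, endToMatrix_add]
  holomorphic _ hz u _ := dbM_of_differentiableAt (fun i j =>
    (φ.holomorphic p u i j).differentiableAt ((isOpen_coordDomain n r V p).mem_nhds hz)) _

lemma isGram_kahler (p : X) : IsGram (coordDomain n r V p) (g.gram p) :=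
  (isGram_gram g p).mono (isOpen_coordDomain n r V p) fun _ hz => mem_coordDomain_TX.2 hz.1

lemma chernForm_eq (p : X) (z u : Fin n → ℂ) : chernForm h p z u = chernL (h.gram p) z u := by
  rw [chernForm, delMat_eq, chernL]

lemma component11_hsCurvature (hz : z ∈ coordDomain n r V p) (a b : Fin n) :
    component11 (hsCurvature φ h p z) a b =
      curvL (h.gram p) (φ.mat p) z (Pi.single a 1) (Pi.single b 1) := by
  rw [← component11_hs (isGram_gram h p) (isHiggs_mat φ p) hz a b]
  congr 1
  funext u w
  simp only [hsCurvature, hsForm, chernForm_eq, HiggsField.adjMat]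

lemma meanCurvature_eq (p : X) :
    meanCurvature g φ h p = endOfMatrix r V p p (meanAt g φ h p (center n p)) := by
  simp only [meanCurvature, meanAt, meanL, gInv,
    component11_hsCurvature φ h (center_mem n r V p)]

lemma smooth_meanAt (hz : z ∈ coordDomain n r V p) : SmoothMat (meanAt g φ h p) z :=
  (isGram_kahler g p).smooth_meanL (isGram_gram h p) (isHiggs_mat φ p) hz

lemma adj_meanAt (hz : z ∈ coordDomain n r V p) :
    adj (h.gram p z) (meanAt g φ h p z) = meanAt g φ h p z :=
  (isGram_kahler g p).adj_meanL (isGram_gram h p) hz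

lemma gram_coordChange (hz : z ∈ overlap n r V p q) :
    h.gram p z = (frameChange r V p q (pt p z))ᴴ * h.gram q (coordChange n p q z) *
      frameChange r V p q (pt p z) := by
  rw [h.gram_eq, h.gram_eq, pt_coordChange hz]
  exact gramAt_change h.form hz.2.2

lemma kahler_coordChange (hz : z ∈ overlap n r V p q) :
    g.gram p z = (jac (coordChange n p q) z)ᴴ * g.gram q (coordChange n p q z) *
      jac (coordChange n p q) z := by
  rw [jac_coordChange hz.1.1 hz.2.1, g.gram_eq, g.gram_eq, pt_coordChange hz]
  exact gramAt_change (r := n) g.form hz.2.1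

lemma det_jac_coordChange_ne (hz : z ∈ overlap n r V p q) :
    (jac (coordChange n p q) z).det ≠ 0 := by
  rw [jac_coordChange hz.1.1 hz.2.1]
  exact frameChange_det (r := n) (V := TX n) ((chartAt (Fin n → ℂ) p).map_target hz.1.1) hz.2.1

lemma formAt_coordChange (ψ : ∀ x, TX n x → Module.End ℂ (V x)) (hz : z ∈ overlap n r V p q)
    (u : Fin n → ℂ) : formAt ψ p (pt p z) u = (frameChange r V p q (pt p z))⁻¹ *
      formAt ψ q (pt p z) (fderiv ℂ (coordChange n p q) z u) * frameChange r V p q (pt p z) := by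
  have h1 : pt p z ∈ frameSet n (TX n) q := hz.2.1
  rw [formAt, endToMatrix_change hz.1.2 hz.2.2, formAt, ← comps_vec_TX hz.1.1 hz.2.1, vec_comps h1]

lemma mat_coordChange (hz : z ∈ overlap n r V p q) (u : Fin n → ℂ) :
    φ.mat p z u = (frameChange r V p q (pt p z))⁻¹ *
      φ.mat q (coordChange n p q z) (fderiv ℂ (coordChange n p q) z u) *
        frameChange r V p q (pt p z) := by
  have h1 (p : X) (z u : Fin n → ℂ) :
      φ.mat p z u = formAt (fun x => φ.form x) p (pt p z) u := rfl
  rw [h1, h1, pt_coordChange hz]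
  exact formAt_coordChange _ hz u

lemma endAt_coordChange (M : ∀ x, Module.End ℂ (V x)) (hz : z ∈ overlap n r V p q) :
    endAt M p (pt p z) = (frameChange r V p q (pt p z))⁻¹ *
      endAt M q (pt q (coordChange n p q z)) * frameChange r V p q (pt p z) := by
  rw [pt_coordChange hz]
  exact endToMatrix_change hz.1.2 hz.2.2 _

variable [ContMDiffVectorBundle ω (Fin r → ℂ) V 𝓘(ℂ, Fin n → ℂ)]

lemma meanAt_coordChange (hz : z ∈ overlap n r V p q) :
    meanAt g φ h p z = (frameChange r V p q (pt p z))⁻¹ *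
      meanAt g φ h q (coordChange n p q z) * frameChange r V p q (pt p z) :=
  (isTransition V p q).meanL_eq hz (isGram_gram h q) (isHiggs_mat φ q)
    (fun _ hy => coordChange_mem hy) (fun _ hy => gram_coordChange h hy)
    (kahler_coordChange g hz) (det_jac_coordChange_ne hz) (fun u => mat_coordChange φ hz u)

/-- Allows comparing the chart at `p` with the chart centred at the point itself, in which the
global objects are defined. -/
lemma mem_overlap_self (hz : z ∈ coordDomain n r V p) : z ∈ overlap n r V p (pt p z) :=
  ⟨hz, mem_chartDomain_self n r V _⟩

/-- The matrix of the mean curvature in any frame. -/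
lemma endAt_meanCurvature (hz : z ∈ coordDomain n r V p) :
    endAt (meanCurvature g φ h) p (pt p z) = meanAt g φ h p z := by
  have h1 := mem_overlap_self hz
  rw [meanAt_coordChange g φ h h1, endAt, endToMatrix_change hz.2 h1.2.2, meanCurvature_eq,
    endToMatrix_endOfMatrix h1.2.2]
  rfl

lemma endNormSq_meanCurvature_self (p : X) : endNormSq h (meanCurvature g φ h) p =
    (meanAt g φ h p (center n p) * meanAt g φ h p (center n p)).trace.re := by
  have h1 := endAt_meanCurvature g φ h (center_mem n r V p)
  rw [pt_center] at h1
  have h2 : endToMatrix r V p p (meanCurvature g φ h p) = meanAt g φ h p (center n p) := h1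
  simp only [endNormSq, h2]
  rw [adj_meanAt g φ h (center_mem n r V p)]

lemma trace_inv_conj {S A : Matrix (Fin r) (Fin r) ℂ} (hS : S.det ≠ 0) :
    (S⁻¹ * A * S).trace = A.trace := by
  rw [trace_mul_comm, ← Matrix.mul_assoc, mul_nonsing_inv _ hS.isUnit, Matrix.one_mul]

lemma trace_meanAt_coordChange (hz : z ∈ overlap n r V p q) :
    (meanAt g φ h p z * meanAt g φ h p z).trace =
      (meanAt g φ h q (coordChange n p q z) * meanAt g φ h q (coordChange n p q z)).trace := by
  have hd := frameChange_det hz.1.2 hz.2.2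
  rw [meanAt_coordChange g φ h hz, inv_conj_mul_inv_conj hd, trace_inv_conj hd]

/-- `K²` is self-adjoint, so its trace is real, and taking the real part in `endNormSq` loses
nothing. -/
lemma star_trace_mul_self {G K : Matrix (Fin r) (Fin r) ℂ} (hd : G.det ≠ 0)
    (hK : adj G K = K) : star (K * K).trace = (K * K).trace := by
  have h1 : adj G (K * K) = K * K := by rw [adj_mul hd, hK]
  conv_rhs => rw [← h1, adj, trace_inv_conj hd, trace_conjTranspose]

/-- The pointwise norm squared of the mean curvature, in any frame. -/
lemma endNormSq_meanCurvature (hz : z ∈ coordDomain n r V p) :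
    ((endNormSq h (meanCurvature g φ h) (pt p z) : ℝ) : ℂ) =
      (meanAt g φ h p z * meanAt g φ h p z).trace := by
  rw [endNormSq_meanCurvature_self, trace_meanAt_coordChange g φ h (mem_overlap_self hz)]
  have h1 := star_trace_mul_self (((isGram_gram h (pt p z)).det_ne _ (center_mem n r V _)))
    (adj_meanAt g φ h (center_mem n r V (pt p z)))
  exact Complex.conj_eq_iff_re.1 h1

end LocalFormulas

/-! ### The divergence of `tr(K_h D'_h M)` as a global function -/

section Divergence

variable {n r : ℕ} {X : Type*} [TopologicalSpace X] [ChartedSpace (Fin n → ℂ) X]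
  [IsManifold 𝓘(ℂ, Fin n → ℂ) ω X]
  {V : X → Type*} [TopologicalSpace (TotalSpace (Fin r → ℂ) V)]
  [∀ x, AddCommGroup (V x)] [∀ x, Module ℂ (V x)] [∀ x, TopologicalSpace (V x)]
  [FiberBundle (Fin r → ℂ) V] [VectorBundle ℂ (Fin r → ℂ) V]

/-- A section of `End V` is smooth if its matrices in the preferred frames are smooth. -/
def IsSmoothEnd (n r : ℕ) {X : Type*} [TopologicalSpace X] [ChartedSpace (Fin n → ℂ) X]
    {V : X → Type*} [TopologicalSpace (TotalSpace (Fin r → ℂ) V)]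
    [∀ x, AddCommGroup (V x)] [∀ x, Module ℂ (V x)] [∀ x, TopologicalSpace (V x)]
    [FiberBundle (Fin r → ℂ) V] [VectorBundle ℂ (Fin r → ℂ) V]
    (M : ∀ x, Module.End ℂ (V x)) : Prop :=
  ∀ p : X, ∀ z ∈ coordDomain n r V p, SmoothMat (fun y : Fin n → ℂ => endAt (r := r) M p (pt p y)) z

variable (g : HermitianMetric n n (TX n (X := X))) (φ : HiggsField n r V)
  (h : HermitianMetric n r V) {M N : ∀ x, Module.End ℂ (V x)} {p q : X} {z : Fin n → ℂ}

/-- The `(1,0)`-form `tr(K_h D'_h M)` in the frame around `p`. -/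
def traceForm (M : ∀ x, Module.End ℂ (V x)) (p : X) (z u : Fin n → ℂ) : ℂ :=
  (meanAt g φ h p z * covL (h.gram p) (fun y => endAt M p (pt p y)) z u).trace

/-- The trace of `∂̄ tr(K_h D'_h M)` with respect to `g`. -/
def divTrace (M : ∀ x, Module.End ℂ (V x)) (p : X) : ℂ :=
  divL (g.gram p) (traceForm g φ h M p) (center n p)

lemma contDiffAt_traceForm (hM : IsSmoothEnd n r M) (hz : z ∈ coordDomain n r V p)
    (u : Fin n → ℂ) : ContDiffAt ℝ ∞ (fun y => traceForm g φ h M p y u) z :=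
  ((smooth_meanAt g φ h hz).mul ((isGram_gram h p).smooth_covL hz (hM p z hz) u)).trace

lemma covL_eq_sum (G m : (Fin n → ℂ) → Matrix (Fin r) (Fin r) ℂ) (z u : Fin n → ℂ) :
    covL G m z u = ∑ c, u c • covL G m z (Pi.single c 1) := by
  simp only [covL]
  rw [dlM_eq_sum, chernL_eq_sum, Finset.sum_mul, Finset.mul_sum, ← Finset.sum_sub_distrib,
    ← Finset.sum_add_distrib]
  simp only [smul_add, smul_sub, Matrix.smul_mul, Matrix.mul_smul]

lemma covL_congr {G m m' : (Fin n → ℂ) → Matrix (Fin r) (Fin r) ℂ} (hm : m =ᶠ[𝓝 z] m')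
    (u : Fin n → ℂ) : covL G m z u = covL G m' z u := by
  rw [covL, covL, dlM, cdM_congr hm, hm.eq_of_nhds]

lemma traceForm_eq_sum (M : ∀ x, Module.End ℂ (V x)) (p : X) (z u : Fin n → ℂ) :
    traceForm g φ h M p z u = ∑ c, u c * traceForm g φ h M p z (Pi.single c 1) := by
  simp only [traceForm]
  rw [covL_eq_sum, Finset.mul_sum, trace_sum]
  simp only [Matrix.mul_smul, trace_smul, smul_eq_mul]

lemma traceForm_add (hM : IsSmoothEnd n r M) (hN : IsSmoothEnd n r N) (hz : z ∈ coordDomain n r V p)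
    (u : Fin n → ℂ) : traceForm g φ h (fun x => M x + N x) p z u =
      traceForm g φ h M p z u + traceForm g φ h N p z u := by
  have h1 (y : Fin n → ℂ) : endAt (r := r) (fun x => M x + N x) p (pt p y) =
      endAt M p (pt p y) + endAt N p (pt p y) := endToMatrix_add _ _ _ _
  simp only [traceForm, covL, h1]
  rw [dlM, cdM_add (hM p z hz) (hN p z hz), ← trace_add, ← Matrix.mul_add]
  congr 2
  simp only [Matrix.mul_add, Matrix.add_mul]
  abel

/-- Additivity in `M` with `K_h` fixed lets a partition of unity act on `M` instead of on the form.
-/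
lemma divTrace_add (hM : IsSmoothEnd n r M) (hN : IsSmoothEnd n r N) (p : X) :
    divTrace g φ h (fun x => M x + N x) p = divTrace g φ h M p + divTrace g φ h N p := by
  have hp := center_mem n r V p
  simp only [divTrace, divL, ← Finset.sum_add_distrib, ← mul_add]
  refine Finset.sum_congr rfl fun a _ => Finset.sum_congr rfl fun b _ => ?_
  congr 1
  rw [db, db, ← cd_add (contDiffAt_traceForm g φ h hM hp _) (contDiffAt_traceForm g φ h hN hp _)]
  exact cd_congr (eventually_of_mem ((isOpen_coordDomain n r V p).mem_nhds hp) fun y hy =>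
    traceForm_add g φ h hM hN hy _)

variable [ContMDiffVectorBundle ω (Fin r → ℂ) V 𝓘(ℂ, Fin n → ℂ)]

lemma traceForm_coordChange (hM : IsSmoothEnd n r M) (hz : z ∈ overlap n r V p q)
    (u : Fin n → ℂ) : traceForm g φ h M p z u =
      traceForm g φ h M q (coordChange n p q z) (fderiv ℂ (coordChange n p q) z u) := by
  have hd := frameChange_det hz.1.2 hz.2.2
  rw [traceForm, meanAt_coordChange g φ h hz, (isTransition V p q).covL_eq hz (isGram_gram h q)
    (coordChange_mem hz) (fun _ hy => gram_coordChange h hy) (hM q _ (coordChange_mem hz))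
    (fun _ hy => endAt_coordChange M hy), inv_conj_mul_inv_conj hd, trace_inv_conj hd, traceForm]

/-- The divergence in any frame. -/
lemma divTrace_eq (hM : IsSmoothEnd n r M) (hz : z ∈ coordDomain n r V p) :
    divTrace g φ h M (pt p z) = divL (g.gram p) (traceForm g φ h M p) z := by
  have hz' := mem_overlap_self hz
  exact ((isTransition V p (pt p z)).divL_eq hz' (kahler_coordChange g hz')
    (det_jac_coordChange_ne hz')
    (fun u => contDiffAt_traceForm g φ h hM (coordChange_mem hz') u)
    (fun y u => traceForm_eq_sum g φ h M _ y u)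
    (fun y hy u => traceForm_coordChange g φ h hM hy u)).symm

end Divergence

/-! ### The divergence theorem on a compact Kähler manifold -/

section Stokes

variable {n r : ℕ} {X : Type*} [TopologicalSpace X] [ChartedSpace (Fin n → ℂ) X]
  [IsManifold 𝓘(ℂ, Fin n → ℂ) ω X]
  {V : X → Type*} [TopologicalSpace (TotalSpace (Fin r → ℂ) V)]
  [∀ x, AddCommGroup (V x)] [∀ x, Module ℂ (V x)] [∀ x, TopologicalSpace (V x)]
  [FiberBundle (Fin r → ℂ) V] [VectorBundle ℂ (Fin r → ℂ) V]

/-- A complex manifold is a smooth real manifold. -/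
lemma isManifold_real : IsManifold 𝓘(ℝ, Fin n → ℂ) ∞ X := by
  refine isManifold_of_contDiffOn _ _ _ fun e e' he he' => ?_
  have h := ((contDiffGroupoid ω 𝓘(ℂ, Fin n → ℂ)).compatible he he')
  rw [contDiffGroupoid, mem_groupoid_of_pregroupoid] at h
  exact ((show ContDiffOn ℂ ω _ _ from h.1).restrict_scalars ℝ).of_le le_top

lemma contDiffAt_pt {f : X → ℝ} (hf : ContMDiff 𝓘(ℝ, Fin n → ℂ) 𝓘(ℝ, ℝ) ∞ f) {p : X}
    {z : Fin n → ℂ} (hz : z ∈ (chartAt (Fin n → ℂ) p).target) :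
    ContDiffAt ℝ ∞ (fun y : Fin n → ℂ => ((f (pt p y) : ℝ) : ℂ)) z := by
  have := isManifold_real (n := n) (X := X)
  have h1 : ContMDiffOn 𝓘(ℝ, Fin n → ℂ) 𝓘(ℝ, Fin n → ℂ) ∞ (pt (n := n) p)
      (chartAt (Fin n → ℂ) p).target := contMDiffOn_chart_symm
  have h2 := (hf.comp_contMDiffOn h1).contDiffOn.contDiffAt
    ((chartAt (Fin n → ℂ) p).open_target.mem_nhds hz)
  exact Complex.ofRealCLM.contDiff.contDiffAt.comp z h2

variable (g : HermitianMetric n n (TX n (X := X))) (φ : HiggsField n r V)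
  (h : HermitianMetric n r V) {M : ∀ x, Module.End ℂ (V x)} {p : X} {z : Fin n → ℂ}

lemma IsSmoothEnd.smul (hM : IsSmoothEnd n r M) {f : X → ℝ}
    (hf : ContMDiff 𝓘(ℝ, Fin n → ℂ) 𝓘(ℝ, ℝ) ∞ f) :
    IsSmoothEnd n r (fun x => (f x : ℂ) • M x) := by
  intro p z hz
  have h1 (y : Fin n → ℂ) : endAt (r := r) (fun x => (f x : ℂ) • M x) p (pt p y) =
      (f (pt p y) : ℂ) • endAt M p (pt p y) := endToMatrix_smul _ _ _ _
  simp only [h1]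
  exact SmoothMat.smul (contDiffAt_pt hf hz.1) (hM p z hz)

lemma IsSmoothEnd.add {N : ∀ x, Module.End ℂ (V x)} (hM : IsSmoothEnd n r M)
    (hN : IsSmoothEnd n r N) : IsSmoothEnd n r (fun x => M x + N x) := by
  intro p z hz
  have h1 (y : Fin n → ℂ) : endAt (r := r) (fun x => M x + N x) p (pt p y) =
      endAt M p (pt p y) + endAt N p (pt p y) := endToMatrix_add _ _ _ _
  simp only [h1]
  exact (hM p z hz).add (hN p z hz)

lemma endAt_zero (p y : X) : endAt (r := r) (fun x => (0 : Module.End ℂ (V x))) p y = 0 := by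
  simp [endAt, endToMatrix]

variable (n r V) in
lemma isSmoothEnd_zero : IsSmoothEnd n r (fun x => (0 : Module.End ℂ (V x))) := by
  intro p z hz
  simp only [endAt_zero]
  exact SmoothMat.const 0

lemma continuousAt_chart {f : (Fin n → ℂ) → ℂ} (hf : ContinuousAt f (center n p)) :
    ContinuousAt (fun x => f (chartAt (Fin n → ℂ) p x)) p :=
  ContinuousAt.comp hf ((chartAt (Fin n → ℂ) p).continuousAt (mem_chart_source _ p))

variable (r V) in
/-- Continuity can be checked in coordinates. -/
lemma continuous_of_local {F : X → ℂ} (f : X → (Fin n → ℂ) → ℂ)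
    (hf : ∀ p, ContinuousAt (f p) (center n p))
    (hF : ∀ p, ∀ z ∈ coordDomain n r V p, F (pt p z) = f p z) : Continuous F := by
  refine continuous_iff_continuousAt.2 fun p => (continuousAt_chart (hf p)).congr ?_
  filter_upwards [(isOpen_chartDomain n r V p).mem_nhds (mem_chartDomain_self n r V p)] with x hx
  rw [← hF p _ (chart_mem_coordDomain hx), pt_chart n hx.1]

lemma contDiffAt_divL (hM : IsSmoothEnd n r M) (hz : z ∈ coordDomain n r V p) :
    ContDiffAt ℝ ∞ (divL (g.gram p) (traceForm g φ h M p)) z :=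
  ContDiffAt.sum fun a _ => ContDiffAt.sum fun b _ =>
    ((isGram_kahler (r := r) (V := V) g p).smooth_inv hz a b).mul
      (contDiffAt_cd (contDiffAt_traceForm g φ h hM hz _))

lemma IsKahler.symm (hg : IsKahler g) (hz : z ∈ coordDomain n r V p) (a b c : Fin n) :
    dlM (g.gram p) z (Pi.single a 1) b c = dlM (g.gram p) z (Pi.single c 1) b a := by
  refine (isGram_kahler (r := r) (V := V) g p).kahler_symm hz (fun u v w => ?_) a b c
  have h1 (u w : Fin n → ℂ) : (fun y => kahlerForm g p y u w) =
      fun y => -2 * (hermVal (g.gram p y) u w).im := by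
    funext y
    rw [kahlerForm, form_vec]
    rfl
  have h2 := hg p z hz.1 u v w
  rwa [h1, h1, h1] at h2

lemma continuousAt_pt (hz : z ∈ (chartAt (Fin n → ℂ) p).target) : ContinuousAt (pt p) z :=
  (chartAt (Fin n → ℂ) p).continuousAt_symm hz

lemma traceForm_eventually_zero {T : Set X} (hT : IsClosed T) (h0 : ∀ x ∉ T, M x = 0)
    (hz : z ∈ (chartAt (Fin n → ℂ) p).target) (hp : pt p z ∉ T) :
    ∀ᶠ y in 𝓝 z, ∀ u, traceForm g φ h M p y u = 0 := by
  have h1 : ∀ᶠ y in 𝓝 z, endAt (r := r) M p (pt p y) = 0 := by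
    filter_upwards [continuousAt_pt hz (hT.isOpen_compl.mem_nhds hp)] with y hy
    rw [endAt, h0 _ hy]
    exact endAt_zero (V := V) p (pt p y)
  filter_upwards [h1.eventually_nhds] with y hy u
  rw [traceForm, covL_congr (m' := fun _ => 0) hy, covL, dlM, cdM_const]
  simp

lemma divTrace_eq_zero {T : Set X} (hT : IsClosed T) (h0 : ∀ x ∉ T, M x = 0) (hp : p ∉ T) :
    divTrace g φ h M p = 0 := by
  have h1 := traceForm_eventually_zero g φ h hT h0 (mem_chart_target (Fin n → ℂ) p)
    (p := p) (z := center n p) (by rwa [pt_center])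
  simp only [divTrace, divL]
  refine Finset.sum_eq_zero fun a _ => Finset.sum_eq_zero fun b _ => ?_
  rw [db, cd_congr (h1.mono fun y hy => hy _), cd_const, mul_zero]

variable [ContMDiffVectorBundle ω (Fin r → ℂ) V 𝓘(ℂ, Fin n → ℂ)]

lemma continuous_divTrace (hM : IsSmoothEnd n r M) : Continuous (divTrace g φ h M) :=
  continuous_of_local r V (fun p => divL (g.gram p) (traceForm g φ h M p))
    (fun p => (contDiffAt_divL g φ h hM (center_mem n r V p)).continuousAt)
    fun _ _ hz => divTrace_eq g φ h hM hz

variable [CompactSpace X] [MeasurableSpace X] [BorelSpace X]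

/-- The divergence theorem for forms with support in a coordinate domain. -/
lemma integral_divTrace_of_support [T2Space X] (hg : IsKahler g) (hM : IsSmoothEnd n r M)
    {T : Set X} (hT : IsCompact T) (hTp : T ⊆ chartDomain n r V p) (h0 : ∀ x ∉ T, M x = 0) :
    ∫ x, divTrace g φ h M x ∂(kahlerVolume g) = 0 := by
  have hc := (continuous_divTrace g φ h hM).aestronglyMeasurable (μ := kahlerVolume g)
  rw [integral_kahlerVolume g (r := r) (V := V) (p := p) hc fun x hx =>
    divTrace_eq_zero g φ h hT.isClosed h0 fun hx' => hx (hTp hx')]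
  set U := coordDomain n r V p with hU
  have hUo : IsOpen U := isOpen_coordDomain n r V p
  set C := chartAt (Fin n → ℂ) p '' T with hC
  have hCc : IsCompact C := hT.image_of_continuousOn
    ((chartAt (Fin n → ℂ) p).continuousOn.mono fun x hx => (hTp hx).1)
  have hCU : C ⊆ U := by
    rintro _ ⟨x, hx, rfl⟩
    exact chart_mem_coordDomain (hTp hx)
  -- Outside `U` the coordinate expression of the form has no geometric meaning; the indicator makes
  -- it vanish there, as the local theorem requires.
  set η : (Fin n → ℂ) → (Fin n → ℂ) → ℂ := fun z u =>
    U.indicator (fun z => traceForm g φ h M p z u) z with hη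
  have hηev (z) (hz : z ∈ U) (u : Fin n → ℂ) :
      (fun y => η y u) =ᶠ[𝓝 z] fun y => traceForm g φ h M p y u :=
    eventually_of_mem (hUo.mem_nhds hz) fun y hy => Set.indicator_of_mem hy _
  have hmain : ∫ z in U, divL (g.gram p) η z * (g.gram p z).det = 0 := by
    refine (isGram_kahler (r := r) (V := V) g p).setIntegral_divL_mul_det
      (fun z hz a b c => hg.symm g hz a b c) (fun z hz a => ?_) hCc hCU fun z hz a => ?_
    · exact (contDiffAt_traceForm g φ h hM hz _).congr_of_eventuallyEq (hηev z hz _)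
    · by_cases hzU : z ∈ U
      · have h1 : pt p z ∉ T := fun h1 =>
          hz ⟨pt p z, h1, (chartAt (Fin n → ℂ) p).right_inv hzU.1⟩
        rw [(hηev z hzU _).eq_of_nhds]
        exact (traceForm_eventually_zero g φ h hT.isClosed h0 hzU.1 h1).self_of_nhds _
      · exact Set.indicator_of_notMem hzU _
  rw [setIntegral_congr_fun hUo.measurableSet fun z hz => ?_, hmain, mul_zero]
  rw [divTrace_eq g φ h hM hz]
  congr 1
  refine Finset.sum_congr rfl fun a _ => Finset.sum_congr rfl fun b _ => ?_
  rw [db, db, cd_congr (hηev z hz _)]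

/-- The divergence theorem on a compact Kähler manifold. -/
lemma integral_divTrace [T2Space X] (hg : IsKahler g) (hM : IsSmoothEnd n r M) :
    ∫ x, divTrace g φ h M x ∂(kahlerVolume g) = 0 := by
  classical
  have hX := isManifold_real (n := n) (X := X)
  obtain ⟨t, ht⟩ := isCompact_univ.elim_finite_subcover (chartDomain n r V)
    (isOpen_chartDomain n r V) fun x _ => Set.mem_iUnion.2 ⟨x, mem_chartDomain_self n r V x⟩
  obtain ⟨ρ, hρ⟩ := SmoothPartitionOfUnity.exists_isSubordinate 𝓘(ℝ, Fin n → ℂ)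
    (s := Set.univ (α := X)) isClosed_univ (fun i : t => chartDomain n r V (i : X))
    (fun i => isOpen_chartDomain n r V _) (by simpa [Set.iUnion_subtype] using ht)
  have hs (i : t) : IsSmoothEnd n r fun x => (ρ i x : ℂ) • M x := hM.smul (ρ i).contMDiff
  -- Smoothness is carried along in the induction since `divTrace_add` needs it for the partial
  -- sums.
  have hsum (s : Finset t) : IsSmoothEnd n r (fun x => ∑ i ∈ s, (ρ i x : ℂ) • M x) ∧
      ∫ x, divTrace g φ h (fun x => ∑ i ∈ s, (ρ i x : ℂ) • M x) x ∂(kahlerVolume g) = 0 := by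
    induction s using Finset.induction_on with
    | empty =>
      -- Additivity at `0 + 0 = 0` shows that the divergence of zero is zero.
      have h1 (p : X) := divTrace_add g φ h (isSmoothEnd_zero n r V) (isSmoothEnd_zero n r V) p
      simp only [add_zero, left_eq_add] at h1
      simp only [Finset.sum_empty, h1, integral_zero, and_true]
      exact isSmoothEnd_zero n r V
    | insert i s hi ih =>
      simp only [Finset.sum_insert hi]
      refine ⟨(hs i).add ih.1, ?_⟩
      simp only [divTrace_add g φ h (hs i) ih.1]
      rw [integral_add ((continuous_divTrace g φ h (hs i)).integrable_of_hasCompactSupport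
          (HasCompactSupport.of_compactSpace _))
        ((continuous_divTrace g φ h ih.1).integrable_of_hasCompactSupport
          (HasCompactSupport.of_compactSpace _)), ih.2, add_zero]
      refine integral_divTrace_of_support g φ h hg (hs i) (isClosed_tsupport (ρ i)).isCompact
        (hρ i) fun x hx => ?_
      rw [image_eq_zero_of_notMem_tsupport hx, Complex.ofReal_zero, zero_smul]
  have h1 (x : X) : ∑ i, (ρ i x : ℂ) • M x = M x := by
    have h2 := ρ.sum_eq_one (Set.mem_univ x)
    rw [finsum_eq_sum_of_fintype] at h2
    rw [← Finset.sum_smul, ← Complex.ofReal_sum, h2, Complex.ofReal_one, one_smul]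
  have h3 := (hsum Finset.univ).2
  simpa only [h1] using h3

end Stokes

/-! ### The pointwise identity and differentiation under the integral -/

section FirstVariation

variable {n r : ℕ} {X : Type*} [TopologicalSpace X] [ChartedSpace (Fin n → ℂ) X]
  [IsManifold 𝓘(ℂ, Fin n → ℂ) ω X]
  {V : X → Type*} [TopologicalSpace (TotalSpace (Fin r → ℂ) V)]
  [∀ x, AddCommGroup (V x)] [∀ x, Module ℂ (V x)] [∀ x, TopologicalSpace (V x)]
  [FiberBundle (Fin r → ℂ) V] [VectorBundle ℂ (Fin r → ℂ) V]

variable (g : HermitianMetric n n (TX n (X := X))) (φ : HiggsField n r V)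

lemma formMatrix_dPrime (h : HermitianMetric n r V) (M : ∀ x, Module.End ℂ (V x)) (p : X)
    (u : Fin n → ℂ) : formMatrix n r V (dPrime φ h M) p (center n p) u =
      covL (h.gram p) (fun y => endAt M p (pt p y)) (center n p) u
        + (adj (h.gram p (center n p)) (φ.mat p (center n p) u) * endAt M p (pt p (center n p))
          - endAt M p (pt p (center n p)) *
            adj (h.gram p (center n p)) (φ.mat p (center n p) u)) := by
  have h1 : formMatrix n r V (dPrime φ h M) p (center n p) u =
      formAt (dPrime φ h M) p (pt p (center n p)) u := rfl
  have h2 : p ∈ frameSet n (TX n) p := mem_chart_source _ p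
  rw [h1]
  conv_lhs => rw [pt_center]
  rw [formAt, dPrime]
  simp only
  rw [endToMatrix_endOfMatrix (FiberBundle.mem_baseSet_trivializationAt' p), comps_vec h2,
    chernForm_eq, delMat_eq]
  rfl

lemma coeff_add {C B : (Fin n → ℂ) → Matrix (Fin r) (Fin r) ℂ} {u : Fin n → ℂ}
    (hC : C (Complex.I • u) = Complex.I • C u) (hB : B (Complex.I • u) = -Complex.I • B u) :
    (1 / 2 : ℂ) • ((C u + B u) - Complex.I • (C (Complex.I • u) + B (Complex.I • u))) = C u ∧
    (1 / 2 : ℂ) • ((C u + B u) + Complex.I • (C (Complex.I • u) + B (Complex.I • u))) = B u := by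
  rw [hC, hB]
  constructor
  all_goals
    simp only [smul_add, smul_smul, mul_neg, Complex.I_mul_I]
    module

/-- `D'_h M` is complex linear and `[φ*_h, M]` conjugate linear in the vector, so the two summands
of `dPrime` are exactly its `(1,0)`- and `(0,1)`-parts. -/
lemma coeff_dPrime (h : HermitianMetric n r V) (M : ∀ x, Module.End ℂ (V x)) (p : X)
    (a : Fin n) :
    coeff10 (dPrime φ h M) p a =
      covL (h.gram p) (fun y => endAt M p (pt p y)) (center n p) (Pi.single a 1) ∧
    coeff01 (dPrime φ h M) p a =
      adj (h.gram p (center n p)) (φ.mat p (center n p) (Pi.single a 1))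
          * endAt M p (pt p (center n p))
        - endAt M p (pt p (center n p)) *
          adj (h.gram p (center n p)) (φ.mat p (center n p) (Pi.single a 1)) := by
  simp only [coeff10, coeff01, formMatrix_dPrime]
  refine coeff_add (C := covL (h.gram p) (fun y => endAt M p (pt p y)) (center n p))
    (B := fun u => adj (h.gram p (center n p)) (φ.mat p (center n p) u)
          * endAt M p (pt p (center n p)) - endAt M p (pt p (center n p)) *
          adj (h.gram p (center n p)) (φ.mat p (center n p) u)) ?_ ?_
  · simp only [covL]
    rw [dlM_smul, chernL_I_smul]
    simp only [smul_add, smul_sub, Matrix.smul_mul, Matrix.mul_smul]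
  · rw [(isHiggs_mat φ p).smul, adj_smul, Matrix.smul_mul, Matrix.mul_smul, ← smul_sub]
    simp

variable {ε : ℝ} {h : ℝ → HermitianMetric n r V}

lemma IsSmoothFamily.isGramFamily (hsmooth : IsSmoothFamily ε h) (p : X) :
    IsGramFamily (Set.Ioo (-ε) ε) (coordDomain n r V p) (fun t => (h t).gram p) where
  isOpen_time := isOpen_Ioo
  gram t := isGram_gram (h t) p
  smooth _ hq i j := (hsmooth p i j).contDiffAt
    (mem_of_superset ((isOpen_Ioo.prod (isOpen_coordDomain n r V p)).mem_nhds hq)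
      (Set.prod_mono_left Set.Ioo_subset_Icc_self))

variable {v : ∀ x, Module.End ℂ (V x)}

/-- With `h(s, s') = s'ᴴ G s`, the condition on `v` reads `∂ₜG = mᴴ G`. As `∂ₜG` is Hermitian, it
also equals `G m`, so `m = G⁻¹ ∂ₜG`. -/
lemma velocity_eq (hε : 0 < ε) (hsmooth : IsSmoothFamily ε h)
    (hv : ∀ x s s', HasDerivAt (fun t => (h t).form x s s') ((h 0).form x s (v x s')) 0)
    {p : X} {z : Fin n → ℂ} (hz : z ∈ coordDomain n r V p) :
    velocity (fun t => (h t).gram p) 0 z = endAt v p (pt p z) := by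
  have hfam := hsmooth.isGramFamily p
  have hq : ((0 : ℝ), z) ∈ Set.Ioo (-ε) ε ×ˢ coordDomain n r V p :=
    ⟨⟨neg_lt_zero.2 hε, hε⟩, hz⟩
  set m := endAt (r := r) v p (pt p z) with hm
  set G := (h 0).gram p z with hG
  have hd : G.det ≠ 0 := (isGram_gram (h 0) p).det_ne z hz
  have hH : Gᴴ = G := (isGram_gram (h 0) p).herm z hz
  have hvec (u : Fin r → ℂ) : v (pt p z) (vec r V p (pt p z) u) = vec r V p (pt p z) (m *ᵥ u) := by
    rw [hm, endAt, endToMatrix, LinearMap.toMatrix'_mulVec, LinearMap.comp_apply,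
      LinearMap.comp_apply, vec_comps hz.2]
  have hdt : dtM (fun t => (h t).gram p) (0, z) = mᴴ * G := by
    ext i j
    have h1 := hasDerivAt_of_joint (hfam.smooth _ hq i j)
    have h2 := hv (pt p z) (vec r V p (pt p z) (Pi.single j 1)) (vec r V p (pt p z) (Pi.single i 1))
    refine (h1.unique h2).trans ?_
    rw [hvec, form_vec, star_mulVec, ← dotProduct_mulVec, mulVec_mulVec]
    exact dotProduct_mulVec_single _ i j
  have hherm : (dtM (fun t => (h t).gram p) (0, z))ᴴ = dtM (fun t => (h t).gram p) (0, z) := by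
    have h1 := cdM_conjTranspose (c := 1) (a := (1, 0)) (b := (1, 0)) (hfam.smooth _ hq)
    rw [star_one] at h1
    refine h1.symm.trans (cdM_congr ?_)
    exact eventually_of_mem (hfam.isOpen.mem_nhds hq) fun q hq' =>
      (isGram_gram (h q.1) p).herm q.2 hq'.2
  rw [velocity, ← hherm, hdt, conjTranspose_mul, conjTranspose_conjTranspose, hH,
    nonsing_inv_mul_cancel_left _ _ hd.isUnit]

/-- Smoothness of `v` is not assumed; it is inherited from `G⁻¹ ∂ₜG`. -/
lemma isSmoothEnd_velocity (hε : 0 < ε) (hsmooth : IsSmoothFamily ε h)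
    (hv : ∀ x s s', HasDerivAt (fun t => (h t).form x s s') ((h 0).form x s (v x s')) 0) :
    IsSmoothEnd n r v := by
  intro p z hz
  have h1 := (hsmooth.isGramFamily p).smooth_velocity_slice (q := (0, z))
    ⟨⟨neg_lt_zero.2 hε, hε⟩, hz⟩
  exact SmoothMat.congr h1 (eventually_of_mem ((isOpen_coordDomain n r V p).mem_nhds hz)
    fun y hy => (velocity_eq hε hsmooth hv hy).symm)

/-- The density of the functional `2 𝒥(h t)`. -/
def density (g : HermitianMetric n n (TX n (X := X))) (φ : HiggsField n r V)
    (h : ℝ → HermitianMetric n r V) (t : ℝ) (x : X) : ℂ :=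
  (endNormSq (h t) (meanCurvature g φ (h t)) x : ℝ)

variable [ContMDiffVectorBundle ω (Fin r → ℂ) V 𝓘(ℂ, Fin n → ℂ)]

lemma formInner_dPrime (hε : 0 < ε) (hsmooth : IsSmoothFamily ε h)
    (hv : ∀ x s s', HasDerivAt (fun t => (h t).form x s s') ((h 0).form x s (v x s')) 0) (p : X) :
    formInner g (h 0) (dPrime φ (h 0) v) (dPrime φ (h 0) (meanCurvature g φ (h 0))) p =
      (meanAt g φ (h 0) p (center n p) *
        dtM (fun t y => meanAt g φ (h t) p y) (0, center n p)).trace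
      + divTrace g φ (h 0) v p := by
  have hfam := hsmooth.isGramFamily p
  have hz := center_mem n r V p
  have hq : ((0 : ℝ), center n p) ∈ Set.Ioo (-ε) ε ×ˢ coordDomain n r V p :=
    ⟨⟨neg_lt_zero.2 hε, hε⟩, hz⟩
  have hU := (isOpen_coordDomain n r V p).mem_nhds hz
  have hev : (fun y => endAt (r := r) v p (pt p y)) =ᶠ[𝓝 (center n p)]
      velocity (fun t => (h t).gram p) 0 :=
    eventually_of_mem hU fun y hy => (velocity_eq hε hsmooth hv hy).symm
  have hevK : (fun y => endAt (r := r) (meanCurvature g φ (h 0)) p (pt p y)) =ᶠ[𝓝 (center n p)]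
      meanAt g φ (h 0) p :=
    eventually_of_mem hU fun y hy => endAt_meanCurvature g φ (h 0) hy
  have h1 := (isGram_gram (h 0) p).trace_variation (Γ := g.gram p) (Φ := φ.mat p) hz
    (hfam.smooth_velocity_slice hq) (smooth_meanAt g φ (h 0) hz) fun y hy => adj_meanAt g φ (h 0) hy
  have h2 := hfam.dtM_meanL (isGram_kahler (r := r) (V := V) g p) (isHiggs_mat φ p) hq
  have h3 : divTrace g φ (h 0) v p = divL (g.gram p) (fun y u => (meanAt g φ (h 0) p y *
      covL ((h 0).gram p) (velocity (fun t => (h t).gram p) 0) y u).trace) (center n p) := by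
    simp only [divTrace, divL]
    refine Finset.sum_congr rfl fun a _ => Finset.sum_congr rfl fun b _ => ?_
    rw [db, db, cd_congr (hev.eventually_nhds.mono fun y hy => ?_)]
    rw [traceForm, covL_congr hy]
  rw [h3]
  have h4 : dtM (fun t y => meanAt g φ (h t) p y) (0, center n p) = _ := h2
  rw [h4]
  refine Eq.trans ?_ h1.symm
  simp only [formInner, gInv, (coeff_dPrime φ (h 0) _ p _).1, (coeff_dPrime φ (h 0) _ p _).2,
    covL_congr hev, covL_congr hevK, hev.eq_of_nhds, hevK.eq_of_nhds]

lemma density_eq {p : X} {z : Fin n → ℂ} (hz : z ∈ coordDomain n r V p) (t : ℝ) :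
    density g φ h t (pt p z) = (meanAt g φ (h t) p z * meanAt g φ (h t) p z).trace :=
  endNormSq_meanCurvature g φ (h t) hz

lemma hasDerivAt_density (hsmooth : IsSmoothFamily ε h) {p : X} {z : Fin n → ℂ} {t : ℝ}
    (ht : t ∈ Set.Ioo (-ε) ε) (hz : z ∈ coordDomain n r V p) :
    HasDerivAt (fun t => density g φ h t (pt p z)) (cd 1 (1, 0) (1, 0)
      (fun q : ℝ × (Fin n → ℂ) =>
        (meanAt g φ (h q.1) p q.2 * meanAt g φ (h q.1) p q.2).trace) (t, z)) t := by
  simp only [density_eq g φ hz]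
  exact hasDerivAt_of_joint (f := fun q : ℝ × (Fin n → ℂ) =>
    (meanAt g φ (h q.1) p q.2 * meanAt g φ (h q.1) p q.2).trace)
    ((hsmooth.isGramFamily p).smooth_normSq (isGram_kahler (r := r) (V := V) g p)
      (isHiggs_mat φ p) (q := (t, z)) ⟨ht, hz⟩)

lemma continuous_endNormSq (h : HermitianMetric n r V) :
    Continuous (endNormSq h (meanCurvature g φ h)) := by
  have h1 : Continuous fun x => ((endNormSq h (meanCurvature g φ h) x : ℝ) : ℂ) :=
    continuous_of_local r V (fun p z => (meanAt g φ h p z * meanAt g φ h p z).trace)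
      (fun p => ((smooth_meanAt g φ h (center_mem n r V p)).mul
        (smooth_meanAt g φ h (center_mem n r V p))).trace.continuousAt)
      fun _ _ hz => endNormSq_meanCurvature g φ h hz
  exact Complex.isometry_ofReal.isEmbedding.continuous_iff.2 h1

/-- Joint continuity bounds the time derivative on compact subsets of the time interval times `X`,
which is the domination needed below. -/
lemma continuousOn_deriv_density (hsmooth : IsSmoothFamily ε h) :
    ContinuousOn (fun q : ℝ × X => deriv (fun t => density g φ h t q.2) q.1)
      (Set.Ioo (-ε) ε ×ˢ Set.univ) := by
  rintro ⟨t, p⟩ ⟨ht, -⟩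
  refine ContinuousAt.continuousWithinAt ?_
  have hz := center_mem n r V p
  have h1 : ContinuousAt (cd 1 (1, 0) (1, 0) (fun q : ℝ × (Fin n → ℂ) =>
      (meanAt g φ (h q.1) p q.2 * meanAt g φ (h q.1) p q.2).trace)) (t, center n p) :=
    (contDiffAt_cd ((hsmooth.isGramFamily p).smooth_normSq (isGram_kahler (r := r) (V := V) g p)
      (isHiggs_mat φ p) (q := (t, center n p)) ⟨ht, hz⟩)).continuousAt
  have h2 : ContinuousAt (fun q : ℝ × X => (q.1, chartAt (Fin n → ℂ) p q.2)) (t, p) :=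
    continuousAt_fst.prodMk (ContinuousAt.comp (x := (t, p)) (f := Prod.snd)
      ((chartAt (Fin n → ℂ) p).continuousAt (mem_chart_source _ p)) continuousAt_snd)
  refine (ContinuousAt.comp (x := (t, p)) (f := fun q : ℝ × X =>
    (q.1, chartAt (Fin n → ℂ) p q.2)) h1 h2).congr ?_
  filter_upwards [(isOpen_Ioo.prod (isOpen_chartDomain n r V p)).mem_nhds
    ⟨ht, mem_chartDomain_self n r V p⟩] with q hq
  have h3 := (hasDerivAt_density g φ hsmooth hq.1 (chart_mem_coordDomain hq.2)).deriv
  rw [pt_chart n hq.2.1] at h3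
  exact h3.symm

lemma hasDerivAt_density_deriv (hsmooth : IsSmoothFamily ε h) {t : ℝ} (ht : t ∈ Set.Ioo (-ε) ε)
    (p : X) : HasDerivAt (fun t => density g φ h t p) (deriv (fun t => density g φ h t p) t) t := by
  have h1 := hasDerivAt_density g φ hsmooth ht (center_mem n r V p)
  rw [pt_center] at h1
  exact h1.differentiableAt.hasDerivAt

/-- The theorem before integration: the inner product is half the time derivative of `|K|²` plus a
divergence. -/
lemma formInner_eq (hε : 0 < ε) (hsmooth : IsSmoothFamily ε h)
    (hv : ∀ x s s', HasDerivAt (fun t => (h t).form x s s') ((h 0).form x s (v x s')) 0) (p : X) :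
    formInner g (h 0) (dPrime φ (h 0) v) (dPrime φ (h 0) (meanCurvature g φ (h 0))) p =
      (1 / 2) * deriv (fun t => density g φ h t p) 0 + divTrace g φ (h 0) v p := by
  have ht : (0 : ℝ) ∈ Set.Ioo (-ε) ε := ⟨neg_lt_zero.2 hε, hε⟩
  have h1 := hasDerivAt_density g φ hsmooth ht (center_mem n r V p)
  rw [pt_center] at h1
  have h2 := (hsmooth.isGramFamily p).cd_normSq (isGram_kahler (r := r) (V := V) g p)
    (isHiggs_mat φ p) (q := (0, center n p)) ⟨ht, center_mem n r V p⟩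
  have h3 : deriv (fun t => density g φ h t p) 0 = 2 * (meanAt g φ (h 0) p (center n p) *
      dtM (fun t y => meanAt g φ (h t) p y) (0, center n p)).trace := h1.deriv.trans h2
  rw [formInner_dPrime g φ hε hsmooth hv, h3]
  ring

variable [CompactSpace X] [MeasurableSpace X] [BorelSpace X]

lemma continuous_deriv_density (hε : 0 < ε) (hsmooth : IsSmoothFamily ε h) :
    Continuous fun x => deriv (fun t => density g φ h t x) 0 := by
  have h1 := (continuousOn_deriv_density g φ hsmooth).comp (f := fun x : X => ((0 : ℝ), x))
    (s := Set.univ) (by fun_prop) fun x _ => ⟨⟨neg_lt_zero.2 hε, hε⟩, Set.mem_univ _⟩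
  exact continuousOn_univ.1 h1

/-- Differentiation under the integral sign. -/
lemma hasDerivAt_integral_density (hε : 0 < ε) (hsmooth : IsSmoothFamily ε h) :
    HasDerivAt (fun t => ∫ x, density g φ h t x ∂(kahlerVolume g))
      (∫ x, deriv (fun t => density g φ h t x) 0 ∂(kahlerVolume g)) 0 := by
  -- A compact neighbourhood of `0` inside the open interval on which the derivative is controlled.
  have hsub : Set.Icc (-(ε / 2)) (ε / 2) ⊆ Set.Ioo (-ε) ε := fun t ht =>
    ⟨by linarith [ht.1], by linarith [ht.2]⟩
  have hcont (t : ℝ) : Continuous (density g φ h t) :=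
    Complex.continuous_ofReal.comp (continuous_endNormSq g φ (h t))
  obtain ⟨C, hC⟩ := ((isCompact_Icc (a := -(ε / 2)) (b := ε / 2)).prod
    (isCompact_univ (X := X))).exists_bound_of_continuousOn
      ((continuousOn_deriv_density g φ hsmooth).mono (Set.prod_mono_left hsub))
  refine (hasDerivAt_integral_of_dominated_loc_of_deriv_le (bound := fun _ => C)
    (F' := fun t x => deriv (fun t => density g φ h t x) t)
    (Icc_mem_nhds (a := -(ε / 2)) (b := ε / 2) (by linarith) (by linarith))
    (Eventually.of_forall fun t => (hcont t).aestronglyMeasurable)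
    ((hcont 0).integrable_of_hasCompactSupport (HasCompactSupport.of_compactSpace _))
    (continuous_deriv_density g φ hε hsmooth).aestronglyMeasurable
    (Eventually.of_forall fun x t ht => hC (t, x) ⟨ht, Set.mem_univ _⟩)
    (integrable_const C)
    (Eventually.of_forall fun x t ht => hasDerivAt_density_deriv g φ hsmooth (hsub ht) x)).2

end FirstVariation

end HiggsBundle

end

/-! ### The first variation formula -/

theorem mainTheorem4 {n r : ℕ}
    -- a compact complex manifold of dimension `n`
    {X : Type*} [TopologicalSpace X] [T2Space X] [CompactSpace X]
    [ChartedSpace (Fin n → ℂ) X] [IsManifold 𝓘(ℂ, Fin n → ℂ) ω X]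
    [MeasurableSpace X] [BorelSpace X]
    -- a holomorphic vector bundle of rank `r`
    (V : X → Type*) [TopologicalSpace (Bundle.TotalSpace (Fin r → ℂ) V)]
    [∀ x, AddCommGroup (V x)] [∀ x, Module ℂ (V x)] [∀ x, TopologicalSpace (V x)]
    [FiberBundle (Fin r → ℂ) V] [VectorBundle ℂ (Fin r → ℂ) V]
    [ContMDiffVectorBundle ω (Fin r → ℂ) V 𝓘(ℂ, Fin n → ℂ)]
    -- a Kähler metric and a Higgs field
    (g : HiggsBundle.HermitianMetric n n (HiggsBundle.TX n (X := X)))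
    (hg : HiggsBundle.IsKahler g)
    (φ : HiggsBundle.HiggsField n r V)
    -- a smooth 1-parameter family of Hermitian metrics
    (ε : ℝ) (hε : 0 < ε) (h : ℝ → HiggsBundle.HermitianMetric n r V)
    (hsmooth : HiggsBundle.IsSmoothFamily ε h)
    -- the endomorphism `v = h⁻¹ ∂ₜ hₜ` at `t = 0`, where `k(s, s') = h(s, h⁻¹k s')`
    (v : ∀ x, Module.End ℂ (V x))
    (hv : ∀ x s s', HasDerivAt (fun t => (h t).form x s s') ((h 0).form x s (v x s')) 0) :
    (∀ t, MeasureTheory.Integrable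
      (HiggsBundle.endNormSq (h t) (HiggsBundle.meanCurvature g φ (h t)))
      (HiggsBundle.kahlerVolume g)) ∧
    MeasureTheory.Integrable
      (HiggsBundle.formInner g (h 0) (HiggsBundle.dPrime φ (h 0) v)
        (HiggsBundle.dPrime φ (h 0) (HiggsBundle.meanCurvature g φ (h 0))))
      (HiggsBundle.kahlerVolume g) ∧
    HasDerivAt (fun t => ((HiggsBundle.kobayashiFunctional g φ (h t) : ℝ) : ℂ))
      ((n.factorial : ℂ) *
        HiggsBundle.l2Inner g (h 0) (HiggsBundle.dPrime φ (h 0) v)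
          (HiggsBundle.dPrime φ (h 0) (HiggsBundle.meanCurvature g φ (h 0)))) 0 := by
  have hD := (HiggsBundle.continuous_deriv_density g φ hε hsmooth).integrable_of_hasCompactSupport
    (μ := HiggsBundle.kahlerVolume g) (HasCompactSupport.of_compactSpace _)
  have hsv := HiggsBundle.isSmoothEnd_velocity hε hsmooth hv
  have hQ := (HiggsBundle.continuous_divTrace g φ (h 0) hsv).integrable_of_hasCompactSupport
    (μ := HiggsBundle.kahlerVolume g) (HasCompactSupport.of_compactSpace _)
  have hform := HiggsBundle.formInner_eq g φ hε hsmooth hv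
  refine ⟨fun t => (HiggsBundle.continuous_endNormSq g φ (h t)).integrable_of_hasCompactSupport
    (HasCompactSupport.of_compactSpace _), ?_, ?_⟩
  -- The inner product is integrable because both terms on the right of the pointwise identity are
  -- continuous on a compact space.
  · rw [funext hform]
    exact (hD.const_mul _).add hQ
  · have hint := (HiggsBundle.hasDerivAt_integral_density g φ hε hsmooth).const_mul
      ((1 / 2 : ℂ) * (n.factorial : ℂ))
    -- Integrating the pointwise identity removes the divergence; this is the only use of the Kähler
    -- condition.
    have hl2 : HiggsBundle.l2Inner g (h 0) (HiggsBundle.dPrime φ (h 0) v)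
        (HiggsBundle.dPrime φ (h 0) (HiggsBundle.meanCurvature g φ (h 0))) =
        (1 / 2) * ∫ x, deriv (fun t => HiggsBundle.density g φ h t x) 0
          ∂(HiggsBundle.kahlerVolume g) := by
      rw [HiggsBundle.l2Inner, funext hform, MeasureTheory.integral_add (hD.const_mul _) hQ,
        HiggsBundle.integral_divTrace g φ (h 0) hg hsv, add_zero, MeasureTheory.integral_const_mul]
    have hJ : (fun t => ((HiggsBundle.kobayashiFunctional g φ (h t) : ℝ) : ℂ)) = fun t =>
        (1 / 2 : ℂ) * (n.factorial : ℂ) *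
          ∫ x, HiggsBundle.density g φ h t x ∂(HiggsBundle.kahlerVolume g) := by
      funext t
      simp only [HiggsBundle.kobayashiFunctional, HiggsBundle.density, integral_complex_ofReal]
      push_cast
      ring
    rw [hl2, hJ, ← mul_assoc, mul_comm (n.factorial : ℂ)]
    exact hint
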